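/- **Definitions.** A discrete OCF game $\mathcal G=(N,\mathbf W,v)$ consists of agents $N=\{1,\dots,n\}$, integer weights $W_i\ge 0$ with maximum $W_M$, and a function $v\ge 0$ on the set of coalitions $\mathbf c\in\mathbb Z_{\ge 0}^N$, $\mathbf c\le\mathbf W$, with $v(\mathbf 0)=0$. Let $\mathrm{supp}(\mathbf c)=\{i: c^i>0\}$. The game is a 2-OCF game if $v(\mathbf c)=0$ whenever $|\mathrm{supp}(\mathbf c)|>2$. It has a tree interaction structure with tree $T=(N,E)$ if $v(\mathbf c)=0$ whenever $\mathrm{supp}(\mathbf c)$ does not induce a connected subgraph of $T$; $T$ is then part of the description of the game. The superadditive cover $v^*(\mathbf c)$ is the maximum of $\sum_j v(\mathbf c_j)$ over all finite lists of coalitions with $\sum_j\mathbf c_j=\mathbf c$. An outcome $(CS,\mathbf x)$ is a finite list $CS$ of coalitions $\mathbf c\neq\mathbf 0$ with $\sum_{\mathbf c\in CS}\mathbf c\le\mathbf W$, together with vectors $\mathbf x(\mathbf c)\in\mathbb R_{\ge 0}^N$ such that $\sum_i x^i(\mathbf c)=v(\mathbf c)$, $x^i(\mathbf c)=0$ for $i\notin\mathrm{supp}(\mathbf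 c)$, and $\sum_{\mathbf c\in CS}x^i(\mathbf c)\ge v^*(W_i\mathbf e^i)$ for all $i$, where $\mathbf e^i$ is the $i$-th unit vector. For $S\subseteq N$ let $p_S=\sum_{i\in S}\sum_{\mathbf c\in CS}x^i(\mathbf c)$, and let $CS|_S$ be the list of those $\mathbf c\in CS$ with $\mathrm{supp}(\mathbf c)\subseteq S$. A deviation $\mathbf d$ of $S$ assigns to every $\mathbf c\in CS\setminus CS|_S$ a vector $\mathbf d(\mathbf c)$ of nonnegative integers with $\mathbf d(\mathbf c)\le\mathbf c$ that vanishes outside $S$. After it, an agent $i\in S$ has the resources $r^i=W_i-\sum_{\mathbf c\in CS\setminus CS|_S}(c^i-d^i(\mathbf c))$ at its disposal; put $r^i=0$ for $i\notin S$. An arbitration function $\mathcal A$ assigns to every outcome, set $S$, deviation $\mathbf d$ of $S$ and $\mathbf c\in CS\setminus CS|_S$ a real payment $\alpha_{\mathbf c}$ to $S$. Put $\mathcal A^*(CS,\mathbf x,S)=\sup_{\mathbf d}\big(v^*(\mathbf r)+\sum_{\mathbf c\in CS\setminus CS|_S}\alpha_{\mathbf c}\big)$. The outcome is in the $\mathcal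 A$-core if $p_S\ge\mathcal A^*(CS,\mathbf x,S)$ for all $S\subseteq N$. The function $\mathcal A$ is local if, for the given game, $\alpha_{\mathbf c}$ depends only on $\mathbf c$, $\mathbf x(\mathbf c)$, $S\cap\mathrm{supp}(\mathbf c)$ and $\mathbf d(\mathbf c)$. **Theorem.** There is one algorithm which, for every 2-OCF game $\mathcal G$ with a tree interaction structure $T$, every local arbitration function $\mathcal A$, and every outcome $(CS,\mathbf x)$ in which each coalition either has as its support a single agent or two agents adjacent in $T$, or makes only the payment $0$ to all sets $S$ under all their deviations, decides whether $(CS,\mathbf x)$ is in the $\mathcal A$-core, in time at most $P(n,W_M)$ for a fixed polynomial $P$. Here the algorithm has oracle access to $v$ and $\mathcal A$ and reads $n$, $\mathbf W$, $T$, $CS$ and $\mathbf x$ entry by entry; additions, subtractions and comparisons of integers and of reals, memory accesses and oracle calls each take one step. -/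

import Mathlib

namespace OCF

/-! ### Discrete overlapping coalition formation games -/

/-- The support of a vector of contributions: the agents that contribute something. -/
def supp {n : ℕ} (c : Fin n → ℕ) : Finset (Fin n) :=
  Finset.univ.filter (fun i => 0 < c i)

/-- A discrete OCF game on the agents `Fin n` with integer weights `W`.  The characteristic
function is a map from the coalitions `c ≤ W` to the nonnegative reals; it is extended by `0` to
the vectors that are not coalitions.  The coalition to which nobody contributes is worth nothing. -/
structure Game (n : ℕ) where
  W : Fin n → ℕ
  v : (Fin n → ℕ) → ℝ
  v_nonneg : ∀ c, 0 ≤ v c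
  v_zero : v 0 = 0
  v_outside : ∀ c, ¬ c ≤ W → v c = 0

namespace Game

variable {n : ℕ} (G : Game n)

/-- The maximal weight of an agent. -/
def maxWeight : ℕ := Finset.univ.sup G.W

/-- `k`-OCF games: coalitions with more than `k` contributors are worth nothing. -/
def IsKOCF (k : ℕ) : Prop :=
  ∀ c : Fin n → ℕ, c ≤ G.W → k < (supp c).card → G.v c = 0

open Classical in
/-- The game reduced to a graph `Γ`: coalitions keep their value if their support induces a
connected subgraph of `Γ`, all others are worth nothing. -/
noncomputable def reduce (Γ : SimpleGraph (Fin n)) : Game n where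
  W := G.W
  v c := if (Γ.induce (supp c : Set (Fin n))).Connected then G.v c else 0
  v_nonneg c := by split_ifs <;> simp [G.v_nonneg]
  v_zero := by simp [G.v_zero]
  v_outside c hc := by simp [G.v_outside c hc]

/-- The superadditive cover `v*`: the largest total value of a coalition structure (a finite
multiset of coalitions) of weight `c`. -/
noncomputable def cover (c : Fin n → ℕ) : ℝ :=
  sSup {r : ℝ | ∃ CS : Multiset (Fin n → ℕ), CS.sum = c ∧ r = (CS.map G.v).sum}

end Game

/-- An outcome `(CS, x)`: a finite list of coalitions `coal k` (with at least one contributor each)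
in which no agent exceeds its weight, with an imputation `pay` that divides the value of every
coalition among its contributors and is individually rational. -/
structure Outcome {n : ℕ} (G : Game n) where
  m : ℕ
  coal : Fin m → Fin n → ℕ
  coal_nonempty : ∀ k, (supp (coal k)).Nonempty
  weight_le : ∀ i, ∑ k, coal k i ≤ G.W i
  pay : Fin m → Fin n → ℝ
  pay_nonneg : ∀ k i, 0 ≤ pay k i
  efficient : ∀ k, ∑ i, pay k i = G.v (coal k)
  no_side_payments : ∀ k i, i ∉ supp (coal k) → pay k i = 0
  rational : ∀ i, G.cover (Pi.single i (G.W i)) ≤ ∑ k, pay k i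

namespace Outcome

variable {n : ℕ} {G : Game n} (o : Outcome G)

/-- The total payoff of the set `S`. -/
def payoff (S : Finset (Fin n)) : ℝ := ∑ i ∈ S, ∑ k, o.pay k i

/-- The indices of the coalitions in `CS \ CS|_S`, those not fully controlled by `S`. -/
def outer (S : Finset (Fin n)) : Finset (Fin o.m) :=
  Finset.univ.filter (fun k => ¬ supp (o.coal k) ⊆ S)

end Outcome

/-- A deviation of `S`: from every coalition that `S` does not fully control, the members of `S`
withdraw part of what they have contributed to it. -/
structure Deviation {n : ℕ} {G : Game n} (o : Outcome G) (S : Finset (Fin n)) where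
  withdraw : Fin o.m → Fin n → ℕ
  le_coal : ∀ k, withdraw k ≤ o.coal k
  only_members : ∀ k i, i ∉ S → withdraw k i = 0
  only_outer : ∀ k, k ∉ o.outer S → withdraw k = 0

/-- The resources available to `S` after a deviation: a member of `S` has at its disposal
everything except what it has left in the coalitions that `S` does not fully control. -/
def Deviation.available {n : ℕ} {G : Game n} {o : Outcome G} {S : Finset (Fin n)}
    (D : Deviation o S) : Fin n → ℕ := fun i =>
  if i ∈ S then G.W i - ∑ k ∈ o.outer S, (o.coal k i - D.withdraw k i) else 0

/-- An arbitration function for the game `G`: given an outcome, a set `S` and a deviation of `S`,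
it says what every coalition of the outcome pays to `S`.  (Only the payments of the coalitions
that are not fully controlled by `S` are ever used.) -/
abbrev Arbitration {n : ℕ} (G : Game n) : Type :=
  (o : Outcome G) → (S : Finset (Fin n)) → Deviation o S → Fin o.m → ℝ

namespace Arbitration

variable {n : ℕ} {G : Game n} (A : Arbitration G)

/-- `A` is local: the payment of a coalition `c` to `S` depends only on `c`, on how its value is
divided, on which contributors of `c` deviate, and on what these withdraw from `c`. -/
def IsLocal : Prop :=
  ∀ (o o' : Outcome G) (S S' : Finset (Fin n)) (D : Deviation o S) (D' : Deviation o' S')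
    (k : Fin o.m) (k' : Fin o'.m), k ∈ o.outer S → k' ∈ o'.outer S' →
    o.coal k = o'.coal k' → o.pay k = o'.pay k' →
    S ∩ supp (o.coal k) = S' ∩ supp (o.coal k) → D.withdraw k = D'.withdraw k' →
    A o S D k = A o' S' D' k'

/-- What `S` obtains from a deviation when it uses the available resources optimally. -/
noncomputable def value (o : Outcome G) (S : Finset (Fin n)) (D : Deviation o S) : ℝ :=
  G.cover D.available + ∑ k ∈ o.outer S, A o S D k

/-- `A*`: the most that `S` can get by deviating. -/
noncomputable def best (o : Outcome G) (S : Finset (Fin n)) : ℝ :=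
  ⨆ D : Deviation o S, A.value o S D

/-- The outcome is in the `A`-core: no set has positive excess. -/
def InCore (o : Outcome G) : Prop :=
  ∀ S : Finset (Fin n), A.best o S ≤ o.payoff S

/-- Every coalition of the outcome either consists of one agent or of two agents that are adjacent
in `T`, or it pays nothing to deviators, whatever they do. -/
def Admissible (T : SimpleGraph (Fin n)) (o : Outcome G) : Prop :=
  ∀ k : Fin o.m,
    ((supp (o.coal k)).card ≤ 2 ∧ (T.induce (supp (o.coal k) : Set (Fin n))).Connected) ∨
    (∀ (S : Finset (Fin n)) (D : Deviation o S), k ∈ o.outer S → A o S D k = 0)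

end Arbitration

/-! ### The machine model

Algorithms are programs of a small imperative language that works on natural numbers and on real
numbers, with unit-cost arithmetic (addition, subtraction and comparison only) and with oracle
access to the instance.  Every program is a finite piece of syntax and does not depend on the
instance.  Loops have a bound that is computed at run time; every iteration is charged.  Such
programs can be executed by a unit-cost random access machine with real registers, with the same
running time up to a constant factor. -/

/-- What a program can ask about an instance, one entry at a time. -/
structure Oracle where
  /-- the number of agents -/
  agents : ℕ
  /-- the weight of agent `i` -/
  weight : ℕ → ℕ
  /-- `1` if `i` and `j` are adjacent in the interaction tree, `0` otherwise -/
  edge : ℕ → ℕ → ℕ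
  /-- the number of coalitions in the given outcome -/
  coalitions : ℕ
  /-- the contribution of agent `i` to the `k`-th coalition -/
  contrib : ℕ → ℕ → ℕ
  /-- the payoff of agent `i` from the `k`-th coalition -/
  pay : ℕ → ℕ → ℝ
  /-- the value of the coalition to which `i` contributes `a` and `j` contributes `b` -/
  val : ℕ → ℕ → ℕ → ℕ → ℝ
  /-- what the `k`-th coalition pays to agent `i` alone, if `i` withdraws `d` from this coalition
  and nothing from the others -/
  arb : ℕ → ℕ → ℕ → ℝ

/-- Expressions for natural numbers.  The expression `get a x y z` is the entry at `(x, y, z)` of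
the array with name `a`. -/
inductive NExp : Type
  | lit (c : ℕ)
  | get (a : ℕ) (x y z : NExp)
  | add (x y : NExp)
  | sub (x y : NExp)
  | agents
  | weight (i : NExp)
  | edge (i j : NExp)
  | coalitions
  | contrib (k i : NExp)

/-- Expressions for real numbers. -/
inductive RExp : Type
  | zero
  | get (a : ℕ) (x y z : NExp)
  | add (x y : RExp)
  | sub (x y : RExp)
  | pay (k i : NExp)
  | val (i a j b : NExp)
  | arb (k i d : NExp)

/-- Tests. -/
inductive BExp : Type
  | nle (x y : NExp)
  | rle (x y : RExp)
  | neg (b : BExp)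
  | and (b c : BExp)

/-- Programs. -/
inductive Prog : Type
  | skip
  | setN (a : ℕ) (x y z : NExp) (e : NExp)
  | setR (a : ℕ) (x y z : NExp) (e : RExp)
  | seq (p q : Prog)
  | ite (b : BExp) (p q : Prog)
  | loop (a : ℕ) (bound : NExp) (body : Prog)

/-- The memory: named three-dimensional arrays of natural numbers and of real numbers. -/
structure Mem where
  nat : ℕ → ℕ → ℕ → ℕ → ℕ
  real : ℕ → ℕ → ℕ → ℕ → ℝ

/-- The initial memory. -/
def Mem.init : Mem := ⟨fun _ _ _ _ => 0, fun _ _ _ _ => 0⟩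

def Mem.setNat (s : Mem) (a x y z c : ℕ) : Mem :=
  { s with nat := fun a' x' y' z' =>
      if a' = a ∧ x' = x ∧ y' = y ∧ z' = z then c else s.nat a' x' y' z' }

noncomputable def Mem.setReal (s : Mem) (a x y z : ℕ) (r : ℝ) : Mem :=
  { s with real := fun a' x' y' z' =>
      if a' = a ∧ x' = x ∧ y' = y ∧ z' = z then r else s.real a' x' y' z' }

noncomputable def NExp.eval (O : Oracle) (s : Mem) : NExp → ℕ
  | lit c => c
  | get a x y z => s.nat a (x.eval O s) (y.eval O s) (z.eval O s)
  | add x y => x.eval O s + y.eval O s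
  | sub x y => x.eval O s - y.eval O s
  | agents => O.agents
  | weight i => O.weight (i.eval O s)
  | edge i j => O.edge (i.eval O s) (j.eval O s)
  | coalitions => O.coalitions
  | contrib k i => O.contrib (k.eval O s) (i.eval O s)

noncomputable def RExp.eval (O : Oracle) (s : Mem) : RExp → ℝ
  | zero => 0
  | get a x y z => s.real a (x.eval O s) (y.eval O s) (z.eval O s)
  | add x y => x.eval O s + y.eval O s
  | sub x y => x.eval O s - y.eval O s
  | pay k i => O.pay (k.eval O s) (i.eval O s)
  | val i a j b => O.val (i.eval O s) (a.eval O s) (j.eval O s) (b.eval O s)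
  | arb k i d => O.arb (k.eval O s) (i.eval O s) (d.eval O s)

def BExp.Holds (O : Oracle) (s : Mem) : BExp → Prop
  | nle x y => x.eval O s ≤ y.eval O s
  | rle x y => x.eval O s ≤ y.eval O s
  | neg b => ¬ b.Holds O s
  | and b c => b.Holds O s ∧ c.Holds O s

/-- The time needed to evaluate an expression: one step for every operation, memory access and
oracle call. -/
def NExp.cost : NExp → ℕ
  | lit _ => 1
  | get _ x y z => x.cost + y.cost + z.cost + 1
  | add x y => x.cost + y.cost + 1
  | sub x y => x.cost + y.cost + 1
  | agents => 1
  | weight i => i.cost + 1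
  | edge i j => i.cost + j.cost + 1
  | coalitions => 1
  | contrib k i => k.cost + i.cost + 1

/-- The time needed to evaluate an expression, counted in the same way. -/
def RExp.cost : RExp → ℕ
  | zero => 1
  | get _ x y z => x.cost + y.cost + z.cost + 1
  | add x y => x.cost + y.cost + 1
  | sub x y => x.cost + y.cost + 1
  | pay k i => k.cost + i.cost + 1
  | val i a j b => i.cost + a.cost + j.cost + b.cost + 1
  | arb k i d => k.cost + i.cost + d.cost + 1

/-- The time needed to evaluate a test, counted in the same way. -/
def BExp.cost : BExp → ℕ
  | nle x y => x.cost + y.cost + 1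
  | rle x y => x.cost + y.cost + 1
  | neg b => b.cost + 1
  | and b c => b.cost + c.cost + 1

/-- Perform `step 0, …, step (m - 1)` one after the other, adding up the time. -/
def iterate (step : ℕ → Mem → Mem × ℕ) : ℕ → Mem → Mem × ℕ
  | 0, s => (s, 0)
  | m + 1, s =>
    let r := iterate step m s
    let q := step m r.1
    (q.1, r.2 + q.2)

open Classical in
/-- Run a program: the final memory and the number of steps.  In `loop a bound body` the entry
`(0, 0, 0)` of the array `a` is the loop counter, which runs from `0` to `bound - 1`. -/
noncomputable def Prog.run (O : Oracle) : Prog → Mem → Mem × ℕ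
  | skip, s => (s, 1)
  | setN a x y z e, s =>
    (s.setNat a (x.eval O s) (y.eval O s) (z.eval O s) (e.eval O s),
      x.cost + y.cost + z.cost + e.cost + 1)
  | setR a x y z e, s =>
    (s.setReal a (x.eval O s) (y.eval O s) (z.eval O s) (e.eval O s),
      x.cost + y.cost + z.cost + e.cost + 1)
  | seq p q, s =>
    let r := p.run O s
    let t := q.run O r.1
    (t.1, r.2 + t.2)
  | ite b p q, s =>
    let r := if b.Holds O s then p.run O s else q.run O s
    (r.1, b.cost + r.2 + 1)
  | loop a bound body, s =>
    let r := iterate (fun i u =>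
      let t := body.run O (u.setNat a 0 0 0 i)
      (t.1, t.2 + 1)) (bound.eval O s) s
    (r.1, bound.cost + r.2 + 1)

/-- A program accepts if it ends with a `1` at the entry `(0, 0, 0)` of array `0`. -/
def Prog.Accepts (p : Prog) (O : Oracle) : Prop :=
  (p.run O Mem.init).1.nat 0 0 0 0 = 1

/-- The running time of a program. -/
noncomputable def Prog.time (p : Prog) (O : Oracle) : ℕ :=
  (p.run O Mem.init).2

/-! ### Oracle access to an instance -/

/-- The set that consists of the agent with number `i`; it is empty if there is none. -/
def agentSet (n i : ℕ) : Finset (Fin n) :=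
  Finset.univ.filter (fun j => j.val = i)

/-- The vector whose entry at the agent with number `i` is `a`, the other entries being `0`. -/
def agentVec (n i a : ℕ) : Fin n → ℕ :=
  fun j => if j.val = i then a else 0

open Classical in
/-- The oracle of the instance given by a game, its interaction tree, an arbitration function and
an outcome.  Queries about agents or coalitions that do not exist are answered by `0`, except that
`arb k i d` with `n ≤ i` is the payment of the `k`-th coalition to the empty set; queries about
withdrawals that are not deviations are answered by `0`. -/
noncomputable def oracle {n : ℕ} (G : Game n) (T : SimpleGraph (Fin n)) (A : Arbitration G)
    (o : Outcome G) : Oracle where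
  agents := n
  weight i := if h : i < n then G.W ⟨i, h⟩ else 0
  edge i j := if ∃ (hi : i < n) (hj : j < n), T.Adj ⟨i, hi⟩ ⟨j, hj⟩ then 1 else 0
  coalitions := o.m
  contrib k i := if h : k < o.m ∧ i < n then o.coal ⟨k, h.1⟩ ⟨i, h.2⟩ else 0
  pay k i := if h : k < o.m ∧ i < n then o.pay ⟨k, h.1⟩ ⟨i, h.2⟩ else 0
  val i a j b := G.v (agentVec n i a + agentVec n j b)
  arb k i d :=
    if h : k < o.m ∧ ∃ D : Deviation o (agentSet n i),
        ∀ l, D.withdraw l = if l.val = k then agentVec n i d else 0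
    then A o (agentSet n i) h.2.choose ⟨k, h.1⟩ else 0

end OCF

/-! The outcome is in the core iff the largest excess, over all sets `S` and all deviations, is at
most zero. On a tree this excess is a sum of terms that belong to single vertices and single edges,
so it can be maximized by dynamic programming.

Why it is such a sum: only coalitions of one agent or of two adjacent agents have a value. Hence the
members of `S` use their resources optimally by splitting them into a private part and one part for
each edge inside `S`, and the cover becomes a sum of covers of single agents and of adjacent pairs
(`exists_cover_decomposition`, `sum_cover_add_edgeSum_le`). The payments split as well
(`sum_payments`): by locality, a single or pair coalition without members of `S` pays what it pays
to the empty set, and a pair coalition with exactly one member `i` pays according to what `i`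
withdraws from it; by admissibility, all other coalitions outside the control of `S` pay nothing.
For an edge that leaves `S` it therefore suffices to know the best total payment of its pair
coalitions when the member leaves at most `b` units in them (`Oracle.retSet`).

So every vertex chooses a state, deviating or not, and divides its weight between itself and its
edges; on an edge to an outsider, the budget is what stays in the old coalitions. The outcome is in
the core iff no such choice has a positive objective (`inCore_of_nonPos`, `nonPos_of_inCore`). For a
given state and budget of its neighbour, the best reaction of a leaf is a maximum over polynomially
many options, and adding it to the vertex term of the neighbour eliminates the leaf
(`IsLeaf.nonPos_erase`). When one vertex is left, two numbers are compared with zero. The tables of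
covers and payments come from knapsack recursions (`Game.isLUB_cover`,
`Oracle.isGreatest_retSet_succ`).

Correctness of the program is shown with loop invariants and frame rules. Its running time is read
off the syntax (`Prog.Static.time_le`), since all loop bounds are polynomial in `n` and the maximal
weight: there are at most `n` times the maximal weight coalitions, as each of them uses at least one
unit. -/

namespace OCF

/-! ### Reasoning about programs -/

/-- The memory after a run. -/
noncomputable def Prog.ex (O : Oracle) (p : Prog) (s : Mem) : Mem := (p.run O s).1

section Semantics

variable (O : Oracle) (s : Mem)

@[simp] theorem Prog.ex_skip : Prog.skip.ex O s = s := rfl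

@[simp] theorem Prog.ex_setN (a : ℕ) (x y z e : NExp) :
    (Prog.setN a x y z e).ex O s =
      s.setNat a (x.eval O s) (y.eval O s) (z.eval O s) (e.eval O s) := rfl

@[simp] theorem Prog.ex_setR (a : ℕ) (x y z : NExp) (e : RExp) :
    (Prog.setR a x y z e).ex O s =
      s.setReal a (x.eval O s) (y.eval O s) (z.eval O s) (e.eval O s) := rfl

@[simp] theorem Prog.ex_seq (p q : Prog) : (Prog.seq p q).ex O s = q.ex O (p.ex O s) := rfl

theorem Prog.ex_ite_pos {b : BExp} (p q : Prog) (h : b.Holds O s) :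
    (Prog.ite b p q).ex O s = p.ex O s := by
  simp [Prog.ex, Prog.run, h]

theorem Prog.ex_ite_neg {b : BExp} (p q : Prog) (h : ¬ b.Holds O s) :
    (Prog.ite b p q).ex O s = q.ex O s := by
  simp [Prog.ex, Prog.run, h]

/-- The invariant rule for loops. -/
theorem Prog.ex_loop_induction {a : ℕ} {bound : NExp} {body : Prog} {N : ℕ} (Inv : ℕ → Mem → Prop)
    (hN : bound.eval O s = N) (h0 : Inv 0 s)
    (hstep : ∀ i < N, ∀ u, Inv i u → Inv (i + 1) (body.ex O (u.setNat a 0 0 0 i))) :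
    Inv N ((Prog.loop a bound body).ex O s) := by
  subst hN
  simp only [Prog.ex, Prog.run]
  have key : ∀ m ≤ bound.eval O s, Inv m (iterate (fun i u =>
      let t := body.run O (u.setNat a 0 0 0 i)
      (t.1, t.2 + 1)) m s).1 := by
    intro m
    induction m with
    | zero => intro _; exact h0
    | succ m ih =>
      intro hm
      exact hstep m hm _ (ih (by omega))
  exact key _ le_rfl

end Semantics

@[simp] theorem Mem.setNat_real (s : Mem) (a x y z c : ℕ) : (s.setNat a x y z c).real = s.real := rfl

@[simp] theorem Mem.setReal_nat (s : Mem) (a x y z : ℕ) (r : ℝ) :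
    (s.setReal a x y z r).nat = s.nat := rfl

theorem Mem.setNat_nat (s : Mem) (a x y z c a' x' y' z' : ℕ) :
    (s.setNat a x y z c).nat a' x' y' z' =
      if a' = a ∧ x' = x ∧ y' = y ∧ z' = z then c else s.nat a' x' y' z' := rfl

theorem Mem.setReal_real (s : Mem) (a x y z a' x' y' z' : ℕ) (r : ℝ) :
    (s.setReal a x y z r).real a' x' y' z' =
      if a' = a ∧ x' = x ∧ y' = y ∧ z' = z then r else s.real a' x' y' z' := rfl

@[simp] theorem Mem.setNat_nat_self (s : Mem) (a x y z c : ℕ) :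
    (s.setNat a x y z c).nat a x y z = c := by
  simp [Mem.setNat_nat]

@[simp] theorem Mem.setReal_real_self (s : Mem) (a x y z : ℕ) (r : ℝ) :
    (s.setReal a x y z r).real a x y z = r := by
  simp [Mem.setReal_real]

theorem Mem.setNat_nat_of_ne (s : Mem) {a a' : ℕ} (x y z c : ℕ) (h : a' ≠ a) :
    (s.setNat a x y z c).nat a' = s.nat a' := by
  funext x' y' z'
  simp [Mem.setNat_nat, h]

theorem Mem.setReal_real_of_ne (s : Mem) {a a' : ℕ} (x y z : ℕ) (r : ℝ) (h : a' ≠ a) :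
    (s.setReal a x y z r).real a' = s.real a' := by
  funext x' y' z'
  simp [Mem.setReal_real, h]

/-- The names of the arrays of natural numbers that a program may change. -/
def Prog.writesN : Prog → List ℕ
  | skip => []
  | setN a _ _ _ _ => [a]
  | setR _ _ _ _ _ => []
  | seq p q => p.writesN ++ q.writesN
  | ite _ p q => p.writesN ++ q.writesN
  | loop a _ p => a :: p.writesN

/-- The names of the arrays of real numbers that a program may change. -/
def Prog.writesR : Prog → List ℕ
  | skip => []
  | setN _ _ _ _ _ => []
  | setR a _ _ _ _ => [a]
  | seq p q => p.writesR ++ q.writesR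
  | ite _ p q => p.writesR ++ q.writesR
  | loop _ _ p => p.writesR

/-- The frame rule. The list of written arrays is computed from the syntax alone, so for a concrete
program the hypothesis is settled by `decide` or `simp`. -/
theorem Prog.ex_nat_eq (O : Oracle) (p : Prog) {a : ℕ} (s : Mem) (h : a ∉ p.writesN) :
    (p.ex O s).nat a = s.nat a := by
  induction p generalizing s with
  | skip => rfl
  | setN b x y z e =>
    exact Mem.setNat_nat_of_ne _ _ _ _ _ (by simpa [Prog.writesN] using h)
  | setR b x y z e => rfl
  | seq p q hp hq =>
    simp only [Prog.writesN, List.mem_append, not_or] at h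
    rw [Prog.ex_seq, hq _ h.2, hp _ h.1]
  | ite b p q hp hq =>
    simp only [Prog.writesN, List.mem_append, not_or] at h
    by_cases hb : b.Holds O s
    · rw [Prog.ex_ite_pos _ _ _ _ hb, hp _ h.1]
    · rw [Prog.ex_ite_neg _ _ _ _ hb, hq _ h.2]
  | loop b bd p hp =>
    simp only [Prog.writesN, List.mem_cons, not_or] at h
    refine Prog.ex_loop_induction O s (fun _ u => u.nat a = s.nat a) rfl rfl ?_
    intro i _ u hu
    rw [hp _ h.2, Mem.setNat_nat_of_ne _ _ _ _ _ h.1, hu]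

theorem Prog.ex_real_eq (O : Oracle) (p : Prog) {a : ℕ} (s : Mem) (h : a ∉ p.writesR) :
    (p.ex O s).real a = s.real a := by
  induction p generalizing s with
  | skip => rfl
  | setN b x y z e => rfl
  | setR b x y z e =>
    exact Mem.setReal_real_of_ne _ _ _ _ _ (by simpa [Prog.writesR] using h)
  | seq p q hp hq =>
    simp only [Prog.writesR, List.mem_append, not_or] at h
    rw [Prog.ex_seq, hq _ h.2, hp _ h.1]
  | ite b p q hp hq =>
    simp only [Prog.writesR, List.mem_append, not_or] at h
    by_cases hb : b.Holds O s
    · rw [Prog.ex_ite_pos _ _ _ _ hb, hp _ h.1]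
    · rw [Prog.ex_ite_neg _ _ _ _ hb, hq _ h.2]
  | loop b bd p hp =>
    simp only [Prog.writesR] at h
    refine Prog.ex_loop_induction O s (fun _ u => u.real a = s.real a) rfl rfl ?_
    intro i _ u hu
    rw [hp _ h, Mem.setNat_real, hu]

/-! ### Running times -/

/-- The value of the expression has a bound that does not depend on the memory. -/
def NExp.Static : NExp → Prop
  | lit _ => True
  | add x y => x.Static ∧ y.Static
  | sub x _ => x.Static
  | agents => True
  | weight _ => True
  | coalitions => True
  | _ => False

/-- A bound on the value of a static expression, in terms of the number of agents and of the
maximal weight. -/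
noncomputable def NExp.bound : NExp → MvPolynomial (Fin 2) ℕ
  | lit c => MvPolynomial.C c
  | add x y => x.bound + y.bound
  | sub x _ => x.bound
  | agents => MvPolynomial.X 0
  | weight _ => MvPolynomial.X 1
  | coalitions => MvPolynomial.X 0 * MvPolynomial.X 1
  | _ => 0

/-- All loops of the program have static bounds. -/
def Prog.Static : Prog → Prop
  | seq p q => p.Static ∧ q.Static
  | ite _ p q => p.Static ∧ q.Static
  | loop _ b p => b.Static ∧ p.Static
  | _ => True

/-- A bound on the running time of a program with static loop bounds. -/
noncomputable def Prog.timeBound : Prog → MvPolynomial (Fin 2) ℕ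
  | skip => 1
  | setN _ x y z e => MvPolynomial.C (x.cost + y.cost + z.cost + e.cost + 1)
  | setR _ x y z e => MvPolynomial.C (x.cost + y.cost + z.cost + e.cost + 1)
  | seq p q => p.timeBound + q.timeBound
  | ite b p q => MvPolynomial.C b.cost + (p.timeBound + q.timeBound) + 1
  | loop _ b p => MvPolynomial.C b.cost + b.bound * (p.timeBound + 1) + 1

/-- Truncated subtraction never exceeds its first operand, so only that operand has to be static. -/
theorem NExp.Static.eval_le {O : Oracle} {N W : ℕ} (hN : O.agents ≤ N) (hW : ∀ i, O.weight i ≤ W)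
    (hm : O.coalitions ≤ N * W) {e : NExp} (he : e.Static) (s : Mem) :
    e.eval O s ≤ MvPolynomial.eval ![N, W] e.bound := by
  induction e with
  | lit c => simp [NExp.eval, NExp.bound]
  | add x y hx hy =>
    simp only [NExp.eval, NExp.bound, map_add]
    exact add_le_add (hx he.1) (hy he.2)
  | sub x y hx hy =>
    simp only [NExp.eval, NExp.bound]
    exact (Nat.sub_le _ _).trans (hx he)
  | agents => simpa [NExp.eval, NExp.bound] using hN
  | weight i => simpa [NExp.eval, NExp.bound] using hW _
  | coalitions => simpa [NExp.eval, NExp.bound] using hm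
  | get => exact he.elim
  | edge => exact he.elim
  | contrib => exact he.elim

/-- A loop bound is evaluated once and is bounded independently of the memory, so a loop costs at
most this bound times a bound for its body. For a branching, the sum of both branches bounds either
one. -/
theorem Prog.Static.time_le {O : Oracle} {N W : ℕ} (hN : O.agents ≤ N) (hW : ∀ i, O.weight i ≤ W)
    (hm : O.coalitions ≤ N * W) {p : Prog} (hp : p.Static) (s : Mem) :
    (p.run O s).2 ≤ MvPolynomial.eval ![N, W] p.timeBound := by
  induction p generalizing s with
  | skip => simp [Prog.run, Prog.timeBound]
  | setN => simp [Prog.run, Prog.timeBound]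
  | setR => simp [Prog.run, Prog.timeBound]
  | seq p q ihp ihq =>
    simp only [Prog.run, Prog.timeBound, map_add]
    exact add_le_add (ihp hp.1 _) (ihq hp.2 _)
  | ite b p q ihp ihq =>
    simp only [Prog.run, Prog.timeBound, map_add, map_one, MvPolynomial.eval_C]
    have h1 := ihp hp.1 s
    have h2 := ihq hp.2 s
    split_ifs <;> omega
  | loop a b p ihp =>
    simp only [Prog.run, Prog.timeBound, map_add, map_mul, map_one, MvPolynomial.eval_C]
    have key : ∀ m, (iterate (fun i u =>
        let t := p.run O (u.setNat a 0 0 0 i)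
        (t.1, t.2 + 1)) m s).2 ≤ m * (MvPolynomial.eval ![N, W] p.timeBound + 1) := by
      intro m
      induction m with
      | zero => simp [iterate]
      | succ m ih =>
        rw [add_mul, one_mul]
        exact add_le_add ih (Nat.add_le_add_right (ihp hp.2 _) 1)
    refine Nat.add_le_add_right (Nat.add_le_add_left ?_ _) 1
    exact (key _).trans (Nat.mul_le_mul_right _ (hp.1.eval_le hN hW hm s))

/-! ### Loops that maximize -/

/-- From `s` to `t` the entry `(x, y, z)` of the real array `a` is replaced by the maximum of its
old value and the elements of `S`; except for this, only nat arrays with names in `C` change. -/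
structure MaxStep (C : List ℕ) (a x y z : ℕ) (S : Set ℝ) (s t : Mem) : Prop where
  nat_eq : ∀ b ∉ C, t.nat b = s.nat b
  real_eq : ∀ a' x' y' z', ¬ (a' = a ∧ x' = x ∧ y' = y ∧ z' = z) →
    t.real a' x' y' z' = s.real a' x' y' z'
  old_le : s.real a x y z ≤ t.real a x y z
  le : ∀ r ∈ S, r ≤ t.real a x y z
  mem : t.real a x y z = s.real a x y z ∨ t.real a x y z ∈ S

namespace MaxStep

variable {C : List ℕ} {a x y z : ℕ} {s t u : Mem}

theorem refl (C : List ℕ) (a x y z : ℕ) (s : Mem) : MaxStep C a x y z ∅ s s where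
  nat_eq _ _ := rfl
  real_eq _ _ _ _ _ := rfl
  old_le := le_rfl
  le _ h := h.elim
  mem := Or.inl rfl

theorem trans {S S' : Set ℝ} (h : MaxStep C a x y z S s t) (h' : MaxStep C a x y z S' t u) :
    MaxStep C a x y z (S ∪ S') s u where
  nat_eq b hb := (h'.nat_eq b hb).trans (h.nat_eq b hb)
  real_eq a' x' y' z' hn := (h'.real_eq a' x' y' z' hn).trans (h.real_eq a' x' y' z' hn)
  old_le := h.old_le.trans h'.old_le
  le r hr := hr.elim (fun hr => (h.le r hr).trans h'.old_le) (h'.le r)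
  mem := by
    rcases h'.mem with h1 | h1
    · rw [h1]
      exact h.mem.imp_right Or.inl
    · exact Or.inr (Or.inr h1)

theorem setNat {b : ℕ} (hb : b ∈ C) (i : ℕ) (s : Mem) :
    MaxStep C a x y z ∅ s (s.setNat b 0 0 0 i) where
  nat_eq b' hb' := Mem.setNat_nat_of_ne _ _ _ _ _ (by rintro rfl; exact hb' hb)
  real_eq _ _ _ _ _ := rfl
  old_le := le_rfl
  le _ h := h.elim
  mem := Or.inl rfl

theorem mono {C' : List ℕ} {S S' : Set ℝ} (h : MaxStep C a x y z S s t) (hC : C ⊆ C')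
    (hS : S = S') : MaxStep C' a x y z S' s t := by
  subst hS
  exact { h with nat_eq := fun b hb => h.nat_eq b fun hb' => hb (hC hb') }

theorem nat_val {S : Set ℝ} (h : MaxStep C a x y z S s t) {b : ℕ} (hb : b ∉ C) (x' y' z' : ℕ) :
    t.nat b x' y' z' = s.nat b x' y' z' := by
  rw [h.nat_eq b hb]

/-- The initial entry counts as a candidate. Payments may be negative, so programs that maximize
over them have to start from a genuine candidate and not from zero. -/
theorem isGreatest {S : Set ℝ} (h : MaxStep C a x y z S s t) :
    IsGreatest (insert (s.real a x y z) S) (t.real a x y z) := by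
  refine ⟨h.mem, ?_⟩
  rintro r (rfl | hr)
  · exact h.old_le
  · exact h.le r hr

/-- A loop around maximizing steps maximizes over the union of the sets of candidates. -/
theorem loop {O : Oracle} {b : ℕ} {bound : NExp} {body : Prog} {N : ℕ} (S : ℕ → Set ℝ)
    (hN : bound.eval O s = N) (hb : b ∈ C)
    -- The body may rely on the earlier iterations having changed nothing but the entry and the
    -- counters; which candidates `T` they went through is irrelevant.
    (hstep : ∀ i < N, ∀ u T, MaxStep C a x y z T s u → u.nat b 0 0 0 = i →
      MaxStep C a x y z (S i) u (body.ex O u)) :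
    MaxStep C a x y z {r | ∃ i < N, r ∈ S i} s ((Prog.loop b bound body).ex O s) := by
  refine Prog.ex_loop_induction O s
    (fun m u => MaxStep C a x y z {r | ∃ i < m, r ∈ S i} s u) hN ?_ ?_
  · refine (refl C a x y z s).mono (List.Subset.refl _) ?_
    ext r
    simp
  · intro i hi u hu
    have h1 := hu.trans (setNat hb i u)
    refine (h1.trans (hstep i hi _ _ h1 (by simp))).mono (List.Subset.refl _) ?_
    ext r
    simp only [Set.union_empty, Set.mem_union, Set.mem_ofPred_eq]
    constructor
    · rintro (⟨j, hj, hr⟩ | hr)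
      · exact ⟨j, by omega, hr⟩
      · exact ⟨i, by omega, hr⟩
    · rintro ⟨j, hj, hr⟩
      rcases Nat.lt_succ_iff_lt_or_eq.1 hj with h | rfl
      · exact Or.inl ⟨j, h, hr⟩
      · exact Or.inr hr

end MaxStep

/-- Replace an array entry by its maximum with the value of an expression. -/
def Prog.upd (a : ℕ) (x y z : NExp) (e : RExp) : Prog :=
  .ite (.rle e (.get a x y z)) .skip (.setR a x y z e)

theorem MaxStep.upd (C : List ℕ) {O : Oracle} {a : ℕ} {x y z : NExp} {e : RExp} {s : Mem} :
    MaxStep C a (x.eval O s) (y.eval O s) (z.eval O s) {e.eval O s} s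
      ((Prog.upd a x y z e).ex O s) := by
  by_cases h : (BExp.rle e (.get a x y z)).Holds O s
  · rw [Prog.upd, Prog.ex_ite_pos _ _ _ _ h]
    simp only [BExp.Holds, RExp.eval] at h
    exact ⟨fun _ _ => rfl, fun _ _ _ _ _ => rfl, le_rfl, by simpa using h, Or.inl rfl⟩
  · rw [Prog.upd, Prog.ex_ite_neg _ _ _ _ h]
    simp only [BExp.Holds, RExp.eval, not_le] at h
    refine ⟨fun _ _ => rfl, fun a' x' y' z' hn => ?_, ?_, ?_, ?_⟩
    · simp [Mem.setReal_real, hn]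
    · simpa using h.le
    · simp
    · simp

/-! ### Trees and leaves -/

section Leaves

variable {V : Type*} [DecidableEq V] {T : SimpleGraph V}

/-- `c` is a leaf of the subgraph induced by `R`, with the only neighbour `p`. -/
structure IsLeaf (T : SimpleGraph V) (R : Finset V) (c p : V) : Prop where
  mem : c ∈ R
  nbr_mem : p ∈ R
  adj : T.Adj c p
  unique : ∀ j ∈ R, T.Adj c j → j = p

-- Induced subgraphs of an acyclic graph are acyclic, so a connected one with at least two vertices
-- is a tree and has a vertex of degree one.
omit [DecidableEq V] in
theorem exists_isLeaf (hT : T.IsAcyclic) {R : Finset V}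
    (hR : (T.induce (R : Set V)).Preconnected) (hcard : 2 ≤ R.card) : ∃ c p, IsLeaf T R c p := by
  classical
  have hnt : Nontrivial (R : Set V) :=
    Set.Nontrivial.coe_sort (Finset.one_lt_card_iff_nontrivial.1 hcard)
  have htree : (T.induce (R : Set V)).IsTree := ⟨⟨hR⟩, hT.induce _⟩
  obtain ⟨c, hc⟩ := htree.exists_vert_degree_one_of_nontrivial
  obtain ⟨p, hp, hu⟩ := SimpleGraph.degree_eq_one_iff_existsUnique_adj.1 hc
  refine ⟨c, p, c.2, p.2, hp, fun j hj hcj => ?_⟩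
  exact congrArg Subtype.val (hu ⟨j, hj⟩ hcj)

/-- A path between two other vertices never needs a vertex of degree one. The homomorphism `f` only
passes from the twofold induced subgraph to the one induced by `R.erase c`. -/
theorem IsLeaf.preconnected_erase {R : Finset V} {c p : V} (h : IsLeaf T R c p)
    (hR : (T.induce (R : Set V)).Preconnected) :
    (T.induce (R.erase c : Set V)).Preconnected := by
  have h1 := hR.induce_of_degree_eq_one (s := {x | x.1 ≠ c}) (by
    intro v hv a ha b hb
    simp only [ne_eq, Set.mem_ofPred_eq, not_not] at hv
    have ha' : T.Adj c a := hv ▸ ha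
    have hb' : T.Adj c b := hv ▸ hb
    exact Subtype.ext ((h.unique _ a.2 ha').trans (h.unique _ b.2 hb').symm))
  let f : (T.induce (R : Set V)).induce {x | x.1 ≠ c} →g T.induce (R.erase c : Set V) :=
    { toFun := fun x => ⟨x.1.1, by
        have h1 := x.2
        have h2 := x.1.2
        simp only [ne_eq, Set.mem_ofPred_eq] at h1
        exact Finset.mem_coe.2 (Finset.mem_erase.2 ⟨h1, h2⟩)⟩
      map_rel' := fun h => h }
  intro x y
  have hx := Finset.mem_erase.1 (Finset.mem_coe.1 x.2)
  have hy := Finset.mem_erase.1 (Finset.mem_coe.1 y.2)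
  exact (h1 ⟨⟨x.1, hx.2⟩, hx.1⟩ ⟨⟨y.1, hy.2⟩, hy.1⟩).map f

end Leaves

/-! ### Maximization over trees

The vertices in `R` choose a state `σ i < 2` and divide a budget `W i` among themselves (`x i`) and
the edges to their neighbours in `R` (`b i j`). -/

section TreeOpt

variable {n : ℕ}

/-- The budgets are divided completely. -/
def Feasible (T : SimpleGraph (Fin n)) [DecidableRel T.Adj] (W : Fin n → ℕ) (R : Finset (Fin n))
    (σ x : Fin n → ℕ) (b : Fin n → Fin n → ℕ) : Prop :=
  ∀ i ∈ R, σ i < 2 ∧ x i + ∑ j ∈ R with T.Adj i j, b i j = W i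

/-- The sum of the terms of the edges inside `R`. -/
def edgeSum (T : SimpleGraph (Fin n)) [DecidableRel T.Adj] (R : Finset (Fin n))
    (θ : Fin n → Fin n → ℝ) : ℝ :=
  ∑ i ∈ R, ∑ j ∈ R, if i < j ∧ T.Adj i j then θ i j else 0

/-- The objective: vertex terms plus edge terms. -/
def objective (T : SimpleGraph (Fin n)) [DecidableRel T.Adj] (R : Finset (Fin n))
    (φ : Fin n → ℕ → ℕ → ℝ) (Θ : Fin n → Fin n → ℕ → ℕ → ℕ → ℕ → ℝ)
    (σ x : Fin n → ℕ) (b : Fin n → Fin n → ℕ) : ℝ :=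
  ∑ i ∈ R, φ i (σ i) (x i) + edgeSum T R (fun i j => Θ i j (σ i) (σ j) (b i j) (b j i))

/-- No feasible choice has a positive objective. -/
def NonPos (T : SimpleGraph (Fin n)) [DecidableRel T.Adj] (W : Fin n → ℕ) (R : Finset (Fin n))
    (φ : Fin n → ℕ → ℕ → ℝ) (Θ : Fin n → Fin n → ℕ → ℕ → ℕ → ℕ → ℝ) : Prop :=
  ∀ σ x b, Feasible T W R σ x b → objective T R φ Θ σ x b ≤ 0

variable {T : SimpleGraph (Fin n)} [DecidableRel T.Adj] {W : Fin n → ℕ} {R : Finset (Fin n)}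
  {φ φ' : Fin n → ℕ → ℕ → ℝ} {Θ : Fin n → Fin n → ℕ → ℕ → ℕ → ℕ → ℝ} {c p : Fin n}

theorem edgeSum_congr {θ θ' : Fin n → Fin n → ℝ} (h : ∀ i ∈ R, ∀ j ∈ R, i < j → T.Adj i j →
    θ i j = θ' i j) :
    edgeSum T R θ = edgeSum T R θ' := by
  unfold edgeSum
  refine Finset.sum_congr rfl fun i hi => Finset.sum_congr rfl fun j hj => ?_
  split_ifs with hij
  · exact h i hi j hj hij.1 hij.2
  · rfl

theorem edgeSum_mono {θ θ' : Fin n → Fin n → ℝ} (h : ∀ i ∈ R, ∀ j ∈ R, i < j → T.Adj i j →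
    θ i j ≤ θ' i j) :
    edgeSum T R θ ≤ edgeSum T R θ' := by
  unfold edgeSum
  refine Finset.sum_le_sum fun i hi => Finset.sum_le_sum fun j hj => ?_
  split_ifs with hij
  · exact h i hi j hj hij.1 hij.2
  · rfl

/-- Every edge is counted once, from the smaller to the larger index. Symmetry of `θ` allows the
term `θ p c` whichever of the two is smaller. -/
theorem IsLeaf.edgeSum_eq (h : IsLeaf T R c p) {θ : Fin n → Fin n → ℝ}
    (hθ : ∀ i j, θ i j = θ j i) : edgeSum T R θ = edgeSum T (R.erase c) θ + θ p c := by
  unfold edgeSum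
  rw [← Finset.add_sum_erase R _ h.mem, ← Finset.add_sum_erase R _ h.mem]
  simp only [lt_self_iff_false, false_and, if_false, zero_add]
  have h1 : ∀ i ∈ R.erase c, ∑ j ∈ R, (if i < j ∧ T.Adj i j then θ i j else 0) =
      (if i < c ∧ T.Adj i c then θ i c else 0) +
        ∑ j ∈ R.erase c, (if i < j ∧ T.Adj i j then θ i j else 0) := fun i _ =>
    (Finset.add_sum_erase R _ h.mem).symm
  rw [Finset.sum_congr rfl h1, Finset.sum_add_distrib, ← add_assoc, ← Finset.sum_add_distrib]
  have hpc : p ∈ R.erase c := Finset.mem_erase.2 ⟨h.adj.ne', h.nbr_mem⟩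
  rw [Finset.sum_eq_single_of_mem p hpc, add_comm]
  · congr 1
    rcases lt_or_gt_of_ne h.adj.ne with hlt | hlt
    · simp [hlt, h.adj, hlt.not_gt, hθ c p]
    · simp [hlt, h.adj.symm, hlt.not_gt]
  · intro j hj hjp
    have hn : ¬ T.Adj c j := fun ha => hjp (h.unique j (Finset.mem_of_mem_erase hj) ha)
    have hn' : ¬ T.Adj j c := fun ha => hn ha.symm
    simp [hn, hn']

theorem IsLeaf.sum_adj (h : IsLeaf T R c p) (f : Fin n → ℕ) :
    ∑ j ∈ R with T.Adj c j, f j = f p := by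
  rw [Finset.sum_eq_single_of_mem p (by simp [h.nbr_mem, h.adj])]
  intro j hj hjp
  simp only [Finset.mem_filter] at hj
  exact absurd (h.unique j hj.1 hj.2) hjp

theorem IsLeaf.sum_adj_nbr (h : IsLeaf T R c p) (f : Fin n → ℕ) :
    ∑ j ∈ R with T.Adj p j, f j = f c + ∑ j ∈ R.erase c with T.Adj p j, f j := by
  rw [← Finset.add_sum_erase _ _ (show c ∈ R.filter (T.Adj p ·) by simp [h.mem, h.adj.symm]),
    Finset.filter_erase]

theorem IsLeaf.sum_adj_other (h : IsLeaf T R c p) {i : Fin n} (hi : i ∈ R.erase c) (hip : i ≠ p)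
    (f : Fin n → ℕ) : ∑ j ∈ R with T.Adj i j, f j = ∑ j ∈ R.erase c with T.Adj i j, f j := by
  refine Finset.sum_congr ?_ fun _ _ => rfl
  ext j
  simp only [Finset.mem_filter, Finset.mem_erase]
  refine ⟨fun hj => ⟨⟨?_, hj.1⟩, hj.2⟩, fun hj => ⟨hj.1.2, hj.2⟩⟩
  rintro rfl
  exact hip (h.unique i (Finset.mem_of_mem_erase hi) hj.2.symm)

/-- Isolates the terms that a reaction of the leaf can affect: the vertex terms of `c` and `p` and
the edge between them. -/
theorem IsLeaf.objective_eq (h : IsLeaf T R c p)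
    (hΘ : ∀ i j σ τ b e, Θ i j σ τ b e = Θ j i τ σ e b) (σ x : Fin n → ℕ)
    (b : Fin n → Fin n → ℕ) :
    objective T R φ Θ σ x b =
      (φ p (σ p) (x p) + Θ p c (σ p) (σ c) (b p c) (b c p) + φ c (σ c) (x c)) +
        (∑ i ∈ (R.erase c).erase p, φ i (σ i) (x i) +
          edgeSum T (R.erase c) (fun i j => Θ i j (σ i) (σ j) (b i j) (b j i))) := by
  have hpc : p ∈ R.erase c := Finset.mem_erase.2 ⟨h.adj.ne', h.nbr_mem⟩
  rw [objective, h.edgeSum_eq (fun i j => hΘ i j _ _ _ _), ← Finset.add_sum_erase R _ h.mem,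
    ← Finset.add_sum_erase _ _ hpc]
  ring

theorem objective_split (hp : p ∈ R) (σ x : Fin n → ℕ) (b : Fin n → Fin n → ℕ) :
    objective T R φ Θ σ x b = φ p (σ p) (x p) + (∑ i ∈ R.erase p, φ i (σ i) (x i) +
          edgeSum T R (fun i j => Θ i j (σ i) (σ j) (b i j) (b j i))) := by
  rw [objective, ← Finset.add_sum_erase R _ hp]
  ring

/-- A leaf can be eliminated: its best reaction is added to the vertex term of its neighbour. -/
theorem IsLeaf.nonPos_erase (h : IsLeaf T R c p)
    (hΘ : ∀ i j σ τ b e, Θ i j σ τ b e = Θ j i τ σ e b)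
    (hother : ∀ i, i ≠ p → φ' i = φ i)
    (hbest : ∀ σ < 2, ∀ x ≤ W p, IsGreatest {r | ∃ b ≤ x, ∃ τ < 2, ∃ e ≤ W c,
      r = φ p σ (x - b) + Θ p c σ τ b e + φ c τ (W c - e)} (φ' p σ x)) :
    NonPos T W R φ Θ ↔ NonPos T W (R.erase c) φ' Θ := by
  have hpc : p ∈ R.erase c := Finset.mem_erase.2 ⟨h.adj.ne', h.nbr_mem⟩
  have hcp : c ≠ p := h.adj.ne
  constructor
  · intro hN σ x b hF
    obtain ⟨hσp, hxp⟩ := hF p hpc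
    -- An optimal reaction for the state and budget of `p`: on their edge `p` spends `b₀` and `c`
    -- spends `e`, and `c` takes the state `τ`.
    obtain ⟨⟨b₀, hb₀, τ, hτ, e, he, hval⟩, -⟩ := hbest (σ p) hσp (x p) (by omega)
    set σ₂ := Function.update σ c τ with hσ₂
    -- The amount `b₀` comes out of the private part of `p`, and the leaf keeps `W c - e`, so both
    -- budgets are still divided completely.
    set x₂ := Function.update (Function.update x p (x p - b₀)) c (W c - e) with hx₂
    set b₂ : Fin n → Fin n → ℕ := fun i j =>
      if i = p ∧ j = c then b₀ else if i = c ∧ j = p then e else b i j with hb₂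
    have hb₂' : ∀ i ∈ R.erase c, ∀ j ∈ R.erase c, b₂ i j = b i j := by
      intro i hi j hj
      simp [hb₂, (Finset.mem_erase.1 hi).1, (Finset.mem_erase.1 hj).1]
    have hσ₂' : ∀ i ∈ R.erase c, σ₂ i = σ i := by
      intro i hi
      simp [hσ₂, (Finset.mem_erase.1 hi).1]
    have hsum : ∀ i ∈ R.erase c, ∑ j ∈ R.erase c with T.Adj i j, b₂ i j =
        ∑ j ∈ R.erase c with T.Adj i j, b i j := by
      intro i hi
      exact Finset.sum_congr rfl fun j hj => hb₂' i hi j (Finset.mem_filter.1 hj).1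
    have hF₂ : Feasible T W R σ₂ x₂ b₂ := by
      intro i hi
      by_cases hic : i = c
      · subst hic
        rw [h.sum_adj]
        simp only [hσ₂, hx₂, hb₂, Function.update_self, hcp, false_and, if_false, and_self, if_true]
        exact ⟨hτ, by omega⟩
      · have hi' : i ∈ R.erase c := Finset.mem_erase.2 ⟨hic, hi⟩
        refine ⟨by rw [hσ₂' i hi']; exact (hF i hi').1, ?_⟩
        by_cases hip : i = p
        · subst hip
          rw [h.sum_adj_nbr, hsum i hi']
          simp only [hx₂, hb₂, Function.update_of_ne hic, Function.update_self, and_self, if_true]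
          omega
        · rw [h.sum_adj_other hi' hip, hsum i hi']
          simp only [hx₂, Function.update_of_ne hic, Function.update_of_ne hip]
          exact (hF i hi').2
    have hle := hN σ₂ x₂ b₂ hF₂
    rw [h.objective_eq hΘ] at hle
    rw [objective_split hpc, hval]
    have e1 : edgeSum T (R.erase c) (fun i j => Θ i j (σ₂ i) (σ₂ j) (b₂ i j) (b₂ j i)) =
        edgeSum T (R.erase c) (fun i j => Θ i j (σ i) (σ j) (b i j) (b j i)) :=
      edgeSum_congr fun i hi j hj _ _ => by
        rw [hσ₂' i hi, hσ₂' j hj, hb₂' i hi j hj, hb₂' j hj i hi]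
    have e2 : ∑ i ∈ (R.erase c).erase p, φ i (σ₂ i) (x₂ i) =
        ∑ i ∈ (R.erase c).erase p, φ' i (σ i) (x i) := by
      refine Finset.sum_congr rfl fun i hi => ?_
      obtain ⟨hip, hi'⟩ := Finset.mem_erase.1 hi
      rw [hσ₂' i hi', hother i hip]
      simp [hx₂, hip, (Finset.mem_erase.1 hi').1]
    rw [e1, e2] at hle
    simpa [hσ₂, hx₂, hb₂, hcp, hcp.symm] using hle
  · intro hN σ x b hF
    -- In the smaller tree `p` takes back what it spent on the edge to `c`; the maximum in `φ'` is
    -- free to split it off again.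
    set x₂ := Function.update x p (x p + b p c) with hx₂
    have hFp := hF p h.nbr_mem
    have hFc := hF c h.mem
    rw [h.sum_adj] at hFc
    rw [h.sum_adj_nbr] at hFp
    have hF₂ : Feasible T W (R.erase c) σ x₂ b := by
      intro i hi
      obtain ⟨hic, hiR⟩ := Finset.mem_erase.1 hi
      refine ⟨(hF i hiR).1, ?_⟩
      by_cases hip : i = p
      · subst hip
        simp only [hx₂, Function.update_self]
        omega
      · rw [← h.sum_adj_other hi hip]
        simp only [hx₂, Function.update_of_ne hip]
        exact (hF i hiR).2
    refine le_trans ?_ (hN σ x₂ b hF₂)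
    rw [h.objective_eq hΘ, objective_split hpc]
    have e2 : ∑ i ∈ (R.erase c).erase p, φ i (σ i) (x i) =
        ∑ i ∈ (R.erase c).erase p, φ' i (σ i) (x₂ i) := by
      refine Finset.sum_congr rfl fun i hi => ?_
      obtain ⟨hip, hi'⟩ := Finset.mem_erase.1 hi
      rw [hother i hip]
      simp [hx₂, hip]
    rw [e2]
    gcongr
    -- The actual choices at the leaf are among the candidates for `φ' p`.
    refine (hbest (σ p) hFp.1 (x₂ p) (by simp [hx₂]; omega)).2
      ⟨b p c, by simp [hx₂], σ c, hFc.1, b c p, by omega, ?_⟩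
    have : W c - b c p = x c := by omega
    simp [hx₂, this]

/-- A lone vertex has no edges to spend on and keeps its whole budget, so only its state is free. -/
theorem nonPos_singleton (r : Fin n) :
    NonPos T W {r} φ Θ ↔ φ r 0 (W r) ≤ 0 ∧ φ r 1 (W r) ≤ 0 := by
  have hobj : ∀ σ x b, objective T {r} φ Θ σ x b = φ r (σ r) (x r) := by
    intro σ x b
    simp [objective, edgeSum]
  have hfeas : ∀ σ x b, Feasible T W {r} σ x b ↔ σ r < 2 ∧ x r = W r := by
    intro σ x b
    have : ({r} : Finset (Fin n)).filter (T.Adj r ·) = ∅ := by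
      ext j
      simp only [Finset.mem_filter, Finset.mem_singleton, Finset.notMem_empty, iff_false, not_and]
      rintro rfl
      exact T.loopless.irrefl j
    simp [Feasible, this]
  constructor
  · intro h
    exact ⟨by simpa [hobj] using h (fun _ => 0) W (fun _ _ => 0) (by simp [hfeas]),
      by simpa [hobj] using h (fun _ => 1) W (fun _ _ => 0) (by simp [hfeas])⟩
  · intro h σ x b hF
    rw [hfeas] at hF
    rw [hobj, hF.2]
    obtain hσ | hσ : σ r = 0 ∨ σ r = 1 := by omega
    · rw [hσ]; exact h.1
    · rw [hσ]; exact h.2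

end TreeOpt

/-! ### The superadditive cover -/

namespace Game

variable {n : ℕ} (G : Game n)

/-- A bound linear in the size is needed because coalition structures may have arbitrarily many
parts, while the sizes of the parts add up. The sum of all values serves as the slope, since a
coalition other than `0` has size at least one. -/
theorem exists_v_le : ∃ M : ℝ, 0 ≤ M ∧ ∀ c, G.v c ≤ M * ((∑ i, c i : ℕ) : ℝ) := by
  refine ⟨∑ c ∈ Finset.Icc 0 G.W, G.v c, Finset.sum_nonneg fun c _ => G.v_nonneg c, fun c => ?_⟩
  have hM : 0 ≤ ∑ c ∈ Finset.Icc 0 G.W, G.v c := Finset.sum_nonneg fun c _ => G.v_nonneg c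
  by_cases hc : c ≤ G.W
  · by_cases h0 : c = 0
    · subst h0
      simp [G.v_zero]
    · have h1 : 1 ≤ ∑ i, c i := by
        obtain ⟨i, hi⟩ := Function.ne_iff.1 h0
        have h2 : c i ≤ ∑ i, c i := Finset.single_le_sum (fun _ _ => Nat.zero_le _) (Finset.mem_univ i)
        have h3 : c i ≠ 0 := hi
        omega
      calc G.v c ≤ ∑ c ∈ Finset.Icc 0 G.W, G.v c :=
            Finset.single_le_sum (fun c _ => G.v_nonneg c) (Finset.mem_Icc.2 ⟨zero_le, hc⟩)
        _ ≤ _ := le_mul_of_one_le_right hM (by exact_mod_cast h1)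
  · rw [G.v_outside c hc]
    positivity

theorem bddAbove_cover (c : Fin n → ℕ) :
    BddAbove {r : ℝ | ∃ CS : Multiset (Fin n → ℕ), CS.sum = c ∧ r = (CS.map G.v).sum} := by
  obtain ⟨M, _, hv⟩ := G.exists_v_le
  refine ⟨M * ((∑ i, c i : ℕ) : ℝ), ?_⟩
  rintro r ⟨CS, rfl, rfl⟩
  induction CS using Multiset.induction with
  | empty => simp
  | cons d CS ih =>
    have h1 := hv d
    simp only [Multiset.map_cons, Multiset.sum_cons, Pi.add_apply, Finset.sum_add_distrib,
      Nat.cast_add, mul_add] at ih ⊢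
    exact add_le_add h1 ih

variable {G}

theorem le_cover {c : Fin n → ℕ} {CS : Multiset (Fin n → ℕ)} (h : CS.sum = c) :
    (CS.map G.v).sum ≤ G.cover c :=
  le_csSup (G.bddAbove_cover c) ⟨CS, h, rfl⟩

theorem cover_le {c : Fin n → ℕ} {B : ℝ}
    (h : ∀ CS : Multiset (Fin n → ℕ), CS.sum = c → (CS.map G.v).sum ≤ B) : G.cover c ≤ B := by
  refine csSup_le ⟨_, {c}, by simp, rfl⟩ ?_
  rintro r ⟨CS, hCS, rfl⟩
  exact h CS hCS

theorem v_le_cover (c : Fin n → ℕ) : G.v c ≤ G.cover c := by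
  simpa using le_cover (G := G) (CS := {c}) (by simp)

theorem cover_nonneg (c : Fin n → ℕ) : 0 ≤ G.cover c :=
  (G.v_nonneg c).trans (v_le_cover c)

theorem cover_add (c d : Fin n → ℕ) : G.cover c + G.cover d ≤ G.cover (c + d) := by
  -- The two suprema are bounded one after the other, with the remaining term moved to the
  -- right-hand side.
  rw [← le_sub_iff_add_le]
  refine cover_le fun CS hCS => ?_
  rw [le_sub_comm]
  refine cover_le fun CS' hCS' => ?_
  rw [le_sub_iff_add_le, ← Multiset.sum_add, ← Multiset.map_add]
  exact le_cover (by rw [Multiset.sum_add, hCS, hCS', add_comm])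

theorem cover_mono {c d : Fin n → ℕ} (h : c ≤ d) : G.cover c ≤ G.cover d := by
  have h1 := cover_add (G := G) c (d - c)
  rw [add_tsub_cancel_of_le h] at h1
  linarith [cover_nonneg (G := G) (d - c)]

theorem cover_sum {ι : Type*} (s : Finset ι) (f : ι → Fin n → ℕ) :
    ∑ i ∈ s, G.cover (f i) ≤ G.cover (∑ i ∈ s, f i) := by
  classical
  induction s using Finset.induction_on with
  | empty => simpa using cover_nonneg _
  | insert a s ha ih =>
    rw [Finset.sum_insert ha, Finset.sum_insert ha]
    exact (add_le_add le_rfl ih).trans (cover_add _ _)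

/-- The recursion for the cover: split off one coalition. -/
theorem isLUB_cover (c : Fin n → ℕ) :
    IsLUB (insert 0 {r | ∃ d ≤ c, d ≠ 0 ∧ r = G.cover (c - d) + G.v d}) (G.cover c) := by
  constructor
  · rintro r (rfl | ⟨d, hd, -, rfl⟩)
    · exact cover_nonneg c
    · calc G.cover (c - d) + G.v d ≤ G.cover (c - d) + G.cover d := by
            gcongr; exact v_le_cover d
        _ ≤ G.cover (c - d + d) := cover_add _ _
        _ = G.cover c := by rw [tsub_add_cancel_of_le hd]
  · intro B hB
    refine cover_le fun CS hCS => ?_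
    -- A structure may contain zero vectors, but the recursion splits off some `d ≠ 0` so that it
    -- descends to a strictly smaller vector. A structure of zero vectors only is worth the inserted
    -- `0`.
    by_cases h : ∀ d ∈ CS, d = 0
    · have : (CS.map G.v).sum = 0 := by
        refine Multiset.sum_eq_zero fun r hr => ?_
        obtain ⟨d, hd, rfl⟩ := Multiset.mem_map.1 hr
        rw [h d hd, G.v_zero]
      rw [this]
      exact hB (Or.inl rfl)
    · push Not at h
      obtain ⟨d, hd, hd0⟩ := h
      obtain ⟨CS', rfl⟩ := Multiset.exists_cons_of_mem hd
      rw [Multiset.sum_cons] at hCS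
      rw [Multiset.map_cons, Multiset.sum_cons, add_comm]
      have h1 : CS'.sum = c - d := by rw [← hCS, add_tsub_cancel_left]
      have hdc : d ≤ c := by rw [← hCS]; exact le_self_add
      exact (add_le_add (le_cover h1) le_rfl).trans (hB (Or.inr ⟨d, hdc, hd0, rfl⟩))

end Game

/-! ### Supports -/

section Supports

variable {n : ℕ}

@[simp] theorem mem_supp {c : Fin n → ℕ} {i : Fin n} : i ∈ supp c ↔ 0 < c i := by
  simp [supp]

@[simp] theorem agentVec_apply (i a : ℕ) (j : Fin n) :
    agentVec n i a j = if j.val = i then a else 0 := rfl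

@[simp] theorem agentVec_zero (i : ℕ) : agentVec n i 0 = 0 := by
  funext j
  simp

theorem agentVec_add (i a b : ℕ) : agentVec n i (a + b) = agentVec n i a + agentVec n i b := by
  funext j
  simp only [agentVec_apply, Pi.add_apply]
  split_ifs <;> simp

theorem eq_agentVec_of_supp {c : Fin n → ℕ} {i : Fin n} (h : supp c = {i}) :
    c = agentVec n i (c i) := by
  funext j
  by_cases hj : j = i
  · subst hj; simp
  · have : j ∉ supp c := by simp [h, hj]
    simp only [mem_supp, not_lt, Nat.le_zero] at this
    simp [this, Fin.val_inj, hj]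

theorem eq_agentVec_add_of_supp {c : Fin n → ℕ} {i j : Fin n} (hij : i ≠ j)
    (h : supp c = {i, j}) : c = agentVec n i (c i) + agentVec n j (c j) := by
  funext l
  by_cases hi : l = i
  · subst hi; simp [Fin.val_inj, hij]
  by_cases hj : l = j
  · subst hj; simp [Fin.val_inj, hij.symm]
  · have : l ∉ supp c := by simp [h, hi, hj]
    simp only [mem_supp, not_lt, Nat.le_zero] at this
    simp [this, Fin.val_inj, hi, hj]

/-- Connectedness includes nonemptiness, so there are one or two contributors, and two vertices that
induce a connected graph are adjacent. -/
theorem supp_cases {T : SimpleGraph (Fin n)} {c : Fin n → ℕ} (hcard : (supp c).card ≤ 2)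
    (hconn : (T.induce (supp c : Set (Fin n))).Connected) :
    (∃ i, supp c = {i}) ∨ ∃ i j, i < j ∧ T.Adj i j ∧ supp c = {i, j} := by
  obtain ⟨⟨i, hi⟩⟩ := hconn.nonempty
  have hpos : 0 < (supp c).card := Finset.card_pos.2 ⟨i, hi⟩
  obtain h1 | h2 : (supp c).card = 1 ∨ (supp c).card = 2 := by omega
  · exact Or.inl (Finset.card_eq_one.1 h1)
  · right
    obtain ⟨a, b, hab, hs⟩ := Finset.card_eq_two.1 h2
    have hadj : T.Adj a b := by
      have ha : a ∈ (supp c : Set (Fin n)) := by simp [hs]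
      have hb : b ∈ (supp c : Set (Fin n)) := by simp [hs]
      have hnt : Nontrivial (supp c : Set (Fin n)) :=
        ⟨⟨a, ha⟩, ⟨b, hb⟩, fun h => hab (congrArg Subtype.val h)⟩
      obtain ⟨⟨y, hy⟩, hay⟩ := hconn.preconnected.exists_adj_of_nontrivial ⟨a, ha⟩
      have hay' : T.Adj a y := hay
      rw [hs] at hy
      simp only [Finset.coe_insert, Finset.coe_singleton, Set.mem_insert_iff,
        Set.mem_singleton_iff] at hy
      rcases hy with rfl | rfl
      · exact absurd rfl hay'.ne
      · exact hay'
    rcases lt_or_gt_of_ne hab with h | h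
    · exact ⟨a, b, h, hadj, hs⟩
    · exact ⟨b, a, h, hadj.symm, by rw [hs, Finset.pair_comm]⟩

theorem supp_eq_singleton_iff {c : Fin n → ℕ} {i : Fin n} :
    supp c = {i} ↔ 1 ≤ c i ∧ (supp c).card ≤ 1 := by
  constructor
  · intro h
    have hi : i ∈ supp c := by simp [h]
    exact ⟨mem_supp.1 hi, by simp [h]⟩
  · rintro ⟨h1, h2⟩
    exact (Finset.eq_of_subset_of_card_le 
      (Finset.singleton_subset_iff.2 (mem_supp.2 h1)) (by simpa using h2)).symm

theorem supp_eq_pair_iff {c : Fin n → ℕ} {i j : Fin n} (hij : i ≠ j) :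
    supp c = {i, j} ↔ 1 ≤ c i ∧ 1 ≤ c j ∧ (supp c).card ≤ 2 := by
  constructor
  · intro h
    have hi : i ∈ supp c := by simp [h]
    have hj : j ∈ supp c := by simp [h]
    exact ⟨mem_supp.1 hi, mem_supp.1 hj, by rw [h]; exact Finset.card_le_two⟩
  · rintro ⟨h1, h2, h3⟩
    refine (Finset.eq_of_subset_of_card_le ?_ ?_).symm
    · intro l hl
      simp only [Finset.mem_insert, Finset.mem_singleton] at hl
      rcases hl with rfl | rfl
      · exact mem_supp.2 h1
      · exact mem_supp.2 h2
    · rw [Finset.card_pair hij]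
      exact h3

end Supports

/-! ### Sums over edges -/

section EdgeSums

variable {n : ℕ} {T : SimpleGraph (Fin n)} [DecidableRel T.Adj] {R : Finset (Fin n)}

theorem edgeSum_add (θ θ' : Fin n → Fin n → ℝ) :
    edgeSum T R (fun i j => θ i j + θ' i j) = edgeSum T R θ + edgeSum T R θ' := by
  simp only [edgeSum, ← Finset.sum_add_distrib]
  refine Finset.sum_congr rfl fun i _ => Finset.sum_congr rfl fun j _ => ?_
  split_ifs <;> simp

theorem edgeSum_single {i j : Fin n} (hi : i ∈ R) (hj : j ∈ R) (hij : i < j) (h : T.Adj i j)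
    (r : ℝ) : edgeSum T R (fun a b => if a = i ∧ b = j then r else 0) = r := by
  rw [edgeSum, Finset.sum_eq_single_of_mem i hi, Finset.sum_eq_single_of_mem j hj]
  · simp [hij, h]
  · intro b _ hb
    simp [hb]
  · intro a _ ha
    simp [ha]

theorem edgeSum_sum {ι : Type*} (s : Finset ι) (θ : ι → Fin n → Fin n → ℝ) :
    edgeSum T R (fun i j => ∑ k ∈ s, θ k i j) = ∑ k ∈ s, edgeSum T R (θ k) := by
  classical
  induction s using Finset.induction_on with
  | empty => simp [edgeSum]
  | insert a s ha ih => simp only [Finset.sum_insert ha, edgeSum_add, ih]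

theorem edgeSum_filter (p : Fin n → Prop) [DecidablePred p] (θ : Fin n → Fin n → ℝ) :
    edgeSum T (R.filter p) θ = edgeSum T R (fun i j => if p i ∧ p j then θ i j else 0) := by
  simp only [edgeSum, Finset.sum_filter]
  refine Finset.sum_congr rfl fun i _ => ?_
  split_ifs with hi
  · refine Finset.sum_congr rfl fun j _ => ?_
    split_ifs <;> simp_all
  · simp [hi]

/-- Double counting: an edge listed once with the amounts of both ends is the same as an edge listed
at each end with the amount of that end. -/
theorem sum_lt_adj (f : Fin n → Fin n → ℕ) :
    ∑ i ∈ R, ∑ j ∈ R, (if i < j ∧ T.Adj i j then f i j + f j i else 0) =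
      ∑ i ∈ R, ∑ j ∈ R with T.Adj i j, f i j := by
  have h1 : ∑ i ∈ R, ∑ j ∈ R, (if i < j ∧ T.Adj i j then f i j + f j i else 0) =
      ∑ i ∈ R, ∑ j ∈ R, (if i < j ∧ T.Adj i j then f i j else 0) +
        ∑ i ∈ R, ∑ j ∈ R, (if i < j ∧ T.Adj i j then f j i else 0) := by
    simp only [← Finset.sum_add_distrib]
    refine Finset.sum_congr rfl fun i _ => Finset.sum_congr rfl fun j _ => ?_
    split_ifs <;> simp
  rw [h1, Finset.sum_comm (s := R) (t := R) (f := fun i j => if i < j ∧ T.Adj i j then f j i else 0),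
    ← Finset.sum_add_distrib]
  refine Finset.sum_congr rfl fun i _ => ?_
  rw [← Finset.sum_add_distrib, Finset.sum_filter]
  refine Finset.sum_congr rfl fun j _ => ?_
  by_cases h : T.Adj i j
  · rcases lt_or_gt_of_ne h.ne with hlt | hlt
    · simp [h, hlt, hlt.not_gt]
    · simp [h, h.symm, hlt, hlt.not_gt]
  · have h' : ¬ T.Adj j i := fun h' => h h'.symm
    simp [h, h']

variable {G : Game n}

/-- Coalitions of single agents and of adjacent agents can be formed side by side. -/
theorem sum_cover_add_edgeSum_le {S : Finset (Fin n)} {x : Fin n → ℕ} {b : Fin n → Fin n → ℕ}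
    {r : Fin n → ℕ} (h : ∀ i ∈ S, x i + ∑ j ∈ S with T.Adj i j, b i j ≤ r i) :
    ∑ i ∈ S, G.cover (agentVec n i (x i)) +
      edgeSum T S (fun i j => G.cover (agentVec n i (b i j) + agentVec n j (b j i))) ≤
      G.cover r := by
  have h1 : edgeSum T S (fun i j => G.cover (agentVec n i (b i j) + agentVec n j (b j i))) ≤
      G.cover (∑ i ∈ S, ∑ j ∈ S, if i < j ∧ T.Adj i j then
        agentVec n i (b i j) + agentVec n j (b j i) else 0) := by
    refine le_trans ?_ (Game.cover_sum _ _)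
    refine Finset.sum_le_sum fun i _ => le_trans ?_ (Game.cover_sum _ _)
    refine Finset.sum_le_sum fun j _ => ?_
    split_ifs
    · exact le_rfl
    · exact Game.cover_nonneg _
  refine (add_le_add (Game.cover_sum _ _) h1).trans ((Game.cover_add _ _).trans
    (Game.cover_mono fun l => ?_))
  -- Applied to the amounts of agent `l` alone, double counting shows that the edge coalitions use
  -- exactly what `l` spends on its own edges.
  have h2 := sum_lt_adj (T := T) (R := S) (fun i j => if l = i then b i j else 0)
  have h3 : (∑ i ∈ S, ∑ j ∈ S, if i < j ∧ T.Adj i j then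
        agentVec n i (b i j) + agentVec n j (b j i) else 0) l =
      ∑ i ∈ S, ∑ j ∈ S with T.Adj i j, if l = i then b i j else 0 := by
    rw [← h2]
    simp only [Finset.sum_apply]
    refine Finset.sum_congr rfl fun i _ => Finset.sum_congr rfl fun j _ => ?_
    by_cases hij : i < j ∧ T.Adj i j
    · simp only [if_pos hij, Pi.add_apply, agentVec_apply, Fin.val_inj]
    · simp only [if_neg hij, Pi.zero_apply]
  rw [Pi.add_apply, h3]
  simp only [Finset.sum_apply, agentVec_apply, Fin.val_inj]
  by_cases hl : l ∈ S
  · refine le_trans (le_of_eq ?_) (h l hl)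
    rw [Finset.sum_eq_single_of_mem l hl, Finset.sum_eq_single_of_mem l hl]
    · simp
    · intro i _ hi
      simp [Ne.symm hi]
    · intro i _ hi
      simp [Ne.symm hi]
  · have h4 : ∀ i ∈ S, l ≠ i := by rintro i hi rfl; exact hl hi
    rw [Finset.sum_eq_zero, Finset.sum_eq_zero]
    · simp
    · intro i hi
      simp [h4 i hi]
    · intro i hi
      simp [h4 i hi]

/-- Every coalition structure can be replaced by one that consists of coalitions of single agents
and of adjacent agents. -/
theorem exists_cover_decomposition (hG : ∀ c, G.v c ≠ 0 →
      (∃ i, supp c = {i}) ∨ ∃ i j, i < j ∧ T.Adj i j ∧ supp c = {i, j})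
    {S : Finset (Fin n)} (CS : Multiset (Fin n → ℕ)) (hCS : ∀ i ∉ S, CS.sum i = 0) :
    ∃ (x : Fin n → ℕ) (b : Fin n → Fin n → ℕ),
      (∀ i ∈ S, x i + ∑ j ∈ S with T.Adj i j, b i j = CS.sum i) ∧
      (CS.map G.v).sum ≤ ∑ i ∈ S, G.cover (agentVec n i (x i)) +
        edgeSum T S (fun i j => G.cover (agentVec n i (b i j) + agentVec n j (b j i))) := by
  induction CS using Multiset.induction with
  | empty =>
    refine ⟨0, 0, by simp, ?_⟩
    refine add_nonneg (Finset.sum_nonneg fun i _ => Game.cover_nonneg _) ?_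
    refine Finset.sum_nonneg fun i _ => Finset.sum_nonneg fun j _ => ?_
    split_ifs
    · exact Game.cover_nonneg _
    · exact le_rfl
  | cons c CS ih =>
    simp only [Multiset.sum_cons, Pi.add_apply, Nat.add_eq_zero_iff] at hCS
    obtain ⟨x, b, hx, hle⟩ := ih fun i hi => (hCS i hi).2
    have hmem : ∀ i ∈ supp c, i ∈ S := by
      intro i hi
      by_contra hiS
      have := (hCS i hiS).1
      simp only [mem_supp] at hi
      omega
    simp only [Multiset.map_cons, Multiset.sum_cons, Pi.add_apply]
    -- A worthless coalition or one of a single agent is put into the private parts; covers can only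
    -- grow with the resources.
    by_cases hv : G.v c = 0 ∨ ∃ i, supp c = {i}
    · refine ⟨x + c, b, fun i hi => by rw [← hx i hi, Pi.add_apply]; ring, ?_⟩
      have h1 : G.v c + ∑ i ∈ S, G.cover (agentVec n i (x i)) ≤
          ∑ i ∈ S, G.cover (agentVec n i ((x + c) i)) := by
        have hadd : ∀ i : Fin n, G.cover (agentVec n i (x i)) + G.cover (agentVec n i (c i)) ≤
            G.cover (agentVec n i ((x + c) i)) := fun i => by
          rw [Pi.add_apply, agentVec_add]; exact Game.cover_add _ _
        rcases hv with hv | ⟨i, hi⟩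
        · rw [hv, zero_add]
          exact Finset.sum_le_sum fun i _ =>
            le_trans (le_add_of_nonneg_right (Game.cover_nonneg _)) (hadd i)
        · have hiS : i ∈ S := hmem i (by simp [hi])
          rw [← Finset.add_sum_erase S _ hiS, ← Finset.add_sum_erase S _ hiS, ← add_assoc]
          refine add_le_add ?_ (Finset.sum_le_sum fun j _ =>
            le_trans (le_add_of_nonneg_right (Game.cover_nonneg _)) (hadd j))
          have h2 := Game.v_le_cover (G := G) c
          nth_rewrite 2 [eq_agentVec_of_supp hi] at h2
          linarith [hadd i]
      linarith
    · push Not at hv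
      obtain ⟨i, hi⟩ | ⟨i, j, hij, hadj, hs⟩ := hG c hv.1
      · exact absurd hi (hv.2 i)
      have hiS : i ∈ S := hmem i (by simp [hs])
      have hjS : j ∈ S := hmem j (by simp [hs])
      have hc := eq_agentVec_add_of_supp hij.ne hs
      -- A pair coalition is put on its edge: `i` adds `c i` at its end and `j` adds `c j` at the
      -- other.
      refine ⟨x, fun k l => if k = i ∧ l = j then b k l + c i else
        if k = j ∧ l = i then b k l + c j else b k l, ?_, ?_⟩
      · intro k hk
        rw [← hx k hk]
        by_cases hki : k = i
        · subst hki
          have hkj : k ≠ j := hij.ne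
          rw [← Finset.add_sum_erase _ _ (show j ∈ S.filter (T.Adj k ·) by simp [hjS, hadj]),
            ← Finset.add_sum_erase _ (fun l => b k l)
              (show j ∈ S.filter (T.Adj k ·) by simp [hjS, hadj])]
          rw [Finset.sum_congr rfl (g := fun l => b k l)]
          · simp; ring
          · intro l hl
            simp [(Finset.mem_erase.1 hl).1, hkj]
        by_cases hkj : k = j
        · subst hkj
          rw [← Finset.add_sum_erase _ _ (show i ∈ S.filter (T.Adj k ·) by simp [hiS, hadj.symm]),
            ← Finset.add_sum_erase _ (fun l => b k l)
              (show i ∈ S.filter (T.Adj k ·) by simp [hiS, hadj.symm])]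
          rw [Finset.sum_congr rfl (g := fun l => b k l)]
          · simp [hki]; ring
          · intro l hl
            simp [(Finset.mem_erase.1 hl).1, hki]
        · have hck : c k = 0 := by
            have : k ∉ supp c := by simp [hs, hki, hkj]
            simpa using this
          simp [hki, hkj, hck]
      · have h1 : edgeSum T S (fun k l => G.cover (agentVec n k (b k l) + agentVec n l (b l k))) +
            G.v c ≤ edgeSum T S (fun k l => G.cover (agentVec n k (if k = i ∧ l = j then b k l + c i
              else if k = j ∧ l = i then b k l + c j else b k l) + agentVec n l (if l = i ∧ k = j then
                b l k + c i else if l = j ∧ k = i then b l k + c j else b l k))) := by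
          rw [← edgeSum_single hiS hjS hij hadj (G.v c), ← edgeSum_add]
          refine edgeSum_mono fun k _ l _ _ _ => ?_
          by_cases hkl : k = i ∧ l = j
          · obtain ⟨rfl, rfl⟩ := hkl
            have h2 : agentVec n k (b k l + c k) + agentVec n l (b l k + c l) =
                (agentVec n k (b k l) + agentVec n l (b l k)) + c := by
              nth_rewrite 3 [hc]
              rw [agentVec_add, agentVec_add]
              abel
            simp only [and_self, if_true, hij.ne, hij.ne', if_false]
            rw [h2]
            exact (add_le_add le_rfl (Game.v_le_cover c)).trans (Game.cover_add _ _)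
          · rw [if_neg hkl, add_zero]
            refine Game.cover_mono (add_le_add (fun a => ?_) (fun a => ?_)) <;>
            · simp only [agentVec_apply]
              split_ifs <;> omega
        linarith

end EdgeSums

/-! ### The core in terms of the oracle -/

namespace Oracle

variable (O : Oracle)

/-- The number of agents that contribute to the `k`-th coalition. -/
def contributors (k : ℕ) : ℕ := ((Finset.range O.agents).filter (fun i => 1 ≤ O.contrib k i)).card

/-- Only agent `i` contributes to the `k`-th coalition. -/
abbrev IsSingle (i k : ℕ) : Prop := 1 ≤ O.contrib k i ∧ O.contributors k ≤ 1

/-- Only the agents `i ≠ j` contribute to the `k`-th coalition. -/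
abbrev IsPair (i j k : ℕ) : Prop :=
  1 ≤ O.contrib k i ∧ 1 ≤ O.contrib k j ∧ O.contributors k ≤ 2

theorem isPair_comm (i j k : ℕ) : O.IsPair i j k ↔ O.IsPair j i k := by
  simp only [IsPair]
  tauto

/-- What the pair coalitions of `i` and `j` among the first `k` ones can pay to agent `i` if it
leaves at most `b` in them. -/
def retSet (i j k b : ℕ) : Set ℝ :=
  {r | ∃ d : ℕ → ℕ, (∀ l, d l ≤ O.contrib l i) ∧
    (∑ l ∈ Finset.range k, if O.IsPair i j l then O.contrib l i - d l else 0) ≤ b ∧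
    r = ∑ l ∈ Finset.range k, if O.IsPair i j l then O.arb l i (d l) else 0}

theorem isGreatest_retSet_zero (i j b : ℕ) : IsGreatest (O.retSet i j 0 b) 0 := by
  refine ⟨⟨0, by simp, by simp, by simp⟩, ?_⟩
  rintro r ⟨d, -, -, rfl⟩
  simp

variable {O}

theorem isGreatest_retSet_succ_of_not {i j k b : ℕ} {r : ℝ} (hk : ¬ O.IsPair i j k)
    (h : IsGreatest (O.retSet i j k b) r) : IsGreatest (O.retSet i j (k + 1) b) r := by
  have : O.retSet i j (k + 1) b = O.retSet i j k b := by
    simp [retSet, Finset.sum_range_succ, hk]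
  rwa [this]

/-- A knapsack recursion. Here `t` is what agent `i` leaves in the `k`-th coalition, so `b - t` is
the budget for the earlier ones and the contribution minus `t` is withdrawn. -/
theorem isGreatest_retSet_succ {i j k b : ℕ} {f : ℕ → ℝ} {r : ℝ} (hk : O.IsPair i j k)
    (hf : ∀ b' ≤ b, IsGreatest (O.retSet i j k b') (f b'))
    (hr : IsGreatest {r | ∃ t ≤ b, t ≤ O.contrib k i ∧
      r = f (b - t) + O.arb k i (O.contrib k i - t)} r) :
    IsGreatest (O.retSet i j (k + 1) b) r := by
  constructor
  · obtain ⟨t, htb, htc, rfl⟩ := hr.1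
    obtain ⟨d, hd, hsum, hval⟩ := (hf (b - t) (Nat.sub_le _ _)).1
    have hne : ∀ l ∈ Finset.range k, l ≠ k := fun l hl => (Finset.mem_range.1 hl).ne
    refine ⟨Function.update d k (O.contrib k i - t), fun l => ?_, ?_, ?_⟩
    · by_cases hl : l = k
      · subst hl; simp
      · simpa [hl] using hd l
    · rw [Finset.sum_range_succ, if_pos hk, Function.update_self,
        Finset.sum_congr rfl fun l hl => by rw [Function.update_of_ne (hne l hl)]]
      omega
    · rw [Finset.sum_range_succ, if_pos hk, Function.update_self,
        Finset.sum_congr rfl fun l hl => by rw [Function.update_of_ne (hne l hl)], hval]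
  · rintro _ ⟨d, hd, hsum, rfl⟩
    rw [Finset.sum_range_succ, if_pos hk] at hsum ⊢
    have hdk := hd k
    refine le_trans (add_le_add
      ((hf (b - (O.contrib k i - d k)) (Nat.sub_le _ _)).2 ⟨d, hd, by omega, rfl⟩) le_rfl)
      (hr.2 ⟨O.contrib k i - d k, by omega, Nat.sub_le _ _, ?_⟩)
    rw [show O.contrib k i - (O.contrib k i - d k) = d k by omega]

/-- Makes the `sSup` in `edgeTerm` an attained maximum. There may be infinitely many functions `d`,
but each step of the recursion has finitely many candidates. -/
theorem exists_isGreatest_retSet (i j k : ℕ) : ∀ b, ∃ r, IsGreatest (O.retSet i j k b) r := by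
  induction k with
  | zero => exact fun b => ⟨0, O.isGreatest_retSet_zero i j b⟩
  | succ k ih =>
    intro b
    choose f hf using ih
    by_cases hk : O.IsPair i j k
    · have hfin : {r | ∃ t ≤ b, t ≤ O.contrib k i ∧
          r = f (b - t) + O.arb k i (O.contrib k i - t)}.Finite := by
        refine ((Set.finite_Iic b).image
          fun t => f (b - t) + O.arb k i (O.contrib k i - t)).subset ?_
        rintro r ⟨t, ht, -, rfl⟩
        exact ⟨t, ht, rfl⟩
      obtain ⟨r, hr⟩ := Set.exists_max_image _ id hfin ⟨_, 0, Nat.zero_le _, Nat.zero_le _, rfl⟩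
      exact ⟨r, isGreatest_retSet_succ hk (fun b' _ => hf b') ⟨hr.1, fun s hs => hr.2 s hs⟩⟩
    · exact ⟨f b, isGreatest_retSet_succ_of_not hk (hf b)⟩

theorem isGreatest_sSup_retSet (i j k b : ℕ) :
    IsGreatest (O.retSet i j k b) (sSup (O.retSet i j k b)) := by
  obtain ⟨r, hr⟩ := exists_isGreatest_retSet (O := O) i j k b
  rwa [hr.csSup_eq]

end Oracle

/-- The terms of the vertices: a deviating agent works alone with the resources `x` and gives up its
payoff, another one lets its own coalitions pay. -/
noncomputable def vertexTerm {n : ℕ} (G : Game n) (O : Oracle) (i : Fin n) (σ x : ℕ) : ℝ :=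
  -- No agent has the number `O.agents`, so this query returns the payment to the empty set.
  if σ = 0 then ∑ l ∈ Finset.range O.coalitions, if O.IsSingle i l then O.arb l O.agents 0 else 0
  else G.cover (agentVec n i x) - ∑ l ∈ Finset.range O.coalitions, O.pay l i

/-- The terms of the edges: two deviating agents cooperate; a deviating agent and another one, or
two others, let the existing coalitions pay. -/
noncomputable def edgeTerm {n : ℕ} (G : Game n) (O : Oracle) (i j : Fin n) (σ τ b e : ℕ) : ℝ :=
  if σ = 0 then
    if τ = 0 then
      ∑ l ∈ Finset.range O.coalitions, if O.IsPair i j l then O.arb l O.agents 0 else 0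
    else sSup (O.retSet j i O.coalitions e)
  else if τ = 0 then sSup (O.retSet i j O.coalitions b)
  else G.cover (agentVec n i b + agentVec n j e)

/-- Leaf elimination meets an edge from whichever end is the leaf, so the edge terms must not depend
on the orientation. -/
theorem edgeTerm_comm {n : ℕ} (G : Game n) (O : Oracle) (i j : Fin n) (σ τ b e : ℕ) :
    edgeTerm G O i j σ τ b e = edgeTerm G O j i τ σ e b := by
  unfold edgeTerm
  split_ifs
  · simp only [O.isPair_comm i j]
  · rfl
  · rfl
  · rw [add_comm]

/-! ### Payments after a deviation in terms of oracle answers -/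

section Instance

variable {n : ℕ} {G : Game n} {T : SimpleGraph (Fin n)} {A : Arbitration G} {o : Outcome G}

@[simp] theorem oracle_contrib (k : Fin o.m) (i : Fin n) :
    (oracle G T A o).contrib k i = o.coal k i := by
  simp [oracle]

@[simp] theorem oracle_pay (k : Fin o.m) (i : Fin n) :
    (oracle G T A o).pay k i = o.pay k i := by
  simp [oracle]

theorem oracle_contributors (k : Fin o.m) :
    (oracle G T A o).contributors k = (supp (o.coal k)).card := by
  have : (oracle G T A o).agents = n := rfl
  rw [Oracle.contributors, Finset.card_filter, this, Finset.sum_range, supp, Finset.card_filter]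
  simp [Nat.succ_le_iff]

theorem isSingle_iff (i : Fin n) (k : Fin o.m) :
    (oracle G T A o).IsSingle i k ↔ supp (o.coal k) = {i} := by
  rw [Oracle.IsSingle, oracle_contrib, oracle_contributors, supp_eq_singleton_iff]

theorem isPair_iff {i j : Fin n} (hij : i ≠ j) (k : Fin o.m) :
    (oracle G T A o).IsPair i j k ↔ supp (o.coal k) = {i, j} := by
  rw [Oracle.IsPair, oracle_contrib, oracle_contrib, oracle_contributors, supp_eq_pair_iff hij]

@[simp] theorem Outcome.mem_outer {S : Finset (Fin n)} {k : Fin o.m} :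
    k ∈ o.outer S ↔ ¬ supp (o.coal k) ⊆ S := by
  simp [Outcome.outer]

theorem agentSet_val (i : Fin n) : agentSet n i = {i} := by
  ext j
  simp [agentSet, Fin.val_inj]

theorem agentSet_self : agentSet n n = ∅ := by
  ext j
  simp [agentSet, j.2.ne]

theorem Deviation.withdraw_eq_zero {S : Finset (Fin n)} (D : Deviation o S) {k : Fin o.m}
    {i : Fin n} (h : i ∉ S ∩ supp (o.coal k)) : D.withdraw k i = 0 := by
  by_cases hi : i ∈ S
  · have h1 : i ∉ supp (o.coal k) := fun h' => h (Finset.mem_inter.2 ⟨hi, h'⟩)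
    have h2 : D.withdraw k i ≤ o.coal k i := D.le_coal k i
    simp only [mem_supp, not_lt, Nat.le_zero] at h1
    omega
  · exact D.only_members k i hi

/-- The empty set meets the coalition in the same contributors as `S`, namely in none. The oracle
answers with some chosen deviation, but by locality every choice gives the same payment. -/
theorem arb_disjoint (hA : A.IsLocal) {S : Finset (Fin n)} (D : Deviation o S) {k : Fin o.m}
    (hk : k ∈ o.outer S) (h : S ∩ supp (o.coal k) = ∅) :
    A o S D k = (oracle G T A o).arb k n 0 := by
  have hex : (k : ℕ) < o.m ∧ ∃ D : Deviation o (agentSet n n),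
      ∀ l, D.withdraw l = if l.val = k then agentVec n n 0 else 0 :=
    ⟨k.2, ⟨fun _ _ => 0, fun _ _ => Nat.zero_le _, fun _ _ _ => rfl, fun _ _ => rfl⟩, fun l => by
      rw [agentVec_zero, ite_self]; rfl⟩
  simp only [oracle]
  rw [dif_pos hex]
  refine hA o o S _ D _ k k hk ?_ rfl rfl ?_ ?_
  · rw [agentSet_self, Outcome.mem_outer, Finset.subset_empty]
    exact (o.coal_nonempty k).ne_empty
  · rw [h, agentSet_self, Finset.empty_inter]
  · rw [hex.2.choose_spec k, if_pos rfl, agentVec_zero]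
    funext i
    exact D.withdraw_eq_zero (by simp [h])

/-- From the viewpoint of this coalition `S` is just `{i}`, and by locality the withdrawals from
other coalitions do not matter. Hence the query about `i` alone gives the payment. -/
theorem arb_pair (hA : A.IsLocal) {S : Finset (Fin n)} (D : Deviation o S) {k : Fin o.m}
    {i j : Fin n} (hs : supp (o.coal k) = {i, j}) (hi : i ∈ S) (hj : j ∉ S) :
    A o S D k = (oracle G T A o).arb k i (D.withdraw k i) := by
  have hij : j ≠ i := by rintro rfl; exact hj hi
  have hout : ∀ S' : Finset (Fin n), j ∉ S' → k ∈ o.outer S' := fun S' hjS => by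
    rw [Outcome.mem_outer, hs]
    exact fun h => hjS (h (by simp))
  have hinter : S ∩ supp (o.coal k) = {i} := by
    rw [hs, Finset.inter_insert_of_mem hi, Finset.inter_singleton_of_notMem hj, insert_empty_eq]
  have hex : (k : ℕ) < o.m ∧ ∃ D' : Deviation o (agentSet n i),
      ∀ l, D'.withdraw l = if l.val = k then agentVec n i (D.withdraw k i) else 0 := by
    refine ⟨k.2, ⟨fun l => if l = k then agentVec n i (D.withdraw k i) else 0, fun l => ?_,
      fun l a ha => ?_, fun l hl => ?_⟩, fun l => by simp [Fin.val_inj]⟩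
    · split_ifs with hl
      · subst hl
        intro a
        rw [agentVec_apply]
        split_ifs with ha
        · rw [Fin.val_inj] at ha
          subst ha
          exact D.le_coal l a
        · exact Nat.zero_le _
      · exact fun a => Nat.zero_le _
    · rw [agentSet_val, Finset.mem_singleton] at ha
      split_ifs <;> simp [Fin.val_inj, ha]
    · refine if_neg ?_
      rintro rfl
      exact hl (hout _ (by rw [agentSet_val]; simpa using hij))
  simp only [oracle]
  rw [dif_pos hex]
  refine hA o o S _ D _ k k (hout S hj) (hout _ (by rw [agentSet_val]; simpa using hij)) rfl rfl
    ?_ ?_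
  · rw [hinter, agentSet_val, hs, Finset.inter_eq_left.2 (by simp)]
  · rw [hex.2.choose_spec k, if_pos rfl]
    funext a
    by_cases ha : a = i
    · subst ha; simp
    · rw [D.withdraw_eq_zero (by simp [hinter, ha])]
      simp [Fin.val_inj, ha]

variable [DecidableRel T.Adj]

/-- What a pair coalition pays after a deviation. -/
noncomputable def pairPayment (O : Oracle) {S : Finset (Fin n)} (D : Deviation o S)
    (k : Fin o.m) (i j : Fin n) : ℝ :=
  if i ∈ S then if j ∈ S then 0 else O.arb k i (D.withdraw k i)
  else if j ∈ S then O.arb k j (D.withdraw k j) else O.arb k n 0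

/-- After exchanging the sums the identity is checked coalition by coalition: a coalition of one
agent appears only at its vertex, one of two adjacent agents only at its edge, and any other one
pays nothing by admissibility. -/
theorem sum_payments (hA : A.IsLocal) (hadm : A.Admissible T o) {S : Finset (Fin n)}
    (D : Deviation o S) :
    ∑ k ∈ o.outer S, A o S D k =
      ∑ i with i ∉ S, ∑ k : Fin o.m, (if (oracle G T A o).IsSingle i k then (oracle G T A o).arb k n 0 else 0)
      + edgeSum T Finset.univ (fun i j => ∑ k : Fin o.m,
        if (oracle G T A o).IsPair i j k then pairPayment (oracle G T A o) D k i j else 0) := by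
  rw [edgeSum_sum, Finset.sum_comm, ← Finset.sum_add_distrib, Outcome.outer, Finset.sum_filter]
  refine Finset.sum_congr rfl fun k _ => ?_
  by_cases h1 : ∃ i, supp (o.coal k) = {i}
  · obtain ⟨i, hi⟩ := h1
    have hedge : edgeSum T Finset.univ (fun a b => if (oracle G T A o).IsPair a b k then
        pairPayment (oracle G T A o) D k a b else 0) = edgeSum T Finset.univ (fun _ _ => 0) := by
      refine edgeSum_congr fun a _ b _ hab _ => if_neg ?_
      rw [isPair_iff hab.ne, hi]
      intro h
      have h2 := congrArg Finset.card h
      rw [Finset.card_pair hab.ne, Finset.card_singleton] at h2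
      omega
    have hsing : ∀ a, (oracle G T A o).IsSingle (a : Fin n) k ↔ a = i := fun a => by
      rw [isSingle_iff, hi, Finset.singleton_inj, eq_comm]
    rw [hedge]
    simp only [hsing, hi, Finset.singleton_subset_iff]
    by_cases hiS : i ∈ S
    · rw [Finset.sum_eq_zero]
      · simp [hiS, edgeSum]
      · intro a ha
        simp only [Finset.mem_filter] at ha
        refine if_neg ?_
        rintro rfl
        exact ha.2 hiS
    · rw [Finset.sum_eq_single_of_mem i (by simp [hiS])]
      · rw [if_pos hiS, if_pos rfl, arb_disjoint hA (T := T) D (by simp [hi, hiS]) (by simp [hi, hiS])]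
        simp [edgeSum]
      · intro a _ ha
        exact if_neg ha
  have hsing : ∀ a, ¬ (oracle G T A o).IsSingle (a : Fin n) k := fun a ha =>
    h1 ⟨a, (isSingle_iff a k).1 ha⟩
  simp only [hsing, if_false, Finset.sum_const_zero, zero_add]
  by_cases h2 : ∃ i j, i < j ∧ T.Adj i j ∧ supp (o.coal k) = {i, j}
  · obtain ⟨i, j, hij, hadj, hs⟩ := h2
    have hedge : edgeSum T Finset.univ (fun a b => if (oracle G T A o).IsPair a b k then
        pairPayment (oracle G T A o) D k a b else 0) =
        edgeSum T Finset.univ (fun a b => if a = i ∧ b = j then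
          pairPayment (oracle G T A o) D k i j else 0) := by
      refine edgeSum_congr fun a _ b _ hab _ => ?_
      have hiff : (oracle G T A o).IsPair a b k ↔ a = i ∧ b = j := by
        rw [isPair_iff hab.ne, hs]
        constructor
        · intro h
          have ha : a ∈ ({i, j} : Finset (Fin n)) := by simp [h]
          have hb : b ∈ ({i, j} : Finset (Fin n)) := by simp [h]
          simp only [Finset.mem_insert, Finset.mem_singleton] at ha hb
          rcases ha with rfl | rfl <;> rcases hb with rfl | rfl
          · exact absurd rfl hab.ne
          · exact ⟨rfl, rfl⟩
          · exact absurd hij hab.not_gt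
          · exact absurd rfl hab.ne
        · rintro ⟨rfl, rfl⟩
          rfl
      by_cases hab' : a = i ∧ b = j
      · rw [if_pos (hiff.2 hab'), if_pos hab', hab'.1, hab'.2]
      · rw [if_neg (fun h => hab' (hiff.1 h)), if_neg hab']
    rw [hedge, edgeSum_single (Finset.mem_univ i) (Finset.mem_univ j) hij hadj]
    have hs' : supp (o.coal k) = {j, i} := by rw [hs, Finset.pair_comm]
    unfold pairPayment
    by_cases hi : i ∈ S <;> by_cases hj : j ∈ S
    · simp [hs, hi, hj, Finset.insert_subset_iff]
    · simp only [hs, hi, hj, Finset.insert_subset_iff, Finset.singleton_subset_iff, and_false,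
        not_false_eq_true, if_true, if_false]
      exact arb_pair hA D hs hi hj
    · simp only [hs, hi, hj, Finset.insert_subset_iff, Finset.singleton_subset_iff, false_and,
        not_false_eq_true, if_true, if_false]
      exact arb_pair hA D hs' hj hi
    · simp only [hs, hi, hj, Finset.insert_subset_iff, Finset.singleton_subset_iff, and_false,
        not_false_eq_true, if_true, if_false]
      refine arb_disjoint hA D ?_ ?_
      · simp [hs, hi, Finset.insert_subset_iff]
      · rw [hs, Finset.inter_insert_of_notMem hi, Finset.inter_singleton_of_notMem hj]
  · have hedge : edgeSum T Finset.univ (fun a b => if (oracle G T A o).IsPair a b k then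
        pairPayment (oracle G T A o) D k a b else 0) = edgeSum T Finset.univ (fun _ _ => 0) := by
      refine edgeSum_congr fun a _ b _ hab hadj => if_neg ?_
      rw [isPair_iff hab.ne]
      exact fun h => h2 ⟨a, b, hab, hadj, h⟩
    rw [hedge]
    simp only [edgeSum, ite_self, Finset.sum_const_zero]
    split_ifs with hk
    · rfl
    · rcases hadm k with h | h
      · rcases supp_cases h.1 h.2 with h | h
        · exact absurd h h1
        · exact absurd h h2
      · exact h S D (by simpa using hk)

/-- What a member `i` of `S` leaves in the pair coalitions with the agents outside `S`. -/
theorem sum_pairs_outer {S : Finset (Fin n)} {i : Fin n} (hi : i ∈ S) (f : Fin o.m → ℕ) :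
    ∑ j with T.Adj i j ∧ j ∉ S, ∑ k : Fin o.m, (if (oracle G T A o).IsPair i j k then f k else 0) =
      ∑ k ∈ o.outer S with ∃ j, T.Adj i j ∧ supp (o.coal k) = {i, j}, f k := by
  rw [Finset.sum_comm, Finset.sum_filter, Outcome.outer, Finset.sum_filter]
  refine Finset.sum_congr rfl fun k _ => ?_
  by_cases h : ∃ j, T.Adj i j ∧ supp (o.coal k) = {i, j}
  · obtain ⟨j, hadj, hs⟩ := h
    have hiff : ∀ a, T.Adj i a → ((oracle G T A o).IsPair i a k ↔ a = j) := by
      intro a ha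
      rw [isPair_iff ha.ne, hs]
      constructor
      · intro h
        have h1 : a ∈ ({i, j} : Finset (Fin n)) := by simp [h]
        simp only [Finset.mem_insert, Finset.mem_singleton] at h1
        exact h1.resolve_left ha.ne'
      · rintro rfl
        rfl
    rw [if_pos (⟨j, hadj, hs⟩ : ∃ j, T.Adj i j ∧ supp (o.coal k) = {i, j})]
    simp only [hs, Finset.insert_subset_iff, hi, Finset.singleton_subset_iff, true_and]
    by_cases hj : j ∈ S
    · rw [Finset.sum_eq_zero]
      · simp [hj]
      · intro a ha
        simp only [Finset.mem_filter, Finset.mem_univ, true_and] at ha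
        refine if_neg fun h => ha.2 ?_
        rw [(hiff a ha.1).1 h]
        exact hj
    · rw [Finset.sum_eq_single_of_mem j (by simp [hadj, hj])]
      · rw [if_pos ((hiff j hadj).2 rfl), if_pos hj]
      · intro a ha haj
        simp only [Finset.mem_filter, Finset.mem_univ, true_and] at ha
        exact if_neg fun h => haj ((hiff a ha.1).1 h)
  · rw [if_neg h, ite_self]
    refine Finset.sum_eq_zero fun a ha => if_neg ?_
    simp only [Finset.mem_filter, Finset.mem_univ, true_and] at ha
    rw [isPair_iff ha.1.ne]
    exact fun hs => h ⟨a, ha.1, hs⟩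

-- Withdrawals are bounded by contributions, so there are finitely many deviations and at least one.
-- This makes the real supremum in `best` a genuine one; over an unbounded set it would be `0` by
-- convention.
omit [DecidableRel T.Adj] in
theorem inCore_iff_forall : A.InCore o ↔ ∀ S D, A.value o S D ≤ o.payoff S := by
  have hfin : ∀ S, Finite (Deviation o S) := fun S => by
    have hf : (Set.Icc 0 o.coal).Finite := Set.finite_Icc _ _
    have := hf.to_subtype
    refine Finite.of_injective
      (fun D : Deviation o S => (⟨D.withdraw, fun _ _ => Nat.zero_le _, D.le_coal⟩ :
        Set.Icc 0 o.coal)) ?_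
    rintro ⟨w, _, _, _⟩ ⟨w', _, _, _⟩ h
    have h' : w = w' := congrArg Subtype.val h
    subst h'
    rfl
  have hne : ∀ S, Nonempty (Deviation o S) := fun S =>
    ⟨⟨fun _ _ => 0, fun _ _ => Nat.zero_le _, fun _ _ _ => rfl, fun _ _ => rfl⟩⟩
  refine forall_congr' fun S => ?_
  have := hfin S
  have := hne S
  exact ciSup_le_iff (Set.finite_range _).bddAbove

end Instance

/-! ### Deviations of sets and feasible choices on the tree -/

section Core

variable {n : ℕ} {G : Game n} {T : SimpleGraph (Fin n)} {A : Arbitration G} {o : Outcome G}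

theorem eq_of_pair_eq {i j j' : Fin n} (h : i ≠ j) (h' : ({i, j} : Finset (Fin n)) = {i, j'}) :
    j = j' := by
  have h1 : j ∈ ({i, j'} : Finset (Fin n)) := by simp [← h']
  simp only [Finset.mem_insert, Finset.mem_singleton] at h1
  exact h1.resolve_left h.symm

open Classical in
/-- The deviation in which the agents in `S` withdraw the prescribed amounts `d i j` from the pair
coalitions with agents outside `S`, and everything from all other coalitions that they do not fully
control. -/
noncomputable def pairDeviation (T : SimpleGraph (Fin n)) (S : Finset (Fin n))
    (d : Fin n → Fin n → Fin o.m → ℕ) (hd : ∀ i j k, d i j k ≤ o.coal k i) : Deviation o S where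
  withdraw k i :=
    if i ∈ S ∧ k ∈ o.outer S then
      -- The support determines the partner `j`, so `choose` returns the right one. Withdrawing
      -- everything elsewhere costs nothing for admissible outcomes: a coalition with the member `i`
      -- that is neither inside `S` nor a pair of `i` and a neighbour always pays `0`.
      if h : ∃ j, T.Adj i j ∧ supp (o.coal k) = {i, j} then d i h.choose k else o.coal k i
    else 0
  le_coal k i := by
    dsimp only
    split_ifs
    · exact hd _ _ _
    · exact le_rfl
    · exact Nat.zero_le _
  only_members k i hi := if_neg fun h => hi h.1
  only_outer k hk := by
    funext i
    exact if_neg fun h => hk h.2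

theorem pairDeviation_withdraw_pair {S : Finset (Fin n)} {d : Fin n → Fin n → Fin o.m → ℕ}
    (hd : ∀ i j k, d i j k ≤ o.coal k i) {k : Fin o.m} {i j : Fin n} (hi : i ∈ S) (hj : j ∉ S)
    (hadj : T.Adj i j) (hs : supp (o.coal k) = {i, j}) :
    (pairDeviation T S d hd).withdraw k i = d i j k := by
  have hex : ∃ j, T.Adj i j ∧ supp (o.coal k) = {i, j} := ⟨j, hadj, hs⟩
  have hk : k ∈ o.outer S := by
    rw [Outcome.mem_outer, hs]
    exact fun h => hj (h (by simp))
  have hj' : j = hex.choose := eq_of_pair_eq hadj.ne (hs.symm.trans hex.choose_spec.2)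
  simp only [pairDeviation]
  rw [if_pos ⟨hi, hk⟩, dif_pos hex, ← hj']

theorem pairDeviation_withdraw_of_not {S : Finset (Fin n)} {d : Fin n → Fin n → Fin o.m → ℕ}
    (hd : ∀ i j k, d i j k ≤ o.coal k i) {k : Fin o.m} {i : Fin n} (hi : i ∈ S)
    (hk : k ∈ o.outer S) (h : ¬ ∃ j, T.Adj i j ∧ supp (o.coal k) = {i, j}) :
    (pairDeviation T S d hd).withdraw k i = o.coal k i := by
  simp only [pairDeviation]
  rw [if_pos ⟨hi, hk⟩, dif_neg h]

theorem Game.supp_cases_of_ne_zero (h2 : G.IsKOCF 2) (hT : G.reduce T = G) {c : Fin n → ℕ}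
    (hc : G.v c ≠ 0) : (∃ i, supp c = {i}) ∨ ∃ i j, i < j ∧ T.Adj i j ∧ supp c = {i, j} := by
  have hW : c ≤ G.W := by
    by_contra h
    exact hc (G.v_outside c h)
  have hcard : (supp c).card ≤ 2 := by
    by_contra h
    exact hc (h2 c hW (by omega))
  refine supp_cases hcard ?_
  by_contra h
  refine hc ?_
  rw [← hT]
  simp [Game.reduce, h]

variable [DecidableRel T.Adj]

omit [DecidableRel T.Adj] in
theorem sum_vertexTerm {S : Finset (Fin n)} {σ x : Fin n → ℕ} (hS : ∀ i, i ∈ S → σ i = 1)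
    (hS' : ∀ i, i ∉ S → σ i = 0) :
    ∑ i, vertexTerm G (oracle G T A o) i (σ i) (x i) =
      ∑ i ∈ S, G.cover (agentVec n i (x i)) - o.payoff S +
        ∑ i with i ∉ S, ∑ k : Fin o.m,
          (if (oracle G T A o).IsSingle i k then (oracle G T A o).arb k n 0 else 0) := by
  have hag : (oracle G T A o).agents = n := rfl
  have hm : (oracle G T A o).coalitions = o.m := rfl
  rw [Outcome.payoff, ← Finset.sum_sub_distrib, ← Finset.sum_filter_add_sum_filter_not _ (· ∈ S)]
  congr 1
  · rw [Finset.filter_mem_eq_inter, Finset.univ_inter]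
    refine Finset.sum_congr rfl fun i hi => ?_
    rw [vertexTerm, hS i hi, if_neg one_ne_zero, hm, Finset.sum_range]
    simp
  · refine Finset.sum_congr rfl fun i hi => ?_
    simp only [Finset.mem_filter, Finset.mem_univ, true_and] at hi
    rw [vertexTerm, hS' i hi, if_pos rfl, hm, Finset.sum_range, hag]

theorem edgeSum_cover_add (S : Finset (Fin n)) (b : Fin n → Fin n → ℕ)
    (f : Fin n → Fin n → ℝ) :
    edgeSum T S (fun i j => G.cover (agentVec n i (b i j) + agentVec n j (b j i))) +
      edgeSum T Finset.univ f = edgeSum T Finset.univ (fun i j => (if i ∈ S ∧ j ∈ S then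
        G.cover (agentVec n i (b i j) + agentVec n j (b j i)) else 0) + f i j) := by
  rw [edgeSum_add, ← edgeSum_filter, Finset.filter_mem_eq_inter, Finset.univ_inter]

/-- A deviation and a coalition structure for its resources yield a choice on the tree whose
objective is at least the excess they achieve. Members of `S` get the state `1`; on an edge that
leaves `S`, the budget is what the member leaves in the pair coalitions of that edge. -/
theorem inCore_of_nonPos (h2 : G.IsKOCF 2) (hT : G.reduce T = G) (hA : A.IsLocal)
    (hadm : A.Admissible T o)
    (h : NonPos T G.W Finset.univ (vertexTerm G (oracle G T A o)) (edgeTerm G (oracle G T A o))) :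
    A.InCore o := by
  have hm : (oracle G T A o).coalitions = o.m := rfl
  rw [inCore_iff_forall]
  intro S D
  rw [Arbitration.value, ← le_sub_iff_add_le]
  refine Game.cover_le fun CS hCS => ?_
  rw [le_sub_iff_add_le]
  have hav : ∀ i ∈ S, D.available i = G.W i - ∑ k ∈ o.outer S, (o.coal k i - D.withdraw k i) :=
    fun i hi => if_pos hi
  obtain ⟨x, b, hx, hle⟩ := exists_cover_decomposition (T := T) (S := S)
    (fun c hc => Game.supp_cases_of_ne_zero h2 hT hc) CS
    (fun i hi => by rw [hCS]; exact if_neg hi)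
  set b' : Fin n → Fin n → ℕ := fun i j => if i ∈ S then if j ∈ S then b i j else
    ∑ k : Fin o.m, (if (oracle G T A o).IsPair i j k then o.coal k i - D.withdraw k i else 0)
    else 0 with hb'
  set σ : Fin n → ℕ := fun i => if i ∈ S then 1 else 0 with hσ
  -- Budgets must be divided completely, so the private part is all that remains; for members it is
  -- at least `x i` by `hsum`.
  set x' : Fin n → ℕ := fun i => G.W i - ∑ j with T.Adj i j, b' i j with hx'
  have hsum : ∀ i ∈ S, x i + ∑ j with T.Adj i j, b' i j ≤ G.W i := by
    intro i hi
    rw [← Finset.sum_filter_add_sum_filter_not _ (· ∈ S), Finset.filter_filter,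
      Finset.filter_filter]
    have e1 : ∑ j with T.Adj i j ∧ j ∈ S, b' i j = ∑ j ∈ S with T.Adj i j, b i j := by
      refine Finset.sum_congr ?_ fun j hj => ?_
      · ext j
        simp [and_comm]
      · simp only [Finset.mem_filter] at hj
        simp [hb', hi, hj.1]
    have e2 : ∑ j with T.Adj i j ∧ j ∉ S, b' i j ≤
        ∑ k ∈ o.outer S, (o.coal k i - D.withdraw k i) := by
      have e0 : ∑ j with T.Adj i j ∧ j ∉ S, b' i j = ∑ j with T.Adj i j ∧ j ∉ S, ∑ k : Fin o.m,
          (if (oracle G T A o).IsPair i j k then o.coal k i - D.withdraw k i else 0) := by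
        refine Finset.sum_congr rfl fun j hj => ?_
        simp only [Finset.mem_filter, Finset.mem_univ, true_and] at hj
        simp [hb', hi, hj.2]
      rw [e0, sum_pairs_outer hi]
      exact Finset.sum_le_sum_of_subset (Finset.filter_subset _ _)
    -- Excludes truncation in the subtraction that defines the available resources.
    have e3 : ∑ k ∈ o.outer S, (o.coal k i - D.withdraw k i) ≤ G.W i := by
      refine le_trans (Finset.sum_le_sum fun k _ => Nat.sub_le _ _) (le_trans ?_ (o.weight_le i))
      exact Finset.sum_le_sum_of_subset (Finset.subset_univ _)
    have e4 := hx i hi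
    rw [hCS, hav i hi] at e4
    rw [e1]
    omega
  have hF : Feasible T G.W Finset.univ σ x' b' := by
    intro i _
    refine ⟨by simp only [hσ]; split_ifs <;> omega, ?_⟩
    have : ∑ j with T.Adj i j, b' i j ≤ G.W i := by
      by_cases hi : i ∈ S
      · have := hsum i hi
        omega
      · simp [hb', hi]
    simp only [hx']
    omega
  have hobj := h σ x' b' hF
  rw [objective, sum_vertexTerm (S := S) (by simp +contextual [hσ]) (by simp +contextual [hσ])]
    at hobj
  have hcov : ∑ i ∈ S, G.cover (agentVec n i (x i)) ≤ ∑ i ∈ S, G.cover (agentVec n i (x' i)) := by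
    refine Finset.sum_le_sum fun i hi => Game.cover_mono fun a => ?_
    have := hsum i hi
    simp only [agentVec_apply, hx']
    split_ifs <;> omega
  have hret : ∀ i j, i ∈ S → j ∉ S → T.Adj i j →
      ∑ k : Fin o.m, (if (oracle G T A o).IsPair i j k then
        (oracle G T A o).arb k i (D.withdraw k i) else 0) ≤
      sSup ((oracle G T A o).retSet i j o.m (b' i j)) := by
    intro i j hi hj hadj
    refine (Oracle.isGreatest_sSup_retSet _ _ _ _).2
      ⟨fun l => if hl : l < o.m then D.withdraw ⟨l, hl⟩ i else 0, fun l => ?_, ?_, ?_⟩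
    · dsimp only
      split_ifs with hl
      · exact (D.le_coal ⟨l, hl⟩ i).trans
          (oracle_contrib (T := T) (A := A) (⟨l, hl⟩ : Fin o.m) i).ge
      · exact Nat.zero_le _
    · rw [Finset.sum_range]
      simp [hb', hi, hj]
    · rw [Finset.sum_range]
      simp
  have hedge : edgeSum T S (fun i j => G.cover (agentVec n i (b i j) + agentVec n j (b j i))) +
      edgeSum T Finset.univ (fun i j => ∑ k : Fin o.m,
        if (oracle G T A o).IsPair i j k then pairPayment (oracle G T A o) D k i j else 0) ≤
      edgeSum T Finset.univ
        (fun i j => edgeTerm G (oracle G T A o) i j (σ i) (σ j) (b' i j) (b' j i)) := by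
    rw [edgeSum_cover_add]
    refine edgeSum_mono fun i _ j _ _ hadj => ?_
    by_cases hi : i ∈ S <;> by_cases hj : j ∈ S
    · simp [hi, hj, pairPayment, edgeTerm, hσ, hb']
    · simpa [hi, hj, pairPayment, edgeTerm, hσ, hm] using hret i j hi hj hadj
    · simpa [hi, hj, pairPayment, edgeTerm, hσ, hm, Oracle.isPair_comm _ i j]
        using hret j i hj hi hadj.symm
    · have hag : (oracle G T A o).agents = n := rfl
      simp [hi, hj, pairPayment, edgeTerm, hσ, hm, hag, Finset.sum_range]
  rw [sum_payments hA hadm D]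
  linarith

/-- A feasible choice becomes a deviation of the set of agents with state `1`: on each edge that
leaves the set, the member withdraws as in a maximizer for the budget of that edge. What it leaves
behind fits into this budget, so the resources suffice for all planned coalitions, and the objective
is at most the excess of the deviation. -/
theorem nonPos_of_inCore (hA : A.IsLocal) (hadm : A.Admissible T o) (h : A.InCore o) :
    NonPos T G.W Finset.univ (vertexTerm G (oracle G T A o)) (edgeTerm G (oracle G T A o)) := by
  have hm : (oracle G T A o).coalitions = o.m := rfl
  rw [inCore_iff_forall] at h
  intro σ x b hF
  set S : Finset (Fin n) := Finset.univ.filter (fun i => σ i = 1) with hS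
  have hσ1 : ∀ i, i ∈ S → σ i = 1 := by simp [hS]
  have hσ0 : ∀ i, i ∉ S → σ i = 0 := by
    intro i hi
    simp only [hS, Finset.mem_filter, Finset.mem_univ, true_and] at hi
    have := (hF i (Finset.mem_univ i)).1
    omega
  have hmax := fun i j : Fin n =>
    (Oracle.isGreatest_sSup_retSet (O := oracle G T A o) i j o.m (b i j)).1
  choose d hd hsum hval using hmax
  have hd' : ∀ i j (k : Fin o.m), d i j k ≤ o.coal k i := fun i j k =>
    (hd i j k).trans (oracle_contrib k i).le
  set D : Deviation o S := pairDeviation T S (fun i j k => d i j k) hd' with hD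
  have hle := h S D
  rw [Arbitration.value, sum_payments hA hadm D] at hle
  rw [objective, sum_vertexTerm hσ1 hσ0]
  have hcov : ∑ i ∈ S, G.cover (agentVec n i (x i)) +
      edgeSum T S (fun i j => G.cover (agentVec n i (b i j) + agentVec n j (b j i))) ≤
      G.cover D.available := by
    refine sum_cover_add_edgeSum_le fun i hi => ?_
    have e1 : D.available i = G.W i - ∑ k ∈ o.outer S, (o.coal k i - D.withdraw k i) := if_pos hi
    -- Only pair coalitions with outsiders retain anything, since `D` withdraws everything from the
    -- other ones.
    have e2 : ∑ k ∈ o.outer S, (o.coal k i - D.withdraw k i) ≤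
        ∑ j with T.Adj i j ∧ j ∉ S, b i j := by
      calc ∑ k ∈ o.outer S, (o.coal k i - D.withdraw k i)
          = ∑ k ∈ o.outer S with ∃ j, T.Adj i j ∧ supp (o.coal k) = {i, j},
              (o.coal k i - D.withdraw k i) := by
            symm
            refine Finset.sum_filter_of_ne fun k hk hne => ?_
            by_contra hex
            exact hne (by rw [hD, pairDeviation_withdraw_of_not hd' hi hk hex, Nat.sub_self])
        _ = ∑ j with T.Adj i j ∧ j ∉ S, ∑ k : Fin o.m, (if (oracle G T A o).IsPair i j k then
              o.coal k i - D.withdraw k i else 0) := (sum_pairs_outer hi _).symm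
        _ ≤ _ := by
            refine Finset.sum_le_sum fun j hj => ?_
            simp only [Finset.mem_filter, Finset.mem_univ, true_and] at hj
            refine le_trans (le_of_eq ?_) (hsum i j)
            rw [Finset.sum_range]
            refine Finset.sum_congr rfl fun k _ => ?_
            split_ifs with hk
            · rw [hD, pairDeviation_withdraw_pair hd' hi hj.2 hj.1 ((isPair_iff hj.1.ne k).1 hk),
                oracle_contrib]
            · rfl
    have e3 := (hF i (Finset.mem_univ i)).2
    rw [← Finset.sum_filter_add_sum_filter_not _ (· ∈ S), Finset.filter_filter,
      Finset.filter_filter] at e3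
    have e4 : ∑ j with T.Adj i j ∧ j ∈ S, b i j = ∑ j ∈ S with T.Adj i j, b i j := by
      refine Finset.sum_congr ?_ fun j hj => rfl
      ext j
      simp [and_comm]
    rw [e4] at e3
    omega
  have hret : ∀ i j, i ∈ S → j ∉ S → T.Adj i j →
      sSup ((oracle G T A o).retSet i j o.m (b i j)) =
      ∑ k : Fin o.m, (if (oracle G T A o).IsPair i j k then
        (oracle G T A o).arb k i (D.withdraw k i) else 0) := by
    intro i j hi hj hadj
    rw [hval i j, Finset.sum_range]
    refine Finset.sum_congr rfl fun k _ => ?_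
    split_ifs with hk
    · rw [hD, pairDeviation_withdraw_pair hd' hi hj hadj ((isPair_iff hadj.ne k).1 hk)]
    · rfl
  have hedge : edgeSum T Finset.univ
        (fun i j => edgeTerm G (oracle G T A o) i j (σ i) (σ j) (b i j) (b j i)) =
      edgeSum T S (fun i j => G.cover (agentVec n i (b i j) + agentVec n j (b j i))) +
      edgeSum T Finset.univ (fun i j => ∑ k : Fin o.m,
        if (oracle G T A o).IsPair i j k then pairPayment (oracle G T A o) D k i j else 0) := by
    rw [edgeSum_cover_add]
    refine edgeSum_congr fun i _ j _ _ hadj => ?_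
    by_cases hi : i ∈ S <;> by_cases hj : j ∈ S
    · simp [hi, hj, pairPayment, edgeTerm, hσ1]
    · simpa [hi, hj, pairPayment, edgeTerm, hσ1, hσ0, hm] using hret i j hi hj hadj
    · simpa [hi, hj, pairPayment, edgeTerm, hσ1, hσ0, hm, Oracle.isPair_comm _ i j]
        using hret j i hj hi hadj.symm
    · have hag : (oracle G T A o).agents = n := rfl
      simp [hi, hj, pairPayment, edgeTerm, hσ0, hm, hag, Finset.sum_range]
  rw [hedge]
  linarith

end Core

/-! ### The program

Names of the arrays of natural numbers: `0` the answer, `1` the numbers of contributors, `2` the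
eliminated agents, `3` and `4` the leaf and its neighbour, `5` and `6` auxiliary, `10` to `14` loop
counters.  Names of the arrays of real numbers: `0`, `1` and `5` sums, `2` edge terms, `3` and `4`
payments of the pair coalitions, `6` auxiliary, `7` vertex terms, `8` covers. -/

/-- A scalar variable. -/
def NExp.var (a : ℕ) : NExp := .get a (.lit 0) (.lit 0) (.lit 0)

/-- The number `x + 1`, for `x ≤ w`; the bound on its value depends on `w` only. -/
def NExp.upto (w x : NExp) : NExp := .sub (.add w (.lit 1)) (.sub w x)

/-- Test whether the coalition `k` is a pair coalition of `i` and `j`. -/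
def BExp.isPair (i j k : NExp) : BExp :=
  .and (.nle (.lit 1) (.contrib k i)) (.and (.nle (.lit 1) (.contrib k j))
    (.nle (.get 1 k (.lit 0) (.lit 0)) (.lit 2)))

/-- Test whether the coalition `k` consists of agent `i` alone. -/
def BExp.isSingle (i k : NExp) : BExp :=
  .and (.nle (.lit 1) (.contrib k i)) (.nle (.get 1 k (.lit 0) (.lit 0)) (.lit 1))

theorem NExp.eval_upto {O : Oracle} {s : Mem} {w x : NExp} (h : x.eval O s ≤ w.eval O s) :
    (NExp.upto w x).eval O s = x.eval O s + 1 := by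
  simp only [NExp.upto, NExp.eval]
  omega

/-- The invariant rule for loops; the arrays to which the loop does not write are unchanged. -/
theorem Prog.ex_loop_frame {O : Oracle} {s : Mem} {a : ℕ} {bound : NExp} {body : Prog} {N : ℕ}
    (Inv : ℕ → Mem → Prop) (hN : bound.eval O s = N) (h0 : Inv 0 s)
    (hstep : ∀ i < N, ∀ u : Mem,
      (∀ b ∉ (Prog.loop a bound body).writesN, u.nat b = s.nat b) →
      (∀ b ∉ (Prog.loop a bound body).writesR, u.real b = s.real b) →
      Inv i u → Inv (i + 1) (body.ex O (u.setNat a 0 0 0 i))) :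
    Inv N ((Prog.loop a bound body).ex O s) := by
  refine (Prog.ex_loop_induction O s (fun i u =>
    (∀ b ∉ (Prog.loop a bound body).writesN, u.nat b = s.nat b) ∧
    (∀ b ∉ (Prog.loop a bound body).writesR, u.real b = s.real b) ∧ Inv i u) hN
    ⟨fun _ _ => rfl, fun _ _ => rfl, h0⟩ ?_).2.2
  rintro i hi u ⟨h1, h2, h3⟩
  refine ⟨fun b hb => ?_, fun b hb => ?_, hstep i hi u h1 h2 h3⟩
  · rw [← h1 b hb]
    simp only [Prog.writesN, List.mem_cons, not_or] at hb
    rw [Prog.ex_nat_eq _ _ _ hb.2, Mem.setNat_nat_of_ne _ _ _ _ _ hb.1]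
  · rw [← h2 b hb]
    exact Prog.ex_real_eq _ _ _ hb

theorem MaxStep.upd_of_eval (C : List ℕ) {O : Oracle} {a : ℕ} {x y z : NExp} {e : RExp} {s : Mem}
    {x' y' z' : ℕ} {r : ℝ} (hx : x.eval O s = x') (hy : y.eval O s = y') (hz : z.eval O s = z')
    (he : e.eval O s = r) : MaxStep C a x' y' z' {r} s ((Prog.upd a x y z e).ex O s) := by
  subst hx hy hz he
  exact MaxStep.upd C

theorem MaxStep.ite_upd (C : List ℕ) {O : Oracle} {a : ℕ} {x y z : NExp} {e : RExp} {s : Mem}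
    {x' y' z' : ℕ} {r : ℝ} {b : BExp} {P : Prop} (hb : b.Holds O s ↔ P) (hx : x.eval O s = x')
    (hy : y.eval O s = y') (hz : z.eval O s = z') (he : P → e.eval O s = r) :
    MaxStep C a x' y' z' {r' | P ∧ r' = r} s
      ((Prog.ite b (Prog.upd a x y z e) .skip).ex O s) := by
  by_cases h : P
  · rw [Prog.ex_ite_pos _ _ _ _ (hb.2 h)]
    refine (MaxStep.upd_of_eval C hx hy hz (he h)).mono (List.Subset.refl _) ?_
    ext r'
    simp [h]
  · rw [Prog.ex_ite_neg _ _ _ _ (fun h' => h (hb.1 h'))]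
    refine (MaxStep.refl C a x' y' z' s).mono (List.Subset.refl _) ?_
    ext r'
    simp [h]

/-! ### Numbers of contributors -/

/-- Count the contributors of all coalitions. -/
def countProg : Prog :=
  .loop 10 .coalitions (.seq (.setN 1 (.var 10) (.lit 0) (.lit 0) (.lit 0))
    (.loop 11 .agents (.ite (.nle (.lit 1) (.contrib (.var 10) (.var 11)))
      (.setN 1 (.var 10) (.lit 0) (.lit 0)
        (.add (.get 1 (.var 10) (.lit 0) (.lit 0)) (.lit 1))) .skip)))

theorem countProg_spec (O : Oracle) (s : Mem) :
    ∀ k < O.coalitions, (countProg.ex O s).nat 1 k 0 0 = O.contributors k := by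
  refine Prog.ex_loop_frame (fun m u => ∀ k < m, u.nat 1 k 0 0 = O.contributors k) rfl
    (fun k hk => absurd hk (Nat.not_lt_zero k)) ?_
  intro k _ u _ _ hu
  rw [Prog.ex_seq]
  set w := (Prog.setN 1 (.var 10) (.lit 0) (.lit 0) (.lit 0)).ex O (u.setNat 10 0 0 0 k) with hw
  have hw10 : w.nat 10 0 0 0 = k := by simp [hw, Mem.setNat_nat]
  have hw1 : ∀ k', w.nat 1 k' 0 0 = if k' = k then 0 else u.nat 1 k' 0 0 := by
    intro k'
    simp [hw, Mem.setNat_nat, NExp.eval, NExp.var]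
  have key := Prog.ex_loop_frame (O := O) (s := w) (a := 11) (bound := .agents)
    (body := .ite (.nle (.lit 1) (.contrib (.var 10) (.var 11)))
      (.setN 1 (.var 10) (.lit 0) (.lit 0)
        (.add (.get 1 (.var 10) (.lit 0) (.lit 0)) (.lit 1))) .skip) (N := O.agents)
    (fun i t => t.nat 10 0 0 0 = k ∧ (∀ k' ≠ k, t.nat 1 k' 0 0 = u.nat 1 k' 0 0) ∧
      t.nat 1 k 0 0 = ((Finset.range i).filter (fun i => 1 ≤ O.contrib k i)).card) rfl
    ⟨hw10, fun k' hk' => by simp [hw1, hk'], by simp [hw1]⟩ ?_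
  · intro k' hk'
    rcases Nat.lt_succ_iff_lt_or_eq.1 hk' with h | rfl
    · rw [key.2.1 k' h.ne, hu k' h]
    · exact key.2.2
  · rintro i _ t _ _ ⟨h10, hne, hk⟩
    rw [Finset.range_add_one, Finset.filter_insert]
    by_cases h : 1 ≤ O.contrib k i
    · rw [Prog.ex_ite_pos _ _ _ _ (by simpa [BExp.Holds, NExp.eval, NExp.var, Mem.setNat_nat, h10])]
      refine ⟨by simp [NExp.eval, NExp.var, Mem.setNat_nat, h10], fun k' hk' => ?_, ?_⟩
      · simp [NExp.eval, NExp.var, Mem.setNat_nat, h10, hk', hne k' hk']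
      · rw [if_pos h, Finset.card_insert_of_notMem (by simp)]
        simp [NExp.eval, NExp.var, Mem.setNat_nat, h10, hk]
    · rw [Prog.ex_ite_neg _ _ _ _
        (by simpa [BExp.Holds, NExp.eval, NExp.var, Mem.setNat_nat, h10] using h)]
      refine ⟨by simp [Mem.setNat_nat, h10], fun k' hk' => ?_, ?_⟩
      · simp [Mem.setNat_nat, hne k' hk']
      · rw [if_neg h]
        simp [Mem.setNat_nat, hk]

/-! ### Covers of one or two agents -/

/-- Compute the cover of the coalitions of the agents in the variables `4` and `3`. -/
def coverProg : Prog :=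
  .loop 10 (.add (.weight (.var 4)) (.lit 1)) (.loop 11 (.add (.weight (.var 3)) (.lit 1))
    (.seq (.setR 8 (.var 10) (.var 11) (.lit 0) .zero)
      (.loop 12 (.upto (.weight (.var 4)) (.var 10)) (.loop 13 (.upto (.weight (.var 3)) (.var 11))
        (.ite (.nle (.lit 1) (.add (.var 12) (.var 13)))
          (.upd 8 (.var 10) (.var 11) (.lit 0)
            (.add (.get 8 (.sub (.var 10) (.var 12)) (.sub (.var 11) (.var 13)) (.lit 0))
              (.val (.var 4) (.var 12) (.var 3) (.var 13)))) .skip)))))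

/-- `F` may be any solution of the recursion. The condition `1 ≤ b' + e'` makes every entry that is
read lexicographically earlier than the one being computed, hence final. -/
theorem coverProg_spec (O : Oracle) (s : Mem) {p c : ℕ} (hp : s.nat 4 0 0 0 = p)
    (hc : s.nat 3 0 0 0 = c) (F : ℕ → ℕ → ℝ)
    (hF : ∀ b ≤ O.weight p, ∀ e ≤ O.weight c, IsLUB (insert 0 {r | ∃ b' ≤ b, ∃ e' ≤ e,
      1 ≤ b' + e' ∧ r = F (b - b') (e - e') + O.val p b' c e'}) (F b e)) :
    ∀ b ≤ O.weight p, ∀ e ≤ O.weight c, (coverProg.ex O s).real 8 b e 0 = F b e := by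
  have main := Prog.ex_loop_frame (O := O) (s := s) (a := 10)
    (bound := .add (.weight (.var 4)) (.lit 1)) (body := .loop 11 (.add (.weight (.var 3)) (.lit 1))
    (.seq (.setR 8 (.var 10) (.var 11) (.lit 0) .zero)
      (.loop 12 (.upto (.weight (.var 4)) (.var 10)) (.loop 13 (.upto (.weight (.var 3)) (.var 11))
        (.ite (.nle (.lit 1) (.add (.var 12) (.var 13)))
          (.upd 8 (.var 10) (.var 11) (.lit 0)
            (.add (.get 8 (.sub (.var 10) (.var 12)) (.sub (.var 11) (.var 13)) (.lit 0))
              (.val (.var 4) (.var 12) (.var 3) (.var 13)))) .skip)))))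
    (N := O.weight p + 1)
    (fun m u => ∀ b < m, ∀ e ≤ O.weight c, u.real 8 b e 0 = F b e)
    (by simp [NExp.eval, NExp.var, hp]) (fun b hb => absurd hb (Nat.not_lt_zero b)) ?_
  · exact fun b hb => main b (Nat.lt_succ_of_le hb)
  intro b hb u hun _ hu
  have hu4 : u.nat 4 0 0 0 = p := by rw [hun 4 (by decide), hp]
  have hu3 : u.nat 3 0 0 0 = c := by rw [hun 3 (by decide), hc]
  have inner := Prog.ex_loop_frame (O := O) (s := u.setNat 10 0 0 0 b) (a := 11)
    (bound := .add (.weight (.var 3)) (.lit 1)) (body :=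
      .seq (.setR 8 (.var 10) (.var 11) (.lit 0) .zero)
      (.loop 12 (.upto (.weight (.var 4)) (.var 10)) (.loop 13 (.upto (.weight (.var 3)) (.var 11))
        (.ite (.nle (.lit 1) (.add (.var 12) (.var 13)))
          (.upd 8 (.var 10) (.var 11) (.lit 0)
            (.add (.get 8 (.sub (.var 10) (.var 12)) (.sub (.var 11) (.var 13)) (.lit 0))
              (.val (.var 4) (.var 12) (.var 3) (.var 13)))) .skip))))
    (N := O.weight c + 1)
    (fun m w => (∀ b' < b, ∀ e ≤ O.weight c, w.real 8 b' e 0 = F b' e) ∧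
      ∀ e < m, w.real 8 b e 0 = F b e)
    (by simp [NExp.eval, NExp.var, Mem.setNat_nat, hu3])
    ⟨hu, fun e he => absurd he (Nat.not_lt_zero e)⟩ ?_
  · intro b' hb' e he
    rcases Nat.lt_succ_iff_lt_or_eq.1 hb' with h | rfl
    · exact inner.1 b' h e he
    · exact inner.2 e (Nat.lt_succ_of_le he)
  rintro e he w hwn _ ⟨hw1, hw2⟩
  rw [Prog.ex_seq]
  have hw10 : w.nat 10 0 0 0 = b := by rw [hwn 10 (by decide)]; simp
  have hw4 : w.nat 4 0 0 0 = p := by rw [hwn 4 (by decide)]; simpa [Mem.setNat_nat] using hu4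
  have hw3 : w.nat 3 0 0 0 = c := by rw [hwn 3 (by decide)]; simpa [Mem.setNat_nat] using hu3
  set t := (Prog.setR 8 (.var 10) (.var 11) (.lit 0) .zero).ex O (w.setNat 11 0 0 0 e) with ht
  have ht' : t = (w.setNat 11 0 0 0 e).setReal 8 b e 0 0 := by
    simp [ht, NExp.eval, NExp.var, RExp.eval, Mem.setNat_nat, hw10]
  have ht10 : t.nat 10 0 0 0 = b := by simpa [ht', Mem.setNat_nat] using hw10
  have ht11 : t.nat 11 0 0 0 = e := by simp [ht']
  have ht4 : t.nat 4 0 0 0 = p := by simpa [ht', Mem.setNat_nat] using hw4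
  have ht3 : t.nat 3 0 0 0 = c := by simpa [ht', Mem.setNat_nat] using hw3
  -- The nested sets follow the nested loops, one existential quantifier for each application of
  -- `MaxStep.loop`.
  have hmax : MaxStep [12, 13] 8 b e 0 {r | ∃ b' < b + 1, r ∈ {r | ∃ e' < e + 1,
      r ∈ {r | 1 ≤ b' + e' ∧ r = F (b - b') (e - e') + O.val p b' c e'}}} t
      ((Prog.loop 12 (.upto (.weight (.var 4)) (.var 10))
        (.loop 13 (.upto (.weight (.var 3)) (.var 11))
        (.ite (.nle (.lit 1) (.add (.var 12) (.var 13)))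
          (.upd 8 (.var 10) (.var 11) (.lit 0)
            (.add (.get 8 (.sub (.var 10) (.var 12)) (.sub (.var 11) (.var 13)) (.lit 0))
              (.val (.var 4) (.var 12) (.var 3) (.var 13)))) .skip))).ex O t) := by
    refine MaxStep.loop _ ?_ (by decide) ?_
    · rw [NExp.eval_upto] <;> simp only [NExp.eval, NExp.var, ht10, ht4]
      omega
    intro b' hb' t₁ S₁ h₁ hb₁
    refine (MaxStep.loop (C := [13]) _ ?_ (by decide) ?_).mono (by decide) rfl
    · have h11 : t₁.nat 11 0 0 0 = e := by rw [h₁.nat_val (by decide), ht11]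
      have h3 : t₁.nat 3 0 0 0 = c := by rw [h₁.nat_val (by decide), ht3]
      rw [NExp.eval_upto] <;> simp only [NExp.eval, NExp.var, h11, h3]
      omega
    intro e' he' t₂ S₂ h₂ he₂
    have hb₂ : t₂.nat 12 0 0 0 = b' := by rw [h₂.nat_val (by decide), hb₁]
    have h12 := h₁.trans (h₂.mono (C' := [12, 13]) (by decide) rfl)
    have h10 : t₂.nat 10 0 0 0 = b := by rw [h12.nat_val (by decide), ht10]
    have h11 : t₂.nat 11 0 0 0 = e := by rw [h12.nat_val (by decide), ht11]
    have h4 : t₂.nat 4 0 0 0 = p := by rw [h12.nat_val (by decide), ht4]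
    have h3 : t₂.nat 3 0 0 0 = c := by rw [h12.nat_val (by decide), ht3]
    refine MaxStep.ite_upd _ ?_ ?_ ?_ ?_ ?_
    · simp [BExp.Holds, NExp.eval, NExp.var, hb₂, he₂]
    · simp [NExp.eval, NExp.var, h10]
    · simp [NExp.eval, NExp.var, h11]
    · rfl
    · intro hpos
      simp only [RExp.eval, NExp.eval, NExp.var, h10, h11, h4, h3, hb₂, he₂]
      rw [h12.real_eq 8 _ _ _ (by omega), ht', Mem.setReal_real, if_neg (by omega),
        Mem.setNat_real]
      -- For `b' = 0` the entry that is read lies in the current row, at `e - e' < e`; otherwise it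
      -- lies in an earlier row.
      by_cases hb0 : b' = 0
      · subst hb0
        rw [Nat.sub_zero, hw2 _ (by omega)]
      · rw [hw1 _ (by omega) _ (by omega)]
  set z := (Prog.loop 12 (.upto (.weight (.var 4)) (.var 10))
        (.loop 13 (.upto (.weight (.var 3)) (.var 11))
        (.ite (.nle (.lit 1) (.add (.var 12) (.var 13)))
          (.upd 8 (.var 10) (.var 11) (.lit 0)
            (.add (.get 8 (.sub (.var 10) (.var 12)) (.sub (.var 11) (.var 13)) (.lit 0))
              (.val (.var 4) (.var 12) (.var 3) (.var 13)))) .skip))).ex O t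
  have hother : ∀ b' e', ¬ (b' = b ∧ e' = e) → z.real 8 b' e' 0 = w.real 8 b' e' 0 := by
    intro b' e' hne
    rw [hmax.real_eq 8 _ _ _ (by tauto), ht', Mem.setReal_real, if_neg (by tauto),
      Mem.setNat_real]
  refine ⟨fun b' hb' e' he' => ?_, fun e' he' => ?_⟩
  · rw [hother _ _ (by omega), hw1 b' hb' e' he']
  · rcases Nat.lt_succ_iff_lt_or_eq.1 he' with h | rfl
    · rw [hother _ _ (by omega), hw2 e' h]
    -- The entry was initialized with `0`, which is the element inserted in the recursion.
    · refine hmax.isGreatest.isLUB.unique ?_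
      have h0 : t.real 8 b e' 0 = 0 := by simp [ht']
      rw [h0]
      refine Eq.subst (motive := fun S => IsLUB (insert 0 S) (F b e')) ?_ (hF b (by omega) e' (by omega))
      ext r
      simp only [Set.mem_ofPred_eq, Nat.lt_succ_iff]

/-! ### Payments of the pair coalitions -/

theorem BExp.isPair_holds {O : Oracle} {s : Mem} {i j k : NExp}
    (h : s.nat 1 (k.eval O s) 0 0 = O.contributors (k.eval O s)) :
    (BExp.isPair i j k).Holds O s ↔ O.IsPair (i.eval O s) (j.eval O s) (k.eval O s) := by
  simp [BExp.isPair, BExp.Holds, NExp.eval, h, Oracle.IsPair]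

theorem BExp.isSingle_holds {O : Oracle} {s : Mem} {i k : NExp}
    (h : s.nat 1 (k.eval O s) 0 0 = O.contributors (k.eval O s)) :
    (BExp.isSingle i k).Holds O s ↔ O.IsSingle (i.eval O s) (k.eval O s) := by
  simp [BExp.isSingle, BExp.Holds, NExp.eval, h, Oracle.IsSingle]

/-- The maximization in one entry of the table of payments. -/
def retCell (a pv : ℕ) : Prog :=
  .loop 12 (.upto (.weight (.var pv)) (.var 11))
    (.ite (.nle (.var 12) (.contrib (.var 10) (.var pv)))
      (.upd a (.add (.var 10) (.lit 1)) (.var 11) (.lit 0)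
        (.add (.get a (.var 10) (.sub (.var 11) (.var 12)) (.lit 0))
          (.arb (.var 10) (.var pv) (.sub (.contrib (.var 10) (.var pv)) (.var 12))))) .skip)

/-- One entry of the table of payments. -/
def retEntry (a pv cv : ℕ) : Prog :=
  .ite (.isPair (.var pv) (.var cv) (.var 10))
    (.seq (.setR a (.add (.var 10) (.lit 1)) (.var 11) (.lit 0)
      (.add (.get a (.var 10) (.var 11) (.lit 0))
        (.arb (.var 10) (.var pv) (.contrib (.var 10) (.var pv))))) (retCell a pv))
    (.setR a (.add (.var 10) (.lit 1)) (.var 11) (.lit 0) (.get a (.var 10) (.var 11) (.lit 0)))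

/-- Compute what the pair coalitions of the agents in the variables `pv` and `cv` can pay to the
first one, in the array `a`. -/
def retProg (a pv cv : ℕ) : Prog :=
  .seq (.loop 11 (.add (.weight (.var pv)) (.lit 1)) (.setR a (.lit 0) (.var 11) (.lit 0) .zero))
    (.loop 10 .coalitions (.loop 11 (.add (.weight (.var pv)) (.lit 1)) (retEntry a pv cv)))

/-- Row `k` is read and row `k + 1` is written, so the candidates can be expressed by the entries
before the loop. -/
theorem retCell_spec (O : Oracle) (s : Mem) {a pv i k b : ℕ} (hpv : pv < 10)
    (hi : s.nat pv 0 0 0 = i) (hk : s.nat 10 0 0 0 = k) (hb : s.nat 11 0 0 0 = b)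
    (hbw : b ≤ O.weight i) :
    MaxStep [12] a (k + 1) b 0 {r | ∃ t < b + 1, r ∈ {r | t ≤ O.contrib k i ∧
      r = s.real a k (b - t) 0 + O.arb k i (O.contrib k i - t)}} s ((retCell a pv).ex O s) := by
  refine MaxStep.loop _ ?_ (by decide) ?_
  · rw [NExp.eval_upto] <;> simp only [NExp.eval, NExp.var, hi, hb]
    exact hbw
  intro t ht u S h hu
  have h10 : u.nat 10 0 0 0 = k := by rw [h.nat_val (by decide), hk]
  have h11 : u.nat 11 0 0 0 = b := by rw [h.nat_val (by decide), hb]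
  have hp : u.nat pv 0 0 0 = i := by rw [h.nat_val (by simp; omega), hi]
  refine MaxStep.ite_upd _ ?_ ?_ ?_ rfl ?_
  · simp [BExp.Holds, NExp.eval, NExp.var, hu, hp, h10]
  · simp [NExp.eval, NExp.var, h10]
  · simp [NExp.eval, NExp.var, h11]
  · intro _
    simp only [RExp.eval, NExp.eval, NExp.var, h10, h11, hu, hp]
    rw [h.real_eq a _ _ _ (by omega)]

theorem retEntry_spec (O : Oracle) (s : Mem) {a pv cv i j k b : ℕ} (hpv : pv < 10)
    (hi : s.nat pv 0 0 0 = i) (hj : s.nat cv 0 0 0 = j) (hk : s.nat 10 0 0 0 = k)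
    (hb : s.nat 11 0 0 0 = b) (hbw : b ≤ O.weight i) (hcnt : s.nat 1 k 0 0 = O.contributors k)
    (hprev : ∀ b' ≤ b, IsGreatest (O.retSet i j k b') (s.real a k b' 0)) :
    IsGreatest (O.retSet i j (k + 1) b) (((retEntry a pv cv).ex O s).real a (k + 1) b 0) ∧
      ∀ k' b', ¬ (k' = k + 1 ∧ b' = b) →
        ((retEntry a pv cv).ex O s).real a k' b' 0 = s.real a k' b' 0 := by
  have hiff : (BExp.isPair (.var pv) (.var cv) (.var 10)).Holds O s ↔ O.IsPair i j k := by
    have := BExp.isPair_holds (O := O) (s := s) (i := .var pv) (j := .var cv) (k := .var 10)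
      (by simpa [NExp.eval, NExp.var, hk] using hcnt)
    simpa [NExp.eval, NExp.var, hk, hi, hj] using this
  by_cases hp : O.IsPair i j k
  · rw [retEntry, Prog.ex_ite_pos _ _ _ _ (hiff.2 hp), Prog.ex_seq]
    set t := (Prog.setR a (.add (.var 10) (.lit 1)) (.var 11) (.lit 0)
      (.add (.get a (.var 10) (.var 11) (.lit 0))
        (.arb (.var 10) (.var pv) (.contrib (.var 10) (.var pv))))).ex O s with ht
    have ht' : t = s.setReal a (k + 1) b 0 (s.real a k b 0 + O.arb k i (O.contrib k i)) := by
      simp [ht, NExp.eval, NExp.var, RExp.eval, hk, hb, hi]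
    have hmax := retCell_spec O t (a := a) hpv (by simpa [ht'] using hi) (by simpa [ht'] using hk)
      (by simpa [ht'] using hb) hbw
    have htk : ∀ b', t.real a k b' 0 = s.real a k b' 0 := by
      intro b'
      rw [ht', Mem.setReal_real, if_neg (by omega)]
    have ht0 : t.real a (k + 1) b 0 = s.real a k b 0 + O.arb k i (O.contrib k i) := by simp [ht']
    refine ⟨Oracle.isGreatest_retSet_succ hp hprev ?_, fun k' b' hne => ?_⟩
    · have h := hmax.isGreatest
      -- The entry was initialized with the candidate `t' = 0`, full withdrawal, so the initial
      -- value adds nothing to the candidates.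
      have h0 : s.real a k b 0 + O.arb k i (O.contrib k i) ∈ {r | ∃ t' < b + 1, r ∈ {r |
          t' ≤ O.contrib k i ∧
            r = t.real a k (b - t') 0 + O.arb k i (O.contrib k i - t')}} :=
        ⟨0, by omega, by omega, by rw [htk]; rfl⟩
      rw [ht0, Set.insert_eq_of_mem h0] at h
      refine Eq.subst (motive := fun S => IsGreatest S _) ?_ h
      ext r
      simp only [Set.mem_ofPred_eq, Nat.lt_succ_iff, htk]
    · rw [hmax.real_eq a _ _ _ (by tauto), ht', Mem.setReal_real, if_neg (by tauto)]
  · rw [retEntry, Prog.ex_ite_neg _ _ _ _ (fun h => hp (hiff.1 h))]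
    simp only [Prog.ex_setR, NExp.eval, NExp.var, RExp.eval, hk, hb]
    refine ⟨?_, fun k' b' hne => ?_⟩
    · rw [Mem.setReal_real_self]
      exact Oracle.isGreatest_retSet_succ_of_not hp (hprev b le_rfl)
    · rw [Mem.setReal_real, if_neg (by tauto)]

theorem retProg_spec (O : Oracle) (s : Mem) {a pv cv i j : ℕ} (hpv : pv < 10) (hcv : cv < 10)
    (hi : s.nat pv 0 0 0 = i) (hj : s.nat cv 0 0 0 = j)
    (hcnt : ∀ k < O.coalitions, s.nat 1 k 0 0 = O.contributors k) :
    ∀ b ≤ O.weight i, IsGreatest (O.retSet i j O.coalitions b)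
      (((retProg a pv cv).ex O s).real a O.coalitions b 0) := by
  -- The names `pv` and `cv` are parameters; that the loops do not write to them follows from `pv,
  -- cv < 10`.
  obtain ⟨hWp, hWc, hW1⟩ : pv ∉ (Prog.loop 10 .coalitions (Prog.loop 11
      (.add (.weight (.var pv)) (.lit 1)) (retEntry a pv cv))).writesN ∧
      cv ∉ (Prog.loop 10 .coalitions (Prog.loop 11
      (.add (.weight (.var pv)) (.lit 1)) (retEntry a pv cv))).writesN ∧
      1 ∉ (Prog.loop 10 .coalitions (Prog.loop 11
      (.add (.weight (.var pv)) (.lit 1)) (retEntry a pv cv))).writesN := by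
    simp only [retEntry, retCell, Prog.upd, Prog.writesN]
    simp
    omega
  rw [retProg, Prog.ex_seq]
  set t := (Prog.loop 11 (.add (.weight (.var pv)) (.lit 1))
    (.setR a (.lit 0) (.var 11) (.lit 0) .zero)).ex O s with ht
  have ht0 : ∀ b < O.weight i + 1, t.real a 0 b 0 = 0 := by
    refine Prog.ex_loop_frame (fun m u => ∀ b < m, u.real a 0 b 0 = 0)
      (by simp [NExp.eval, NExp.var, hi]) (fun b hb => absurd hb (Nat.not_lt_zero b)) ?_
    intro b _ u _ _ hu b' hb'
    simp only [Prog.ex_setR, Mem.setReal_real, NExp.eval, NExp.var, RExp.eval]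
    split_ifs with h
    · rfl
    · exact hu b' (by simp at h; omega)
  have htn : ∀ b, b ≠ 11 → t.nat b = s.nat b := by
    intro b hb
    exact Prog.ex_nat_eq _ _ _ (by simpa [Prog.writesN] using hb)
  have main : ∀ b < O.weight i + 1, IsGreatest (O.retSet i j O.coalitions b)
      (((Prog.loop 10 .coalitions (.loop 11 (.add (.weight (.var pv)) (.lit 1))
        (retEntry a pv cv))).ex O t).real a O.coalitions b 0) := by
    refine Prog.ex_loop_frame (fun k u => ∀ b < O.weight i + 1,
      IsGreatest (O.retSet i j k b) (u.real a k b 0)) rfl ?_ ?_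
    · intro b hb
      rw [ht0 b hb]
      exact O.isGreatest_retSet_zero i j b
    intro k hk u hun _ hu
    have hui : u.nat pv 0 0 0 = i := by rw [hun pv hWp, htn _ (by omega), hi]
    have huj : u.nat cv 0 0 0 = j := by rw [hun cv hWc, htn _ (by omega), hj]
    have hu1 : u.nat 1 k 0 0 = O.contributors k := by rw [hun 1 hW1, htn _ (by omega), hcnt k hk]
    -- Row `k` belongs to the invariant because the later entries of row `k + 1` still read it.
    have inner : (∀ b < O.weight i + 1, IsGreatest (O.retSet i j k b)
        (((Prog.loop 11 (.add (.weight (.var pv)) (.lit 1)) (retEntry a pv cv)).ex O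
          (u.setNat 10 0 0 0 k)).real a k b 0)) ∧
        ∀ b < O.weight i + 1, IsGreatest (O.retSet i j (k + 1) b)
        (((Prog.loop 11 (.add (.weight (.var pv)) (.lit 1)) (retEntry a pv cv)).ex O
          (u.setNat 10 0 0 0 k)).real a (k + 1) b 0) := by
      refine Prog.ex_loop_frame (fun m w => (∀ b < O.weight i + 1,
        IsGreatest (O.retSet i j k b) (w.real a k b 0)) ∧ ∀ b < m,
        IsGreatest (O.retSet i j (k + 1) b) (w.real a (k + 1) b 0))
        (by simp [NExp.eval, NExp.var, Mem.setNat_nat, hui, show pv ≠ 10 by omega])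
        ⟨hu, fun b hb => absurd hb (Nat.not_lt_zero b)⟩ ?_
      rintro b hb w hwn _ ⟨hw1, hw2⟩
      simp only [Prog.writesN, List.mem_cons, not_or] at hWp hWc hW1
      have hn : ∀ x, x ≠ 10 → x ≠ 11 → x ∉ (retEntry a pv cv).writesN → ∀ y,
          (w.setNat 11 0 0 0 b).nat x y 0 0 = u.nat x y 0 0 := by
        intro x h10 h11 hx y
        rw [Mem.setNat_nat_of_ne _ _ _ _ _ h11, hwn x (by
          simp only [Prog.writesN, List.mem_cons, not_or]
          exact ⟨h11, hx⟩), Mem.setNat_nat_of_ne _ _ _ _ _ h10]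
      have hw10 : (w.setNat 11 0 0 0 b).nat 10 0 0 0 = k := by
        rw [Mem.setNat_nat_of_ne _ _ _ _ _ (by decide), hwn 10 (by
          simp [retEntry, retCell, Prog.upd, Prog.writesN])]
        simp
      have hstep := retEntry_spec O (w.setNat 11 0 0 0 b) (a := a) (pv := pv) (cv := cv) hpv
        (by rw [hn pv (by omega) (by omega) hWp.2.2, hui])
        (by rw [hn cv (by omega) (by omega) hWc.2.2, huj]) hw10 (Mem.setNat_nat_self _ _ _ _ _ _) (by omega)
        (by rw [hn 1 (by omega) (by omega) hW1.2.2, hu1])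
        (fun b' hb' => hw1 b' (by omega))
      refine ⟨fun b' hb' => ?_, fun b' hb' => ?_⟩
      · rw [hstep.2 k b' (by omega)]
        exact hw1 b' hb'
      · rcases Nat.lt_succ_iff_lt_or_eq.1 hb' with h | rfl
        · rw [hstep.2 (k + 1) b' (by omega)]
          exact hw2 b' h
        · exact hstep.1
    exact inner.2
  exact fun b hb => main b (Nat.lt_succ_of_le hb)

/-- Compute what the pair coalitions of the agents in the variables `4` and `3` pay to the empty
set. -/
def outProg : Prog :=
  .seq (.setR 5 (.lit 0) (.lit 0) (.lit 0) .zero) (.loop 10 .coalitions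
    (.ite (.isPair (.var 4) (.var 3) (.var 10)) (.setR 5 (.lit 0) (.lit 0) (.lit 0)
      (.add (.get 5 (.lit 0) (.lit 0) (.lit 0)) (.arb (.var 10) .agents (.lit 0)))) .skip))

theorem outProg_spec (O : Oracle) (s : Mem) {p c : ℕ} (hp : s.nat 4 0 0 0 = p)
    (hc : s.nat 3 0 0 0 = c) (hcnt : ∀ k < O.coalitions, s.nat 1 k 0 0 = O.contributors k) :
    (outProg.ex O s).real 5 0 0 0 =
      ∑ k ∈ Finset.range O.coalitions, if O.IsPair p c k then O.arb k O.agents 0 else 0 := by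
  rw [outProg, Prog.ex_seq]
  refine Prog.ex_loop_frame (fun m u => u.real 5 0 0 0 =
    ∑ k ∈ Finset.range m, if O.IsPair p c k then O.arb k O.agents 0 else 0) rfl
    (by simp [NExp.eval, RExp.eval]) ?_
  intro k hk u hun _ hu
  have h4 : u.nat 4 0 0 0 = p := by rw [hun 4 (by decide)]; simpa using hp
  have h3 : u.nat 3 0 0 0 = c := by rw [hun 3 (by decide)]; simpa using hc
  have h1 : u.nat 1 k 0 0 = O.contributors k := by rw [hun 1 (by decide)]; simpa using hcnt k hk
  have hiff := BExp.isPair_holds (O := O) (s := u.setNat 10 0 0 0 k) (i := .var 4) (j := .var 3)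
    (k := .var 10) (by simpa [NExp.eval, NExp.var, Mem.setNat_nat] using h1)
  have hiff' : (BExp.isPair (.var 4) (.var 3) (.var 10)).Holds O (u.setNat 10 0 0 0 k) ↔
      O.IsPair p c k := by
    simpa [NExp.eval, NExp.var, Mem.setNat_nat, h3, h4] using hiff
  rw [Finset.sum_range_succ]
  by_cases h : O.IsPair p c k
  · rw [Prog.ex_ite_pos _ _ _ _ (hiff'.2 h), if_pos h, ← hu]
    simp [NExp.eval, NExp.var, RExp.eval]
  · rw [Prog.ex_ite_neg _ _ _ _ (fun h' => h (hiff'.1 h')), if_neg h, ← hu]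
    simp

/-! ### The table of edge terms -/

/-- One row entry of the table of edge terms. -/
def fillEntry : Prog :=
  .seq (.setR 2 (.lit 0) (.var 10) (.var 11) (.get 5 (.lit 0) (.lit 0) (.lit 0)))
  (.seq (.setR 2 (.lit 1) (.var 10) (.var 11) (.get 4 .coalitions (.var 11) (.lit 0)))
  (.seq (.setR 2 (.lit 2) (.var 10) (.var 11) (.get 3 .coalitions (.var 10) (.lit 0)))
  (.setR 2 (.lit 3) (.var 10) (.var 11) (.get 8 (.var 10) (.var 11) (.lit 0)))))

/-- Collect the edge terms in one table. -/
def fillProg : Prog :=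
  .loop 10 (.add (.weight (.var 4)) (.lit 1)) (.loop 11 (.add (.weight (.var 3)) (.lit 1)) fillEntry)

/-- The entries of the table of edge terms. -/
def fillValue (O : Oracle) (s : Mem) (x b e : ℕ) : ℝ :=
  -- The index `x` stands for `2 * σ + τ`, with `σ` the state of `p` and `τ` the state of `c`. In
  -- case `1` only `c` deviates and array `4` is used; in case `2` only `p` deviates and array `3`
  -- is used.
  if x = 0 then s.real 5 0 0 0 else if x = 1 then s.real 4 O.coalitions e 0
  else if x = 2 then s.real 3 O.coalitions b 0 else s.real 8 b e 0

theorem fillEntry_spec (O : Oracle) (s : Mem) {b e : ℕ} (hb : s.nat 10 0 0 0 = b)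
    (he : s.nat 11 0 0 0 = e) {x : ℕ} (hx : x < 4) (b' e' : ℕ) :
    (fillEntry.ex O s).real 2 x b' e' =
      if b' = b ∧ e' = e then fillValue O s x b e else s.real 2 x b' e' := by
  simp only [fillEntry, Prog.ex_seq, Prog.ex_setR, NExp.eval, NExp.var, RExp.eval,
    Mem.setReal_nat, hb, he, Mem.setReal_real, fillValue]
  by_cases h : b' = b ∧ e' = e
  · interval_cases x <;> simp [h]
  · simp [h]

theorem fillProg_spec (O : Oracle) (s : Mem) {p c : ℕ} (hp : s.nat 4 0 0 0 = p)
    (hc : s.nat 3 0 0 0 = c) : ∀ x < 4, ∀ b ≤ O.weight p, ∀ e ≤ O.weight c,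
      (fillProg.ex O s).real 2 x b e = fillValue O s x b e := by
  have main : ∀ b < O.weight p + 1, ∀ x < 4, ∀ e < O.weight c + 1,
      (fillProg.ex O s).real 2 x b e = fillValue O s x b e := by
    refine Prog.ex_loop_frame (fun m u => ∀ b < m, ∀ x < 4, ∀ e < O.weight c + 1,
      u.real 2 x b e = fillValue O s x b e) (by simp [NExp.eval, NExp.var, hp])
      (fun b hb => absurd hb (Nat.not_lt_zero b)) ?_
    intro b hb u hun hur hu
    have hu3 : u.nat 3 0 0 0 = c := by rw [hun 3 (by decide), hc]
    have inner : (∀ b' < b, ∀ x < 4, ∀ e < O.weight c + 1,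
        ((Prog.loop 11 (.add (.weight (.var 3)) (.lit 1)) fillEntry).ex O
          (u.setNat 10 0 0 0 b)).real 2 x b' e = fillValue O s x b' e) ∧
        ∀ e < O.weight c + 1, ∀ x < 4,
        ((Prog.loop 11 (.add (.weight (.var 3)) (.lit 1)) fillEntry).ex O
          (u.setNat 10 0 0 0 b)).real 2 x b e = fillValue O s x b e := by
      refine Prog.ex_loop_frame (fun m w => (∀ b' < b, ∀ x < 4, ∀ e < O.weight c + 1,
        w.real 2 x b' e = fillValue O s x b' e) ∧
        ∀ e < m, ∀ x < 4, w.real 2 x b e = fillValue O s x b e)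
        (by simp [NExp.eval, NExp.var, Mem.setNat_nat, hu3])
        ⟨hu, fun e he => absurd he (Nat.not_lt_zero e)⟩ ?_
      rintro e he w hwn hwr ⟨hw1, hw2⟩
      have hb10 : (w.setNat 11 0 0 0 e).nat 10 0 0 0 = b := by
        rw [Mem.setNat_nat_of_ne _ _ _ _ _ (by decide), hwn 10 (by decide)]
        simp
      have hval : ∀ x, fillValue O (w.setNat 11 0 0 0 e) x b e = fillValue O s x b e := by
        intro x
        simp only [fillValue, Mem.setNat_real]
        rw [hwr 5 (by decide), hwr 4 (by decide), hwr 3 (by decide), hwr 8 (by decide)]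
        simp only [Mem.setNat_real]
        rw [hur 5 (by decide), hur 4 (by decide), hur 3 (by decide), hur 8 (by decide)]
      refine ⟨fun b' hb' x hx e' he' => ?_, fun e' he' x hx => ?_⟩
      · rw [fillEntry_spec O _ hb10 (Mem.setNat_nat_self _ _ _ _ _ _) hx, if_neg (by omega), Mem.setNat_real,
          hw1 b' hb' x hx e' he']
      · rw [fillEntry_spec O _ hb10 (Mem.setNat_nat_self _ _ _ _ _ _) hx, hval]
        rcases Nat.lt_succ_iff_lt_or_eq.1 he' with h | rfl
        · rw [if_neg (by omega), Mem.setNat_real, hw2 e' h x hx]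
        · simp
    intro b' hb' x hx e he
    rcases Nat.lt_succ_iff_lt_or_eq.1 hb' with h | rfl
    · exact inner.1 b' h x hx e he
    · exact inner.2 e he x hx
  exact fun x hx b hb e he => main b (Nat.lt_succ_of_le hb) x hx e (Nat.lt_succ_of_le he)

/-! ### Absorbing a leaf into its neighbour -/

/-- One candidate for the new vertex term of the neighbour of the leaf. -/
def absorbCand : RExp :=
  .add (.add (.get 7 (.var 4) (.var 10) (.sub (.var 11) (.var 12)))
    -- The index `2 * σ + τ`, formed without multiplication.
    (.get 2 (.add (.add (.var 10) (.var 10)) (.var 13)) (.var 12) (.var 14)))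
    (.get 7 (.var 3) (.var 13) (.sub (.weight (.var 3)) (.var 14)))

/-- Maximize over all candidates. -/
def absorbLoop : Prog :=
  .loop 12 (.upto (.weight (.var 4)) (.var 11)) (.loop 13 (.lit 2)
    (.loop 14 (.add (.weight (.var 3)) (.lit 1))
      (.upd 6 (.var 10) (.var 11) (.lit 0) absorbCand)))

/-- The value of a candidate. -/
def candValue (O : Oracle) (s : Mem) (p c σ x b τ e : ℕ) : ℝ :=
  s.real 7 p σ (x - b) + s.real 2 (σ + σ + τ) b e + s.real 7 c τ (O.weight c - e)

theorem absorbCand_eval {O : Oracle} {s : Mem} {p c σ x b τ e : ℕ} (hp : s.nat 4 0 0 0 = p)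
    (hc : s.nat 3 0 0 0 = c) (hσ : s.nat 10 0 0 0 = σ) (hx : s.nat 11 0 0 0 = x)
    (hb : s.nat 12 0 0 0 = b) (hτ : s.nat 13 0 0 0 = τ) (he : s.nat 14 0 0 0 = e) :
    absorbCand.eval O s = candValue O s p c σ x b τ e := by
  simp only [absorbCand, RExp.eval, NExp.eval, NExp.var, hp, hc, hσ, hx, hb, hτ, he, candValue]

theorem absorbLoop_spec (O : Oracle) (s : Mem) {p c σ x : ℕ} (hp : s.nat 4 0 0 0 = p)
    (hc : s.nat 3 0 0 0 = c) (hσ : s.nat 10 0 0 0 = σ) (hx : s.nat 11 0 0 0 = x)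
    (hxw : x ≤ O.weight p) :
    MaxStep [12, 13, 14] 6 σ x 0 {r | ∃ b < x + 1, r ∈ {r | ∃ τ < 2, r ∈ {r |
      ∃ e < O.weight c + 1, r ∈ ({candValue O s p c σ x b τ e} : Set ℝ)}}} s
      (absorbLoop.ex O s) := by
  refine MaxStep.loop _ ?_ (by decide) ?_
  · rw [NExp.eval_upto] <;> simp only [NExp.eval, NExp.var, hp, hx]
    exact hxw
  intro b _ t₁ S₁ h₁ hb₁
  refine (MaxStep.loop (C := [13, 14]) _ rfl (by decide) ?_).mono (by decide) rfl
  intro τ _ t₂ S₂ h₂ hτ₂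
  refine (MaxStep.loop (C := [14]) _ ?_ (by decide) ?_).mono (by decide) rfl
  · have h12 := h₁.trans (h₂.mono (C' := [12, 13, 14]) (by decide) rfl)
    have h3 : t₂.nat 3 0 0 0 = c := by rw [h12.nat_val (by decide), hc]
    simp [NExp.eval, NExp.var, h3]
  intro e _ t S₃ h₃ he
  have h12 := (h₁.trans (h₂.mono (C' := [12, 13, 14]) (by decide) rfl)).trans
    (h₃.mono (C' := [12, 13, 14]) (by decide) rfl)
  have h4 : t.nat 4 0 0 0 = p := by rw [h12.nat_val (by decide), hp]
  have h3 : t.nat 3 0 0 0 = c := by rw [h12.nat_val (by decide), hc]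
  have h10 : t.nat 10 0 0 0 = σ := by rw [h12.nat_val (by decide), hσ]
  have h11 : t.nat 11 0 0 0 = x := by rw [h12.nat_val (by decide), hx]
  have hb : t.nat 12 0 0 0 = b := by rw [h₃.nat_val (by decide), h₂.nat_val (by decide), hb₁]
  have hτ : t.nat 13 0 0 0 = τ := by rw [h₃.nat_val (by decide), hτ₂]
  refine MaxStep.upd_of_eval _ ?_ ?_ rfl ?_
  · simp [NExp.eval, NExp.var, h10]
  · simp [NExp.eval, NExp.var, h11]
  · rw [absorbCand_eval h4 h3 h10 h11 hb hτ he]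
    simp only [candValue]
    rw [h12.real_eq 7 _ _ _ (by omega), h12.real_eq 2 _ _ _ (by omega),
      h12.real_eq 7 _ _ _ (by omega)]

/-- One entry of the new vertex term. -/
def absorbCell : Prog :=
  -- With cleared counters `absorbCand` is the candidate `b = τ = e = 0`, a legitimate initial value
  -- for the maximization.
  .seq (.setN 12 (.lit 0) (.lit 0) (.lit 0) (.lit 0))
  (.seq (.setN 13 (.lit 0) (.lit 0) (.lit 0) (.lit 0))
  (.seq (.setN 14 (.lit 0) (.lit 0) (.lit 0) (.lit 0))
  (.seq (.setR 6 (.var 10) (.var 11) (.lit 0) absorbCand) absorbLoop)))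

theorem absorbCell_spec (O : Oracle) (s : Mem) {p c σ x : ℕ} (hp : s.nat 4 0 0 0 = p)
    (hc : s.nat 3 0 0 0 = c) (hσ : s.nat 10 0 0 0 = σ) (hx : s.nat 11 0 0 0 = x)
    (hxw : x ≤ O.weight p) :
    IsGreatest {r | ∃ b ≤ x, ∃ τ < 2, ∃ e ≤ O.weight c, r = candValue O s p c σ x b τ e}
      ((absorbCell.ex O s).real 6 σ x 0) ∧
    ∀ σ' x', ¬ (σ' = σ ∧ x' = x) → (absorbCell.ex O s).real 6 σ' x' 0 = s.real 6 σ' x' 0 := by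
  simp only [absorbCell, Prog.ex_seq]
  set u := (Prog.setN 14 (.lit 0) (.lit 0) (.lit 0) (.lit 0)).ex O
    ((Prog.setN 13 (.lit 0) (.lit 0) (.lit 0) (.lit 0)).ex O
      ((Prog.setN 12 (.lit 0) (.lit 0) (.lit 0) (.lit 0)).ex O s)) with hu
  have hn : ∀ a, a < 12 → u.nat a = s.nat a := by
    intro a ha
    simp only [hu, Prog.ex_setN, NExp.eval]
    rw [Mem.setNat_nat_of_ne _ _ _ _ _ (by omega), Mem.setNat_nat_of_ne _ _ _ _ _ (by omega),
      Mem.setNat_nat_of_ne _ _ _ _ _ (by omega)]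
  have hr : u.real = s.real := rfl
  have hcand : absorbCand.eval O u = candValue O s p c σ x 0 0 0 := by
    rw [absorbCand_eval (p := p) (c := c) (σ := σ) (x := x) (b := 0) (τ := 0) (e := 0)]
    · simp only [candValue, hr]
    all_goals first
      | (rw [hn _ (by norm_num)]; assumption)
      | simp [hu, NExp.eval, Mem.setNat_nat]
  set t := (Prog.setR 6 (.var 10) (.var 11) (.lit 0) absorbCand).ex O u with ht
  have ht' : t = u.setReal 6 σ x 0 (candValue O s p c σ x 0 0 0) := by
    simp [ht, NExp.eval, NExp.var, hcand, hn 10 (by norm_num), hn 11 (by norm_num), hσ, hx]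
  have htn : ∀ a, a < 12 → t.nat a = s.nat a := by
    intro a ha
    rw [ht', Mem.setReal_nat, hn a ha]
  have htc : ∀ b τ e, candValue O t p c σ x b τ e = candValue O s p c σ x b τ e := by
    intro b τ e
    simp only [candValue, ht']
    rw [Mem.setReal_real_of_ne _ _ _ _ _ (by decide), Mem.setReal_real_of_ne _ _ _ _ _ (by decide),
      hr]
  have hmax := absorbLoop_spec O t (p := p) (c := c) (σ := σ) (x := x)
    (by rw [htn _ (by norm_num), hp]) (by rw [htn _ (by norm_num), hc])
    (by rw [htn _ (by norm_num), hσ]) (by rw [htn _ (by norm_num), hx]) hxw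
  simp only [htc] at hmax
  refine ⟨?_, fun σ' x' hne => ?_⟩
  · have h := hmax.isGreatest
    have h0 : t.real 6 σ x 0 ∈ {r | ∃ b < x + 1, r ∈ {r | ∃ τ < 2, r ∈ {r |
      ∃ e < O.weight c + 1, r ∈ ({candValue O s p c σ x b τ e} : Set ℝ)}}} :=
      ⟨0, by omega, 0, by omega, 0, by omega, by simp [ht']⟩
    rw [Set.insert_eq_of_mem h0] at h
    refine Eq.subst (motive := fun S => IsGreatest S _) ?_ h
    ext r
    simp only [Set.mem_ofPred_eq, Nat.lt_succ_iff, Set.mem_singleton_iff]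
  · rw [hmax.real_eq 6 _ _ _ (by tauto), ht', Mem.setReal_real, if_neg (by tauto), hr]

/-- Compute the new vertex term of the neighbour of the leaf. -/
def absorbTable : Prog :=
  .loop 10 (.lit 2) (.loop 11 (.add (.weight (.var 4)) (.lit 1)) absorbCell)

/-- The results go to array `6`, since the old entries for smaller budgets in array `7` are still
read for the larger budgets. -/
theorem absorbTable_spec (O : Oracle) (s : Mem) {p c : ℕ} (hp : s.nat 4 0 0 0 = p)
    (hc : s.nat 3 0 0 0 = c) : ∀ σ < 2, ∀ x < O.weight p + 1,
    IsGreatest {r | ∃ b ≤ x, ∃ τ < 2, ∃ e ≤ O.weight c, r = candValue O s p c σ x b τ e}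
      ((absorbTable.ex O s).real 6 σ x 0) := by
  refine Prog.ex_loop_frame (fun m u => ∀ σ < m, ∀ x < O.weight p + 1,
    IsGreatest {r | ∃ b ≤ x, ∃ τ < 2, ∃ e ≤ O.weight c, r = candValue O s p c σ x b τ e}
      (u.real 6 σ x 0)) rfl (fun σ hσ => absurd hσ (Nat.not_lt_zero σ)) ?_
  intro σ hσ u hun hur hu
  have h4 : u.nat 4 0 0 0 = p := by rw [hun 4 (by decide), hp]
  have h3 : u.nat 3 0 0 0 = c := by rw [hun 3 (by decide), hc]
  set z := (Prog.loop 11 (.add (.weight (.var 4)) (.lit 1)) absorbCell).ex O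
    (u.setNat 10 0 0 0 σ) with hz
  have inner : (∀ σ' ≠ σ, ∀ x, z.real 6 σ' x 0 = u.real 6 σ' x 0) ∧ ∀ x < O.weight p + 1,
    IsGreatest {r | ∃ b ≤ x, ∃ τ < 2, ∃ e ≤ O.weight c, r = candValue O s p c σ x b τ e}
      (z.real 6 σ x 0) := by
    refine Prog.ex_loop_frame (fun m w => (∀ σ' ≠ σ, ∀ x, w.real 6 σ' x 0 = u.real 6 σ' x 0) ∧
      ∀ x < m, IsGreatest {r | ∃ b ≤ x, ∃ τ < 2, ∃ e ≤ O.weight c,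
        r = candValue O s p c σ x b τ e} (w.real 6 σ x 0))
      (by simp [NExp.eval, NExp.var, Mem.setNat_nat, h4])
      ⟨fun _ _ _ => rfl, fun x hx => absurd hx (Nat.not_lt_zero x)⟩ ?_
    rintro x hx w hwn hwr ⟨hw1, hw2⟩
    have hw : ∀ a, a < 10 → (w.setNat 11 0 0 0 x).nat a 0 0 0 = u.nat a 0 0 0 := by
      intro a ha
      rw [Mem.setNat_nat_of_ne _ _ _ _ _ (by omega), hwn a (by
        simp [absorbCell, absorbLoop, Prog.writesN, Prog.upd]; omega),
        Mem.setNat_nat_of_ne _ _ _ _ _ (by omega)]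
    have hw10 : (w.setNat 11 0 0 0 x).nat 10 0 0 0 = σ := by
      rw [Mem.setNat_nat_of_ne _ _ _ _ _ (by omega), hwn 10 (by decide)]
      simp
    have hcell := absorbCell_spec O (w.setNat 11 0 0 0 x) (p := p) (c := c) (σ := σ) (x := x)
      (by rw [hw 4 (by norm_num), h4]) (by rw [hw 3 (by norm_num), h3]) hw10
      (Mem.setNat_nat_self _ _ _ _ _ _) (by omega)
    have hcv : ∀ b τ e, candValue O (w.setNat 11 0 0 0 x) p c σ x b τ e =
        candValue O s p c σ x b τ e := by
      intro b τ e
      simp only [candValue, Mem.setNat_real]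
      rw [hwr 7 (by decide), hwr 2 (by decide)]
      simp only [Mem.setNat_real]
      rw [hur 7 (by decide), hur 2 (by decide)]
    simp only [hcv] at hcell
    refine ⟨fun σ' hσ' x' => ?_, fun x' hx' => ?_⟩
    · rw [hcell.2 σ' x' (by tauto)]
      exact hw1 σ' hσ' x'
    · rcases Nat.lt_succ_iff_lt_or_eq.1 hx' with h | rfl
      · rw [hcell.2 σ x' (by omega)]
        exact hw2 x' h
      · exact hcell.1
  intro σ' hσ' x hx
  rcases Nat.lt_succ_iff_lt_or_eq.1 hσ' with h | rfl
  · rw [inner.1 σ' h.ne x]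
    exact hu σ' h x hx
  · exact inner.2 x hx

/-- Replace the vertex term of the neighbour of the leaf. -/
def copyTable : Prog :=
  .loop 10 (.lit 2) (.loop 11 (.add (.weight (.var 4)) (.lit 1))
    (.setR 7 (.var 4) (.var 10) (.var 11) (.get 6 (.var 10) (.var 11) (.lit 0))))

theorem copyTable_spec (O : Oracle) (s : Mem) {p : ℕ} (hp : s.nat 4 0 0 0 = p) :
    (∀ q ≠ p, (copyTable.ex O s).real 7 q = s.real 7 q) ∧
    ∀ σ < 2, ∀ x < O.weight p + 1, (copyTable.ex O s).real 7 p σ x = s.real 6 σ x 0 := by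
  refine Prog.ex_loop_frame (fun m u => (∀ q ≠ p, u.real 7 q = s.real 7 q) ∧
    ∀ σ < m, ∀ x < O.weight p + 1, u.real 7 p σ x = s.real 6 σ x 0) rfl
    ⟨fun _ _ => rfl, fun σ hσ => absurd hσ (Nat.not_lt_zero σ)⟩ ?_
  rintro σ hσ u hun hur ⟨hu1, hu2⟩
  have h4 : u.nat 4 0 0 0 = p := by rw [hun 4 (by decide), hp]
  set z := (Prog.loop 11 (.add (.weight (.var 4)) (.lit 1))
    (.setR 7 (.var 4) (.var 10) (.var 11) (.get 6 (.var 10) (.var 11) (.lit 0)))).ex O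
    (u.setNat 10 0 0 0 σ) with hz
  have inner : (∀ q ≠ p, z.real 7 q = s.real 7 q) ∧
      (∀ σ' < σ, ∀ x < O.weight p + 1, z.real 7 p σ' x = s.real 6 σ' x 0) ∧
      ∀ x < O.weight p + 1, z.real 7 p σ x = s.real 6 σ x 0 := by
    refine Prog.ex_loop_frame (fun m w => (∀ q ≠ p, w.real 7 q = s.real 7 q) ∧
      (∀ σ' < σ, ∀ x < O.weight p + 1, w.real 7 p σ' x = s.real 6 σ' x 0) ∧
      ∀ x < m, w.real 7 p σ x = s.real 6 σ x 0)
      (by simp [NExp.eval, NExp.var, Mem.setNat_nat, h4])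
      ⟨hu1, hu2, fun x hx => absurd hx (Nat.not_lt_zero x)⟩ ?_
    rintro x hx w hwn hwr ⟨hw1, hw2, hw3⟩
    have hw4 : w.nat 4 0 0 0 = p := by
      rw [hwn 4 (by decide), Mem.setNat_nat_of_ne _ _ _ _ _ (by decide), h4]
    have hw10 : w.nat 10 0 0 0 = σ := by rw [hwn 10 (by decide)]; simp
    have hw6 : w.real 6 = s.real 6 := by rw [hwr 6 (by decide), Mem.setNat_real, hur 6 (by decide)]
    have hex : (Prog.setR 7 (.var 4) (.var 10) (.var 11)
        (.get 6 (.var 10) (.var 11) (.lit 0))).ex O (w.setNat 11 0 0 0 x) =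
        (w.setNat 11 0 0 0 x).setReal 7 p σ x (s.real 6 σ x 0) := by
      simp [NExp.eval, NExp.var, RExp.eval, Mem.setNat_nat, hw4, hw10, hw6]
    rw [hex]
    refine ⟨fun q hq => ?_, fun σ' hσ' x' hx' => ?_, fun x' hx' => ?_⟩
    · funext σ' x'
      rw [Mem.setReal_real, if_neg (by tauto), Mem.setNat_real, hw1 q hq]
    · rw [Mem.setReal_real, if_neg (by omega), Mem.setNat_real, hw2 σ' hσ' x' hx']
    · rcases Nat.lt_succ_iff_lt_or_eq.1 hx' with h | rfl
      · rw [Mem.setReal_real, if_neg (by omega), Mem.setNat_real, hw3 x' h]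
      · rw [Mem.setReal_real_self]
  refine ⟨inner.1, fun σ' hσ' x hx => ?_⟩
  rcases Nat.lt_succ_iff_lt_or_eq.1 hσ' with h | rfl
  · exact inner.2.1 σ' h x hx
  · exact inner.2.2 x hx

/-! ### Finding a leaf -/

/-- `c` and `p` are a leaf of the remaining tree and its neighbour. -/
structure LeafPair (O : Oracle) (alive : ℕ → Prop) (c p : ℕ) : Prop where
  lt : c < O.agents
  mem : alive c
  nbr_lt : p < O.agents
  nbr_mem : alive p
  adj : 1 ≤ O.edge c p
  unique : ∀ j < O.agents, alive j → 1 ≤ O.edge c j → j = p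

/-- Count the remaining neighbours of the agent in the variable `10` and remember one of them. -/
def nbrProg : Prog :=
  .loop 11 .agents (.ite (.and (.nle (.get 2 (.var 11) (.lit 0) (.lit 0)) (.lit 0))
      (.nle (.lit 1) (.edge (.var 10) (.var 11))))
    (.seq (.setN 5 (.lit 0) (.lit 0) (.lit 0) (.add (.var 5) (.lit 1)))
      (.setN 6 (.lit 0) (.lit 0) (.lit 0) (.var 11))) .skip)

/-- Variable `6` holds the neighbour seen last, which is the only one if the count in variable `5`
is `1`. -/
theorem nbrProg_spec (O : Oracle) (s : Mem) {i : ℕ} (hi : s.nat 10 0 0 0 = i)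
    (h5 : s.nat 5 0 0 0 = 0) :
    (nbrProg.ex O s).nat 5 0 0 0 = ((Finset.range O.agents).filter
      (fun j => s.nat 2 j 0 0 = 0 ∧ 1 ≤ O.edge i j)).card ∧
    (1 ≤ (nbrProg.ex O s).nat 5 0 0 0 → (nbrProg.ex O s).nat 6 0 0 0 ∈
      (Finset.range O.agents).filter (fun j => s.nat 2 j 0 0 = 0 ∧ 1 ≤ O.edge i j)) := by
  refine Prog.ex_loop_frame (fun m u => u.nat 5 0 0 0 = ((Finset.range m).filter
      (fun j => s.nat 2 j 0 0 = 0 ∧ 1 ≤ O.edge i j)).card ∧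
    (1 ≤ u.nat 5 0 0 0 → u.nat 6 0 0 0 ∈
      (Finset.range m).filter (fun j => s.nat 2 j 0 0 = 0 ∧ 1 ≤ O.edge i j))) rfl
    ⟨by simpa using h5, by simp [h5]⟩ ?_
  rintro j _ u hun _ ⟨hu1, hu2⟩
  have h10 : u.nat 10 0 0 0 = i := by rw [hun 10 (by decide), hi]
  have h2 : u.nat 2 j 0 0 = s.nat 2 j 0 0 := by rw [hun 2 (by decide)]
  rw [Finset.range_add_one, Finset.filter_insert]
  have hiff : (BExp.and (.nle (.get 2 (.var 11) (.lit 0) (.lit 0)) (.lit 0))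
      (.nle (.lit 1) (.edge (.var 10) (.var 11)))).Holds O (u.setNat 11 0 0 0 j) ↔
      (s.nat 2 j 0 0 = 0 ∧ 1 ≤ O.edge i j) := by
    simp [BExp.Holds, NExp.eval, NExp.var, Mem.setNat_nat, h10, h2]
  by_cases h : s.nat 2 j 0 0 = 0 ∧ 1 ≤ O.edge i j
  · rw [Prog.ex_ite_pos _ _ _ _ (hiff.2 h), if_pos h, Finset.card_insert_of_notMem (by simp)]
    simp [NExp.eval, NExp.var, Mem.setNat_nat, hu1]
  · rw [Prog.ex_ite_neg _ _ _ _ (fun h' => h (hiff.1 h')), if_neg h]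
    simpa [Mem.setNat_nat] using ⟨hu1, by simpa using hu2⟩

/-- Find a leaf of the remaining tree. -/
def leafProg : Prog :=
  .loop 10 .agents (.seq (.setN 5 (.lit 0) (.lit 0) (.lit 0) (.lit 0)) (.seq nbrProg
    (.ite (.and (.nle (.get 2 (.var 10) (.lit 0) (.lit 0)) (.lit 0))
        (.and (.nle (.var 5) (.lit 1)) (.nle (.lit 1) (.var 5))))
      (.seq (.setN 3 (.lit 0) (.lit 0) (.lit 0) (.var 10))
        (.setN 4 (.lit 0) (.lit 0) (.lit 0) (.var 6))) .skip)))

theorem leafProg_spec (O : Oracle) (s : Mem)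
    (h : ∃ c p, LeafPair O (fun i => s.nat 2 i 0 0 = 0) c p) :
    LeafPair O (fun i => s.nat 2 i 0 0 = 0) ((leafProg.ex O s).nat 3 0 0 0)
      ((leafProg.ex O s).nat 4 0 0 0) := by
  have main : (∃ c < O.agents, ∃ p, LeafPair O (fun i => s.nat 2 i 0 0 = 0) c p) →
      LeafPair O (fun i => s.nat 2 i 0 0 = 0) ((leafProg.ex O s).nat 3 0 0 0)
      ((leafProg.ex O s).nat 4 0 0 0) := by
    -- The invariant is an implication because there need not be a leaf among the first `m` agents.
    -- A later leaf overwrites an earlier one, which does no harm.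
    refine Prog.ex_loop_frame (fun m u =>
      (∃ c < m, ∃ p, LeafPair O (fun i => s.nat 2 i 0 0 = 0) c p) →
      LeafPair O (fun i => s.nat 2 i 0 0 = 0) (u.nat 3 0 0 0) (u.nat 4 0 0 0)) rfl
      (fun ⟨c, hc, _⟩ => absurd hc (Nat.not_lt_zero c)) ?_
    intro i hi u hun _ hu
    rw [Prog.ex_seq, Prog.ex_seq]
    set t := (Prog.setN 5 (.lit 0) (.lit 0) (.lit 0) (.lit 0)).ex O (u.setNat 10 0 0 0 i) with ht
    have ht10 : t.nat 10 0 0 0 = i := by simp [ht, Mem.setNat_nat]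
    have ht5 : t.nat 5 0 0 0 = 0 := by simp [ht, NExp.eval]
    have ht2 : t.nat 2 = s.nat 2 := by
      rw [ht, Prog.ex_nat_eq _ _ _ (by decide), Mem.setNat_nat_of_ne _ _ _ _ _ (by decide),
        hun 2 (by decide)]
    obtain ⟨hdeg, hnbr⟩ := nbrProg_spec O t ht10 ht5
    rw [ht2] at hdeg hnbr
    set w := nbrProg.ex O t with hw
    have hw2 : w.nat 2 = s.nat 2 := by rw [hw, Prog.ex_nat_eq _ _ _ (by decide), ht2]
    have hw10 : w.nat 10 0 0 0 = i := by rw [hw, Prog.ex_nat_eq _ _ _ (by decide), ht10]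
    have hw3 : w.nat 3 = u.nat 3 := by
      rw [hw, Prog.ex_nat_eq _ _ _ (by decide), ht, Prog.ex_nat_eq _ _ _ (by decide),
        Mem.setNat_nat_of_ne _ _ _ _ _ (by decide)]
    have hw4 : w.nat 4 = u.nat 4 := by
      rw [hw, Prog.ex_nat_eq _ _ _ (by decide), ht, Prog.ex_nat_eq _ _ _ (by decide),
        Mem.setNat_nat_of_ne _ _ _ _ _ (by decide)]
    have hiff : (BExp.and (.nle (.get 2 (.var 10) (.lit 0) (.lit 0)) (.lit 0))
        (.and (.nle (.var 5) (.lit 1)) (.nle (.lit 1) (.var 5)))).Holds O w ↔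
        s.nat 2 i 0 0 = 0 ∧ w.nat 5 0 0 0 = 1 := by
      simp only [BExp.Holds, NExp.eval, NExp.var, hw10, hw2]
      omega
    by_cases hl : s.nat 2 i 0 0 = 0 ∧ w.nat 5 0 0 0 = 1
    · rw [Prog.ex_ite_pos _ _ _ _ (hiff.2 hl)]
      intro _
      have hmem := hnbr hl.2.ge
      rw [hl.2] at hdeg
      obtain ⟨q, hq⟩ := Finset.card_eq_one.1 hdeg.symm
      have hq6 : w.nat 6 0 0 0 = q := by
        rw [hq] at hmem
        simpa using hmem
      rw [hq6] at hmem
      simp only [Finset.mem_filter, Finset.mem_range] at hmem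
      simp only [Prog.ex_seq, Prog.ex_setN, NExp.eval, NExp.var, Mem.setNat_nat, hw10]
      simp only [hq6, Nat.reduceEqDiff, false_and, if_false, and_self, if_true]
      refine ⟨hi, hl.1, hmem.1, hmem.2.1, hmem.2.2, fun j hj hja hje => ?_⟩
      have hj' : j ∈ (Finset.range O.agents).filter
          (fun j => s.nat 2 j 0 0 = 0 ∧ 1 ≤ O.edge i j) := by simp [hj, hja, hje]
      rw [hq] at hj'
      simpa using hj'
    · rw [Prog.ex_ite_neg _ _ _ _ (fun h' => hl (hiff.1 h')), Prog.ex_skip, hw3, hw4]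
      rintro ⟨c, hc, p, hcp⟩
      refine hu ⟨c, ?_, p, hcp⟩
      rcases Nat.lt_succ_iff_lt_or_eq.1 hc with h | rfl
      · exact h
      -- If the current agent were a leaf, it would have exactly one remaining neighbour and the
      -- test would have succeeded.
      · refine absurd ⟨hcp.mem, ?_⟩ hl
        rw [hdeg, Finset.card_eq_one]
        refine ⟨p, ?_⟩
        ext j
        simp only [Finset.mem_filter, Finset.mem_range, Finset.mem_singleton]
        constructor
        · rintro ⟨hj, hja, hje⟩
          exact hcp.unique j hj hja hje
        · rintro rfl
          exact ⟨hcp.nbr_lt, hcp.nbr_mem, hcp.adj⟩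
  obtain ⟨c, p, hcp⟩ := h
  exact main ⟨c, hcp.lt, p, hcp⟩

/-! ### Vertex terms -/

/-- Sum up the payoffs of the agent in the variable `15` and what the coalitions that consist of
this agent alone pay to the empty set. -/
def sumProg : Prog :=
  .seq (.setR 0 (.lit 0) (.lit 0) (.lit 0) .zero) (.seq (.setR 1 (.lit 0) (.lit 0) (.lit 0) .zero)
  (.loop 10 .coalitions (.seq
    (.setR 1 (.lit 0) (.lit 0) (.lit 0)
      (.add (.get 1 (.lit 0) (.lit 0) (.lit 0)) (.pay (.var 10) (.var 15))))
    (.ite (.isSingle (.var 15) (.var 10)) (.setR 0 (.lit 0) (.lit 0) (.lit 0)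
      (.add (.get 0 (.lit 0) (.lit 0) (.lit 0)) (.arb (.var 10) .agents (.lit 0)))) .skip))))

theorem sumProg_spec (O : Oracle) (s : Mem) {i : ℕ} (hi : s.nat 15 0 0 0 = i)
    (hcnt : ∀ k < O.coalitions, s.nat 1 k 0 0 = O.contributors k) :
    (sumProg.ex O s).real 1 0 0 0 = ∑ k ∈ Finset.range O.coalitions, O.pay k i ∧
    (sumProg.ex O s).real 0 0 0 0 =
      ∑ k ∈ Finset.range O.coalitions, if O.IsSingle i k then O.arb k O.agents 0 else 0 := by
  rw [sumProg, Prog.ex_seq, Prog.ex_seq]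
  refine Prog.ex_loop_frame (fun m u =>
    u.real 1 0 0 0 = ∑ k ∈ Finset.range m, O.pay k i ∧ u.real 0 0 0 0 =
      ∑ k ∈ Finset.range m, if O.IsSingle i k then O.arb k O.agents 0 else 0) rfl
    (by simp [NExp.eval, RExp.eval, Mem.setReal_real]) ?_
  rintro k hk u hun _ ⟨hu1, hu0⟩
  have h15 : u.nat 15 0 0 0 = i := by rw [hun 15 (by decide)]; simpa using hi
  have h1 : u.nat 1 k 0 0 = O.contributors k := by rw [hun 1 (by decide)]; simpa using hcnt k hk
  rw [Prog.ex_seq]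
  set w := (Prog.setR 1 (.lit 0) (.lit 0) (.lit 0)
    (.add (.get 1 (.lit 0) (.lit 0) (.lit 0)) (.pay (.var 10) (.var 15)))).ex O
    (u.setNat 10 0 0 0 k) with hw
  have hw' : w = (u.setNat 10 0 0 0 k).setReal 1 0 0 0 (u.real 1 0 0 0 + O.pay k i) := by
    simp [hw, NExp.eval, NExp.var, RExp.eval, Mem.setNat_nat, h15]
  have hiff := BExp.isSingle_holds (O := O) (s := w) (i := .var 15) (k := .var 10)
    (by simpa [hw', NExp.eval, NExp.var, Mem.setNat_nat] using h1)
  have hiff' : (BExp.isSingle (.var 15) (.var 10)).Holds O w ↔ O.IsSingle i k := by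
    simpa [hw', NExp.eval, NExp.var, Mem.setNat_nat, h15] using hiff
  rw [Finset.sum_range_succ, Finset.sum_range_succ, ← hu1, ← hu0]
  by_cases h : O.IsSingle i k
  · rw [Prog.ex_ite_pos _ _ _ _ (hiff'.2 h), if_pos h]
    simp [hw', NExp.eval, NExp.var, RExp.eval, Mem.setReal_real]
  · rw [Prog.ex_ite_neg _ _ _ _ (fun h' => h (hiff'.1 h')), if_neg h]
    simp [hw', Mem.setReal_real]

/-- Store the vertex terms of the agent in the variable `15`. -/
def storeProg : Prog :=
  .loop 10 (.add (.weight (.var 15)) (.lit 1)) (.seq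
    (.setR 7 (.var 15) (.lit 0) (.var 10) (.get 0 (.lit 0) (.lit 0) (.lit 0)))
    (.setR 7 (.var 15) (.lit 1) (.var 10)
      (.sub (.get 8 (.var 10) (.lit 0) (.lit 0)) (.get 1 (.lit 0) (.lit 0) (.lit 0)))))

theorem storeProg_spec (O : Oracle) (s : Mem) {i : ℕ} (hi : s.nat 15 0 0 0 = i) :
    (∀ j ≠ i, (storeProg.ex O s).real 7 j = s.real 7 j) ∧ ∀ x < O.weight i + 1,
      (storeProg.ex O s).real 7 i 0 x = s.real 0 0 0 0 ∧
      (storeProg.ex O s).real 7 i 1 x = s.real 8 x 0 0 - s.real 1 0 0 0 := by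
  refine Prog.ex_loop_frame (fun m u => (∀ j ≠ i, u.real 7 j = s.real 7 j) ∧ ∀ x < m,
      u.real 7 i 0 x = s.real 0 0 0 0 ∧ u.real 7 i 1 x = s.real 8 x 0 0 - s.real 1 0 0 0)
    (by simp [NExp.eval, NExp.var, hi])
    ⟨fun _ _ => rfl, fun x hx => absurd hx (Nat.not_lt_zero x)⟩ ?_
  rintro x _ u hun hur ⟨hu1, hu2⟩
  have h15 : u.nat 15 0 0 0 = i := by rw [hun 15 (by decide), hi]
  have hex : (Prog.seq
    (.setR 7 (.var 15) (.lit 0) (.var 10) (.get 0 (.lit 0) (.lit 0) (.lit 0)))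
    (.setR 7 (.var 15) (.lit 1) (.var 10)
      (.sub (.get 8 (.var 10) (.lit 0) (.lit 0)) (.get 1 (.lit 0) (.lit 0) (.lit 0))))).ex O
      (u.setNat 10 0 0 0 x) = ((u.setNat 10 0 0 0 x).setReal 7 i 0 x (s.real 0 0 0 0)).setReal
      7 i 1 x (s.real 8 x 0 0 - s.real 1 0 0 0) := by
    simp [NExp.eval, NExp.var, RExp.eval, Mem.setNat_nat, Mem.setReal_real, h15,
      hur 0 (by decide), hur 8 (by decide), hur 1 (by decide)]
  rw [hex]
  refine ⟨fun j hj => ?_, fun x' hx' => ?_⟩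
  · funext σ y
    simp [Mem.setReal_real, hj, hu1 j hj]
  · rcases Nat.lt_succ_iff_lt_or_eq.1 hx' with h | rfl
    · simpa [Mem.setReal_real, h.ne] using hu2 x' h
    · simp [Mem.setReal_real]

/-! ### The final test and the assembled algorithm -/

/-- Accept if the vertex terms of all remaining agents are not positive. -/
def finalProg : Prog :=
  .seq (.setN 0 (.lit 0) (.lit 0) (.lit 0) (.lit 1)) (.loop 10 .agents
    (.ite (.and (.nle (.get 2 (.var 10) (.lit 0) (.lit 0)) (.lit 0))
      (.neg (.and (.rle (.get 7 (.var 10) (.lit 0) (.weight (.var 10))) .zero)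
        (.rle (.get 7 (.var 10) (.lit 1) (.weight (.var 10))) .zero))))
    (.setN 0 (.lit 0) (.lit 0) (.lit 0) (.lit 0)) .skip))

theorem finalProg_spec (O : Oracle) (s : Mem) :
    (finalProg.ex O s).nat 0 0 0 0 = 1 ↔ ∀ i < O.agents, s.nat 2 i 0 0 = 0 →
      s.real 7 i 0 (O.weight i) ≤ 0 ∧ s.real 7 i 1 (O.weight i) ≤ 0 := by
  rw [finalProg, Prog.ex_seq]
  refine Prog.ex_loop_frame (fun m u => u.nat 0 0 0 0 = 1 ↔ ∀ i < m, s.nat 2 i 0 0 = 0 →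
      s.real 7 i 0 (O.weight i) ≤ 0 ∧ s.real 7 i 1 (O.weight i) ≤ 0) rfl
    (by simp [NExp.eval]) ?_
  intro i _ u hun hur hu
  have h2 : u.nat 2 i 0 0 = s.nat 2 i 0 0 := by rw [hun 2 (by decide)]; rfl
  have h7 : u.real 7 = s.real 7 := by rw [hur 7 (by decide)]; rfl
  have hiff : (BExp.and (.nle (.get 2 (.var 10) (.lit 0) (.lit 0)) (.lit 0))
      (.neg (.and (.rle (.get 7 (.var 10) (.lit 0) (.weight (.var 10))) .zero)
        (.rle (.get 7 (.var 10) (.lit 1) (.weight (.var 10))) .zero)))).Holds O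
        (u.setNat 10 0 0 0 i) ↔ s.nat 2 i 0 0 = 0 ∧
      ¬ (s.real 7 i 0 (O.weight i) ≤ 0 ∧ s.real 7 i 1 (O.weight i) ≤ 0) := by
    simp only [BExp.Holds, NExp.eval, NExp.var, RExp.eval, Mem.setNat_real, Mem.setNat_nat_self,
      h7, Nat.le_zero]
    rw [Mem.setNat_nat_of_ne _ _ _ _ _ (by decide), h2]
  by_cases h : s.nat 2 i 0 0 = 0 ∧
      ¬ (s.real 7 i 0 (O.weight i) ≤ 0 ∧ s.real 7 i 1 (O.weight i) ≤ 0)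
  · rw [Prog.ex_ite_pos _ _ _ _ (hiff.2 h)]
    simp only [Prog.ex_setN, NExp.eval, Mem.setNat_nat_self, zero_ne_one, false_iff]
    exact fun hall => h.2 (hall i (Nat.lt_succ_self i) h.1)
  · rw [Prog.ex_ite_neg _ _ _ _ (fun h' => h (hiff.1 h')), Prog.ex_skip,
      Mem.setNat_nat_of_ne _ _ _ _ _ (by decide), hu]
    constructor
    · intro hall j hj hj2
      rcases Nat.lt_succ_iff_lt_or_eq.1 hj with h' | rfl
      · exact hall j h' hj2
      · by_contra hn
        exact h ⟨hj2, hn⟩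
    · exact fun hall j hj => hall j (Nat.lt_succ_of_lt hj)

/-- Compute the vertex terms. -/
def initProg : Prog :=
  .loop 15 .agents (.seq (.setN 4 (.lit 0) (.lit 0) (.lit 0) (.var 15))
    -- No agent has the number `agents`, and the oracle answers its weight with `0`; so `coverProg`
    -- computes the covers of a single agent, in the column `e = 0`.
    (.seq (.setN 3 (.lit 0) (.lit 0) (.lit 0) .agents)
      (.seq coverProg (.seq sumProg storeProg))))

/-- Compute the edge terms of the edge between the agents in the variables `4` and `3`. -/
def edgeProg : Prog :=
  .seq coverProg (.seq (retProg 3 4 3) (.seq (retProg 4 3 4) (.seq outProg fillProg)))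

/-- Eliminate one leaf. -/
def roundProg : Prog :=
  .seq leafProg (.seq edgeProg (.seq absorbTable (.seq copyTable
    (.setN 2 (.var 3) (.lit 0) (.lit 0) (.lit 1)))))

/-- The algorithm that decides whether an outcome is in the core. -/
def coreProg : Prog :=
  .seq countProg (.seq initProg (.seq (.loop 16 (.sub .agents (.lit 1)) roundProg) finalProg))

theorem coreProg_static : coreProg.Static := by
  simp [coreProg, roundProg, edgeProg, initProg, countProg, coverProg, sumProg, storeProg, leafProg,
    nbrProg, retProg, retEntry, retCell, outProg, fillProg, fillEntry, absorbTable, absorbCell,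
    absorbLoop, copyTable, finalProg, Prog.Static, NExp.Static, NExp.upto, Prog.upd]

/-! ### Correctness -/

/-- Vectors below one that is supported on two agents have the same form, so the general recursion
for the cover becomes one in two variables. The number `c` need not name an agent: single agents are
treated with `c = n`, and then `e = 0`. -/
theorem Game.isLUB_cover_pair {n : ℕ} (G : Game n) (p : Fin n) {c : ℕ} (hc : c ≠ p) {b e : ℕ}
    (he : n ≤ c → e = 0) :
    IsLUB (insert 0 {r | ∃ b' ≤ b, ∃ e' ≤ e, 1 ≤ b' + e' ∧
      r = G.cover (agentVec n p (b - b') + agentVec n c (e - e')) +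
        G.v (agentVec n p b' + agentVec n c e')})
      (G.cover (agentVec n p b + agentVec n c e)) := by
  refine Eq.subst (motive := fun S => IsLUB (insert 0 S) _) ?_ (isLUB_cover _)
  have hsub : ∀ b' ≤ b, ∀ e' ≤ e, agentVec n p b + agentVec n c e -
      (agentVec n p b' + agentVec n c e') = agentVec n p (b - b') + agentVec n c (e - e') := by
    intro b' hb' e' he'
    funext j
    simp only [Pi.sub_apply, Pi.add_apply, agentVec_apply]
    split_ifs <;> omega
  ext r
  constructor
  · rintro ⟨d, hd, hd0, rfl⟩
    have hdp : d p ≤ b := by simpa [hc.symm] using hd p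
    have hrest : ∀ j : Fin n, j ≠ p → j.val ≠ c → d j = 0 := by
      intro j hj hjc
      have := hd j
      simpa [Fin.val_inj, hj, hjc] using this
    obtain ⟨e', he', hde⟩ : ∃ e' ≤ e, d = agentVec n p (d p) + agentVec n c e' := by
      by_cases hcn : c < n
      · refine ⟨d ⟨c, hcn⟩, by simpa [hc] using hd ⟨c, hcn⟩, ?_⟩
        funext j
        by_cases hj : j = p
        · subst hj; simp [hc.symm]
        by_cases hjc : j.val = c
        · have : j = ⟨c, hcn⟩ := Fin.ext hjc
          subst this; simp [hc]
        · simp [Fin.val_inj, hj, hjc, hrest j hj hjc]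
      · refine ⟨0, Nat.zero_le _, ?_⟩
        funext j
        by_cases hj : j = p
        · subst hj; simp
        · have hjc : j.val ≠ c := by omega
          simp [Fin.val_inj, hj, hrest j hj hjc]
    refine ⟨d p, hdp, e', he', ?_, ?_⟩
    · by_contra hlt
      have h1 : d p = 0 := by omega
      have h2 : e' = 0 := by omega
      exact hd0 (by rw [hde, h1, h2]; simp)
    · rw [← hsub _ hdp _ he', ← hde]
  · rintro ⟨b', hb', e', he', hpos, rfl⟩
    refine ⟨agentVec n p b' + agentVec n c e', fun j => ?_, fun h0 => ?_, ?_⟩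
    · simp only [Pi.add_apply, agentVec_apply]
      split_ifs <;> omega
    · have hp := congrFun h0 p
      have hb0 : b' = 0 := by simpa [hc.symm] using hp
      have hcn : c < n := by
        by_contra hcn
        have := he (by omega)
        omega
      have he0 : e' = 0 := by simpa [hc] using congrFun h0 ⟨c, hcn⟩
      omega
    · rw [hsub _ hb' _ he']

section Correctness

variable {n : ℕ} {G : Game n} {T : SimpleGraph (Fin n)} {A : Arbitration G} {o : Outcome G}

@[simp] theorem oracle_weight (i : Fin n) : (oracle G T A o).weight i = G.W i := by
  simp [oracle]

theorem oracle_weight_of_le {i : ℕ} (h : n ≤ i) : (oracle G T A o).weight i = 0 := by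
  simp [oracle, h.not_gt]

theorem one_le_oracle_edge (i j : Fin n) : 1 ≤ (oracle G T A o).edge i j ↔ T.Adj i j := by
  have h : (∃ (hi : i.val < n) (hj : j.val < n), T.Adj ⟨i, hi⟩ ⟨j, hj⟩) ↔ T.Adj i j :=
    ⟨fun ⟨_, _, h⟩ => h, fun h => ⟨i.2, j.2, h⟩⟩
  rw [← h, oracle]
  dsimp only
  split_ifs with h'
  · exact iff_of_true le_rfl h'
  · exact iff_of_false (by norm_num) h'

/-- The numbers of contributors have been computed. -/
def Counted (O : Oracle) (s : Mem) : Prop :=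
  ∀ k < O.coalitions, s.nat 1 k 0 0 = O.contributors k

theorem coverProg_oracle (s : Mem) (p : Fin n) {c : ℕ} (hp : s.nat 4 0 0 0 = p)
    (hc : s.nat 3 0 0 0 = c) (hne : c ≠ p) :
    ∀ b ≤ G.W p, ∀ e ≤ (oracle G T A o).weight c,
      (coverProg.ex (oracle G T A o) s).real 8 b e 0 =
        G.cover (agentVec n p b + agentVec n c e) := by
  have h := coverProg_spec (oracle G T A o) s hp hc
    (fun b e => G.cover (agentVec n p b + agentVec n c e)) ?_
  · rwa [oracle_weight] at h
  · intro b _ e he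
    refine G.isLUB_cover_pair p hne fun hcn => ?_
    rw [oracle_weight_of_le hcn] at he
    omega

theorem initProg_spec (s : Mem) (hcnt : Counted (oracle G T A o) s) :
    ∀ i : Fin n, ∀ σ < 2, ∀ x ≤ G.W i, (initProg.ex (oracle G T A o) s).real 7 i σ x =
      vertexTerm G (oracle G T A o) i σ x := by
  set O := oracle G T A o with hO
  have main : ∀ i : Fin n, i.val < n → ∀ σ < 2, ∀ x ≤ G.W i,
      (initProg.ex O s).real 7 i σ x = vertexTerm G O i σ x := by
    refine Prog.ex_loop_frame (N := n) (fun m u => ∀ i : Fin n, i.val < m → ∀ σ < 2, ∀ x ≤ G.W i,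
      u.real 7 i σ x = vertexTerm G O i σ x) rfl (fun i hi => absurd hi (Nat.not_lt_zero _)) ?_
    intro i hi u hun _ hu
    simp only [Prog.ex_seq]
    set s₁ := (Prog.setN 3 (.lit 0) (.lit 0) (.lit 0) .agents).ex O
      ((Prog.setN 4 (.lit 0) (.lit 0) (.lit 0) (.var 15)).ex O (u.setNat 15 0 0 0 i)) with hs₁
    have h4 : s₁.nat 4 0 0 0 = i := by simp [hs₁, NExp.eval, NExp.var, Mem.setNat_nat]
    have h3 : s₁.nat 3 0 0 0 = n := by
      simp [hs₁, NExp.eval, hO, oracle]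
    have h15 : s₁.nat 15 0 0 0 = i := by simp [hs₁, Mem.setNat_nat]
    have h1 : s₁.nat 1 = s.nat 1 := by
      rw [hs₁, Prog.ex_nat_eq _ _ _ (by decide), Prog.ex_nat_eq _ _ _ (by decide),
        Mem.setNat_nat_of_ne _ _ _ _ _ (by decide), hun 1 (by decide)]
    have hcov := coverProg_oracle (T := T) (A := A) (o := o) s₁ ⟨i, hi⟩ h4 h3
      (by simpa using hi.ne')
    rw [← hO] at hcov
    set s₂ := coverProg.ex O s₁ with hs₂
    have hsum := sumProg_spec O s₂ (i := i)
      (by rw [hs₂, Prog.ex_nat_eq _ _ _ (by decide), h15])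
      (by rw [hs₂, Prog.ex_nat_eq _ _ _ (by decide), h1]; exact hcnt)
    set s₃ := sumProg.ex O s₂ with hs₃
    have h8 : s₃.real 8 = s₂.real 8 := Prog.ex_real_eq _ _ _ (by decide)
    have hstore := storeProg_spec O s₃ (i := i) (by
      rw [hs₃, Prog.ex_nat_eq _ _ _ (by decide), hs₂, Prog.ex_nat_eq _ _ _ (by decide), h15])
    have hWi : O.weight i = G.W ⟨i, hi⟩ := oracle_weight (⟨i, hi⟩ : Fin n)
    intro j hj σ hσ x hx
    by_cases hji : j.val = i
    · have hj' : j = ⟨i, hi⟩ := Fin.ext hji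
      subst hj'
      have hst := hstore.2 x (by rw [hWi]; omega)
      obtain rfl | rfl : σ = 0 ∨ σ = 1 := by omega
      · rw [hst.1, hsum.2, vertexTerm, if_pos rfl]
      · rw [hst.2, hsum.1, vertexTerm, if_neg one_ne_zero, h8, hcov x hx 0 (Nat.zero_le _)]
        simp
    · rw [hstore.1 j hji, hs₃, Prog.ex_real_eq _ _ _ (by decide), hs₂,
        Prog.ex_real_eq _ _ _ (by decide)]
      exact hu j (by omega) σ hσ x hx
  exact fun i => main i i.2

/-- The covers and payments are computed one after the other in the arrays `8`, `3`, `4` and `5`;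
the frame rules show that each of them survives until `fillProg` collects them. -/
theorem edgeProg_spec (s : Mem) (hcnt : Counted (oracle G T A o) s) {p c : Fin n}
    (hp : s.nat 4 0 0 0 = p) (hc : s.nat 3 0 0 0 = c) (hne : c ≠ p) :
    ∀ σ < 2, ∀ τ < 2, ∀ b ≤ G.W p, ∀ e ≤ G.W c,
      (edgeProg.ex (oracle G T A o) s).real 2 (σ + σ + τ) b e =
        edgeTerm G (oracle G T A o) p c σ τ b e := by
  set O := oracle G T A o with hO
  have hWp : O.weight p = G.W p := oracle_weight p
  have hWc : O.weight c = G.W c := oracle_weight c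
  simp only [edgeProg, Prog.ex_seq]
  have hcov := coverProg_oracle (T := T) (A := A) (o := o) s p hp hc
    (fun h => hne (Fin.ext h))
  rw [← hO, hWc] at hcov
  set s₁ := coverProg.ex O s with hs₁
  have n₁ : ∀ a, a < 10 → s₁.nat a = s.nat a := fun a ha =>
    Prog.ex_nat_eq _ _ _ (by simp [coverProg, Prog.writesN, Prog.upd]; omega)
  have hr₁ := retProg_spec O s₁ (a := 3) (pv := 4) (cv := 3) (i := p) (j := c) (by norm_num)
    (by norm_num) (by rw [n₁ 4 (by norm_num), hp]) (by rw [n₁ 3 (by norm_num), hc])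
    (by rw [n₁ 1 (by norm_num)]; exact hcnt)
  set s₂ := (retProg 3 4 3).ex O s₁ with hs₂
  have n₂ : ∀ a, a < 10 → s₂.nat a = s.nat a := fun a ha => by
    rw [hs₂, Prog.ex_nat_eq _ _ _ (by
      simp [retProg, retEntry, retCell, Prog.writesN, Prog.upd]; omega), n₁ a ha]
  have hr₂ := retProg_spec O s₂ (a := 4) (pv := 3) (cv := 4) (i := c) (j := p) (by norm_num)
    (by norm_num) (by rw [n₂ 3 (by norm_num), hc]) (by rw [n₂ 4 (by norm_num), hp])
    (by rw [n₂ 1 (by norm_num)]; exact hcnt)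
  set s₃ := (retProg 4 3 4).ex O s₂ with hs₃
  have n₃ : ∀ a, a < 10 → s₃.nat a = s.nat a := fun a ha => by
    rw [hs₃, Prog.ex_nat_eq _ _ _ (by
      simp [retProg, retEntry, retCell, Prog.writesN, Prog.upd]; omega), n₂ a ha]
  have hout := outProg_spec O s₃ (p := p) (c := c) (by rw [n₃ 4 (by norm_num), hp])
    (by rw [n₃ 3 (by norm_num), hc]) (by rw [n₃ 1 (by norm_num)]; exact hcnt)
  set s₄ := outProg.ex O s₃ with hs₄
  have n₄ : ∀ a, a < 10 → s₄.nat a = s.nat a := fun a ha => by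
    rw [hs₄, Prog.ex_nat_eq _ _ _ (by simp [outProg, Prog.writesN]; omega), n₃ a ha]
  have hfill := fillProg_spec O s₄ (p := p) (c := c) (by rw [n₄ 4 (by norm_num), hp])
    (by rw [n₄ 3 (by norm_num), hc])
  have r4 : s₄.real 4 = s₃.real 4 := Prog.ex_real_eq _ _ _ (by decide)
  have r3 : s₄.real 3 = s₂.real 3 := by
    rw [hs₄, Prog.ex_real_eq _ _ _ (by decide), hs₃, Prog.ex_real_eq _ _ _ (by decide)]
  have r8 : s₄.real 8 = s₁.real 8 := by
    rw [hs₄, Prog.ex_real_eq _ _ _ (by decide), hs₃, Prog.ex_real_eq _ _ _ (by decide), hs₂,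
      Prog.ex_real_eq _ _ _ (by decide)]
  intro σ hσ τ hτ b hb e he
  rw [hfill _ (by omega) b (by omega) e (by omega), edgeTerm, fillValue]
  obtain rfl | rfl : σ = 0 ∨ σ = 1 := by omega
  · obtain rfl | rfl : τ = 0 ∨ τ = 1 := by omega
    · simpa using hout
    · simp [r4, (hr₂ e (by omega)).csSup_eq]
  · obtain rfl | rfl : τ = 0 ∨ τ = 1 := by omega
    · simp [r3, (hr₁ b (by omega)).csSup_eq]
    · simp [r8, hcov b hb e he]

/-- The agents that have not been eliminated. -/
def remaining (n : ℕ) (s : Mem) : Finset (Fin n) :=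
  Finset.univ.filter (fun i => s.nat 2 i 0 0 = 0)

/-- The vertex terms in the memory. -/
def memTerm (n : ℕ) (s : Mem) (i : Fin n) (σ x : ℕ) : ℝ := s.real 7 i σ x

theorem leafPair_iff {s : Mem} (c p : Fin n) :
    LeafPair (oracle G T A o) (fun i => s.nat 2 i 0 0 = 0) c p ↔
      IsLeaf T (remaining n s) c p := by
  constructor
  · rintro ⟨_, hc, _, hp, hadj, hu⟩
    refine ⟨by simpa [remaining] using hc, by simpa [remaining] using hp,
      (one_le_oracle_edge c p).1 hadj, fun j hj hcj => ?_⟩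
    exact Fin.ext (hu j j.2 (by simpa [remaining] using hj) ((one_le_oracle_edge c j).2 hcj))
  · rintro ⟨hc, hp, hadj, hu⟩
    refine ⟨c.2, by simpa [remaining] using hc, p.2, by simpa [remaining] using hp,
      (one_le_oracle_edge c p).2 hadj, fun j hj hj0 hcj => ?_⟩
    exact congrArg Fin.val (hu ⟨j, hj⟩ (by simpa [remaining] using hj0)
      ((one_le_oracle_edge (A := A) (o := o) c ⟨j, hj⟩).1 hcj))

variable [DecidableRel T.Adj]

/-- The memory holds correct vertex terms only for the two states and for budgets within the
weights; a feasible choice evaluates them nowhere else. -/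
theorem nonPos_congr {W : Fin n → ℕ} {R : Finset (Fin n)} {φ φ' : Fin n → ℕ → ℕ → ℝ}
    {Θ : Fin n → Fin n → ℕ → ℕ → ℕ → ℕ → ℝ}
    (h : ∀ i, ∀ σ < 2, ∀ x ≤ W i, φ i σ x = φ' i σ x) :
    NonPos T W R φ Θ ↔ NonPos T W R φ' Θ := by
  refine forall_congr' fun σ => forall_congr' fun x => forall_congr' fun b => forall_congr' fun hF => ?_
  have : objective T R φ Θ σ x b = objective T R φ' Θ σ x b := by
    unfold objective
    rw [Finset.sum_congr rfl fun i hi => h i (σ i) (hF i hi).1 (x i) (by have := (hF i hi).2; omega)]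
  rw [this]

/-- One round carries out `IsLeaf.nonPos_erase`: the new table of the neighbour is the `φ'` of that
lemma, and the tables of all other agents are unchanged. -/
theorem roundProg_spec (s : Mem) (hcnt : Counted (oracle G T A o) s)
    (hleaf : ∃ c p, IsLeaf T (remaining n s) c p) :
    ∃ c p, IsLeaf T (remaining n s) c p ∧
      remaining n (roundProg.ex (oracle G T A o) s) = (remaining n s).erase c ∧
      (NonPos T G.W (remaining n s) (memTerm n s) (edgeTerm G (oracle G T A o)) ↔
        NonPos T G.W ((remaining n s).erase c) (memTerm n (roundProg.ex (oracle G T A o) s))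
          (edgeTerm G (oracle G T A o))) := by
  set O := oracle G T A o with hO
  have hlp : ∃ c p, LeafPair O (fun i => s.nat 2 i 0 0 = 0) c p := by
    obtain ⟨c, p, h⟩ := hleaf
    exact ⟨c, p, (leafPair_iff c p).2 h⟩
  have hfound := leafProg_spec O s hlp
  simp only [roundProg, Prog.ex_seq]
  set s₁ := leafProg.ex O s with hs₁
  obtain ⟨c, hc⟩ : ∃ c : Fin n, s₁.nat 3 0 0 0 = c := ⟨⟨_, hfound.lt⟩, rfl⟩
  obtain ⟨p, hp⟩ : ∃ p : Fin n, s₁.nat 4 0 0 0 = p := ⟨⟨_, hfound.nbr_lt⟩, rfl⟩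
  rw [hc, hp] at hfound
  have hl : IsLeaf T (remaining n s) c p := (leafPair_iff c p).1 hfound
  have hWp : O.weight p = G.W p := oracle_weight p
  have hWc : O.weight c = G.W c := oracle_weight c
  have hcnt₁ : Counted O s₁ := by
    intro k hk
    rw [hs₁, Prog.ex_nat_eq _ _ _ (by decide)]
    exact hcnt k hk
  have hedge := edgeProg_spec s₁ hcnt₁ hp hc hl.adj.ne
  rw [← hO] at hedge
  set s₂ := edgeProg.ex O s₁ with hs₂
  have hp₂ : s₂.nat 4 0 0 0 = p := by rw [hs₂, Prog.ex_nat_eq _ _ _ (by decide), hp]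
  have hc₂ : s₂.nat 3 0 0 0 = c := by rw [hs₂, Prog.ex_nat_eq _ _ _ (by decide), hc]
  have htab := absorbTable_spec O s₂ hp₂ hc₂
  have h7₂ : s₂.real 7 = s.real 7 := by
    rw [hs₂, Prog.ex_real_eq _ _ _ (by decide), hs₁, Prog.ex_real_eq _ _ _ (by decide)]
  set s₃ := absorbTable.ex O s₂ with hs₃
  have hcopy := copyTable_spec O s₃ (p := p)
    (by rw [hs₃, Prog.ex_nat_eq _ _ _ (by decide), hp₂])
  have h7₃ : s₃.real 7 = s.real 7 := by rw [hs₃, Prog.ex_real_eq _ _ _ (by decide), h7₂]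
  set s₄ := copyTable.ex O s₃ with hs₄
  have h2₄ : s₄.nat 2 = s.nat 2 := by
    rw [hs₄, Prog.ex_nat_eq _ _ _ (by decide), hs₃, Prog.ex_nat_eq _ _ _ (by decide), hs₂,
      Prog.ex_nat_eq _ _ _ (by decide), hs₁, Prog.ex_nat_eq _ _ _ (by decide)]
  have hc₄ : s₄.nat 3 0 0 0 = c := by
    rw [hs₄, Prog.ex_nat_eq _ _ _ (by decide), hs₃, Prog.ex_nat_eq _ _ _ (by decide), hc₂]
  refine ⟨c, p, hl, ?_, ?_⟩
  · ext i
    simp only [remaining, Prog.ex_setN, NExp.eval, NExp.var, hc₄, Mem.setNat_nat, h2₄,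
      Finset.mem_filter, Finset.mem_univ, true_and, Finset.mem_erase, Fin.val_inj, and_true]
    by_cases hi : i = c
    · simp [hi]
    · simp [hi]
  · refine hl.nonPos_erase (fun i j σ τ b e => edgeTerm_comm G O i j σ τ b e) ?_ ?_
    · intro i hi
      funext σ x
      simp only [memTerm, Prog.ex_setN, Mem.setNat_real]
      rw [hcopy.1 i (fun h => hi (Fin.ext h)), h7₃]
    · intro σ hσ x hx
      have hbest := htab σ hσ x (by omega)
      rw [← hcopy.2 σ hσ x (by omega)] at hbest
      simp only [memTerm, Prog.ex_setN, Mem.setNat_real]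
      refine Eq.subst (motive := fun S => IsGreatest S _) ?_ hbest
      ext r
      have hval : ∀ b ≤ x, ∀ τ < 2, ∀ e ≤ G.W c, candValue O s₂ p c σ x b τ e =
          s.real 7 p σ (x - b) + edgeTerm G O p c σ τ b e + s.real 7 c τ (G.W c - e) := by
        intro b hb τ hτ e he
        rw [candValue, hedge σ hσ τ hτ b (by omega) e he, h7₂, hWc]
      constructor
      · rintro ⟨b, hb, τ, hτ, e, he, rfl⟩
        exact ⟨b, hb, τ, hτ, e, by omega, hval b hb τ hτ e (by omega)⟩
      · rintro ⟨b, hb, τ, hτ, e, he, rfl⟩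
        exact ⟨b, hb, τ, hτ, e, by omega, (hval b hb τ hτ e he).symm⟩

theorem coreProg_accepts (h2 : G.IsKOCF 2) (hT : T.IsTree) (hG : G.reduce T = G) (hA : A.IsLocal)
    (hadm : A.Admissible T o) : coreProg.Accepts (oracle G T A o) ↔ A.InCore o := by
  set O := oracle G T A o with hO
  have hstart : A.InCore o ↔ NonPos T G.W Finset.univ (vertexTerm G O) (edgeTerm G O) :=
    ⟨nonPos_of_inCore hA hadm, inCore_of_nonPos h2 hG hA hadm⟩
  -- A tree has a vertex; this is needed for `n - (n - 1) = 1`, so that exactly one agent is left in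
  -- the end.
  have hn : 1 ≤ n := by
    obtain ⟨i⟩ := hT.connected.nonempty
    exact i.pos
  have hacc : coreProg.Accepts O ↔ (coreProg.ex O Mem.init).nat 0 0 0 0 = 1 := Iff.rfl
  rw [hacc, coreProg, Prog.ex_seq, Prog.ex_seq, Prog.ex_seq, finalProg_spec]
  have hcnt₁ : Counted O (countProg.ex O Mem.init) := countProg_spec O Mem.init
  set s₁ := countProg.ex O Mem.init with hs₁
  have hinit := initProg_spec s₁ hcnt₁
  rw [← hO] at hinit
  set s₂ := initProg.ex O s₁ with hs₂
  have hcnt₂ : Counted O s₂ := by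
    intro k hk
    rw [hs₂, Prog.ex_nat_eq _ _ _ (by decide)]
    exact hcnt₁ k hk
  have hrem₂ : remaining n s₂ = Finset.univ := by
    have : s₂.nat 2 = Mem.init.nat 2 := by
      rw [hs₂, Prog.ex_nat_eq _ _ _ (by decide), hs₁, Prog.ex_nat_eq _ _ _ (by decide)]
    simp [remaining, this, Mem.init]
  set s₃ := (Prog.loop 16 (.sub .agents (.lit 1)) roundProg).ex O s₂ with hs₃
  -- Connectedness and the cardinality, which is at least two before each round, supply the next
  -- leaf. The core condition stays equivalent to the problem on the remaining tree.
  have hloop : (T.induce (remaining n s₃ : Set (Fin n))).Preconnected ∧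
      (remaining n s₃).card = n - (n - 1) ∧
      (A.InCore o ↔ NonPos T G.W (remaining n s₃) (memTerm n s₃) (edgeTerm G O)) := by
    refine Prog.ex_loop_frame (N := n - 1) (fun m u =>
      (T.induce (remaining n u : Set (Fin n))).Preconnected ∧ (remaining n u).card = n - m ∧
      (A.InCore o ↔ NonPos T G.W (remaining n u) (memTerm n u) (edgeTerm G O))) rfl ?_ ?_
    · rw [hrem₂]
      refine ⟨?_, by simp, ?_⟩
      · rw [Finset.coe_univ]
        exact ((SimpleGraph.induceUnivIso T).connected_iff.2 hT.connected).preconnected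
      · rw [hstart]
        exact nonPos_congr fun i σ hσ x hx => (hinit i σ hσ x hx).symm
    · rintro m hm u hun _ ⟨hu1, hu2, hu3⟩
      have hrem : remaining n (u.setNat 16 0 0 0 m) = remaining n u := by
        simp [remaining, Mem.setNat_nat]
      have hterm : memTerm n (u.setNat 16 0 0 0 m) = memTerm n u := rfl
      have hcnt : Counted O (u.setNat 16 0 0 0 m) := by
        intro k hk
        rw [Mem.setNat_nat_of_ne _ _ _ _ _ (by decide), hun 1 (by decide)]
        exact hcnt₂ k hk
      obtain ⟨c, p, hl, hr, hiff⟩ := roundProg_spec (u.setNat 16 0 0 0 m) hcnt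
        (by rw [hrem]; exact exists_isLeaf hT.isAcyclic hu1 (by omega))
      rw [hrem] at hl hr hiff
      rw [← hO] at hr hiff
      rw [hr]
      refine ⟨hl.preconnected_erase hu1, ?_, ?_⟩
      · rw [Finset.card_erase_of_mem hl.mem, hu2]
        omega
      · rw [hu3, ← hiff, hterm]
  obtain ⟨r, hr⟩ := Finset.card_eq_one.1 (hloop.2.1.trans (by omega))
  rw [hloop.2.2, hr, nonPos_singleton]
  have hmem : ∀ i : Fin n, s₃.nat 2 i 0 0 = 0 ↔ i = r := by
    intro i
    have : i ∈ remaining n s₃ ↔ i = r := by rw [hr, Finset.mem_singleton]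
    simpa [remaining] using this
  constructor
  · intro h
    have := h r r.2 ((hmem r).2 rfl)
    rwa [oracle_weight] at this
  · intro h i hi hi0
    obtain rfl : ⟨i, hi⟩ = r := (hmem ⟨i, hi⟩).1 hi0
    have hW : O.weight i = G.W ⟨i, hi⟩ := oracle_weight (⟨i, hi⟩ : Fin n)
    rw [hW]
    exact h

omit [DecidableRel T.Adj] in
theorem coreProg_time : coreProg.time (oracle G T A o) ≤
    MvPolynomial.eval ![n, G.maxWeight] coreProg.timeBound := by
  have hmax : ∀ i, G.W i ≤ G.maxWeight := fun i => Finset.le_sup (Finset.mem_univ i)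
  refine coreProg_static.time_le le_rfl (fun i => ?_) ?_ _
  · by_cases hi : i < n
    · exact (oracle_weight (⟨i, hi⟩ : Fin n)).le.trans (hmax _)
    · rw [oracle_weight_of_le (by omega)]
      exact Nat.zero_le _
  -- Each coalition has a contributor and thus uses at least one unit of the total weight.
  · change o.m ≤ n * G.maxWeight
    calc o.m = ∑ _k : Fin o.m, 1 := by simp
      _ ≤ ∑ k : Fin o.m, ∑ i, o.coal k i := by
          refine Finset.sum_le_sum fun k _ => ?_
          obtain ⟨i, hi⟩ := o.coal_nonempty k
          exact (mem_supp.1 hi).trans_le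
            (Finset.single_le_sum (f := o.coal k) (fun _ _ => Nat.zero_le _) (Finset.mem_univ i))
      _ = ∑ i, ∑ k, o.coal k i := Finset.sum_comm
      _ ≤ ∑ _i : Fin n, G.maxWeight :=
          Finset.sum_le_sum fun i _ => (o.weight_le i).trans (hmax i)
      _ = n * G.maxWeight := by simp

end Correctness

end OCF

theorem mainTheorem3 :
    ∃ (p : OCF.Prog) (P : MvPolynomial (Fin 2) ℕ),
      ∀ (n : ℕ) (G : OCF.Game n) (T : SimpleGraph (Fin n)) (A : OCF.Arbitration G)
        (o : OCF.Outcome G),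
        G.IsKOCF 2 → T.IsTree → G.reduce T = G → A.IsLocal → A.Admissible T o →
          (p.Accepts (OCF.oracle G T A o) ↔ A.InCore o) ∧
            p.time (OCF.oracle G T A o) ≤ MvPolynomial.eval ![n, G.maxWeight] P := by
  classical
  exact ⟨OCF.coreProg, OCF.coreProg.timeBound, fun n G T A o h2 hT hG hA hadm =>
    ⟨OCF.coreProg_accepts h2 hT hG hA hadm, OCF.coreProg_time⟩⟩
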